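/- Let $d\ge 2$ and $n\ge 1$, and let $V=(v_i^{(j)})\in\mathbb{R}^{d\times n}$ be a matrix with real entries. For a point $x$ of the tropical projective torus $\mathbb{R}^d/\mathbb{R}\mathbf{1}$ (with the quotient topology) let its covector be $G(x)=(G_1(x),\dots,G_d(x))$, where $$G_i(x)=\bigl\{j\in[n] : x_i-v_i^{(j)}=\min_{k}(x_k-v_k^{(j)})\bigr\}.$$ For a covector $H=(H_1,\dots,H_d)$ (that is, $H=G(y)$ for some point $y$) let $X_H=\{x : G_i(x)\supseteq H_i \text{ for all } i\}$ be its covector cell, and call $(|H_1|,\dots,|H_d|)$ the coarse type of $X_H$. The covector decomposition $\mathcal{C}(V)$ is the set of all cells $X_H$, where $H$ ranges over the covectors. Its one-point compactification consists of the closures of the cells $X_H$ in the one-point compactification $(\mathbb{R}^d/\mathbb{R}\mathbf{1})\cup\{\infty\}$ together with the $0$-dimensional cell $\{\infty\}$; so bounded cells are unchanged, and unbounded cells receive the point $\infty$. A regular cell complex is a finite family of closed balls in a Hausdorff space whose interiors partition the space and such that the boundary of each ball is a union of members of the family. The boundary complex $\partial\sigma$ of a cell $\sigma$ consists of the cells properly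 contained in $\sigma$. A total ordering $\sigma_1,\dots,\sigma_m$ of the maximal cells of a regular cell complex is (recursively) a shelling if either the complex has dimension $0$, or the following hold: (S1) $\partial\sigma_1$ has a shelling; (S2) for $2\le j\le m$ the complex $\partial\sigma_j\cap\bigcup_{k<j}\partial\sigma_k$ is pure of dimension $\dim\sigma_j-1$; (S3) for $2\le j\le m$ there is a shelling of $\partial\sigma_j$ in which the maximal cells of $\partial\sigma_j\cap\bigcup_{k<j}\partial\sigma_k$ appear first. Theorem. The one-point compactification of $\mathcal{C}(V)$ is a regular cell complex. Distinct maximal cells of $\mathcal{C}(V)$ have distinct coarse types. If the maximal cells of $\mathcal{C}(V)$ are listed in increasing lexicographic order of their coarse types, then their closures in $(\mathbb{R}^d/\mathbb{R}\mathbf{1})\cup\{\infty\}$, in this order, form a shelling of the one-point compactification of $\mathcal{C}(V)$. -/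

import Mathlib

/-- A (finite) regular cell complex: a finite family of closed balls in a Hausdorff space `X` whose
interiors partition `X`, such that the boundary sphere of each ball is a union of members of the
family. `cells` is the set of all closed cells; the boundary sphere of a cell `σ` is the union of
all cells that are properly contained in `σ`. -/
structure RegularCellComplex (X : Type*) [TopologicalSpace X] where
  cells : Set (Set X)
  /-- The dimension of a cell (the values outside `cells` are irrelevant). -/
  dim : Set X → ℕ
  t2Space : T2Space X
  finite_cells : cells.Finite
  exists_homeomorph : ∀ σ ∈ cells,
    ∃ e : Metric.closedBall (0 : EuclideanSpace ℝ (Fin (dim σ))) 1 ≃ₜ σ,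
      (fun x => (e x : X)) '' {x | ‖(x : EuclideanSpace ℝ (Fin (dim σ)))‖ = 1}
        = ⋃₀ {τ | τ ∈ cells ∧ τ ⊂ σ}
  existsUnique_open_cell : ∀ x : X, ∃! σ : Set X, σ ∈ cells ∧ x ∈ σ \ ⋃₀ {τ | τ ∈ cells ∧ τ ⊂ σ}

namespace RegularCellComplex

variable {X : Type*} [TopologicalSpace X]

/-- The boundary complex `∂σ` of a cell `σ`, as a set of cells. -/
def boundary (K : RegularCellComplex X) (σ : Set X) : Set (Set X) :=
  {τ | τ ∈ K.cells ∧ τ ⊂ σ}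

/-- A set of cells is pure of dimension `r` if all its maximal cells have dimension `r`; the empty
complex is pure of dimension `-1` only. -/
def IsPureOfDim (K : RegularCellComplex X) (S : Set (Set X)) (r : ℤ) : Prop :=
  (∀ τ, Maximal (fun ρ => ρ ∈ S) τ → (K.dim τ : ℤ) = r) ∧ (S = ∅ → r = -1)

/-- The list `l` is a total ordering of the maximal cells of the complex `S`. -/
def IsOrderingOfMaximalCells (S : Set (Set X)) (l : List (Set X)) : Prop :=
  l.Nodup ∧ ∀ σ, σ ∈ l ↔ Maximal (fun ρ => ρ ∈ S) σ

/-- The complex `∂σⱼ ∩ (⋃ₖ ∂σₖ)`, where `k < j`, for a list `l` of cells `σ₀, σ₁, …`. -/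
def attaching (K : RegularCellComplex X) (l : List (Set X)) (j : Fin l.length) : Set (Set X) :=
  K.boundary l[j] ∩ {τ | ∃ k : Fin l.length, k < j ∧ τ ∈ K.boundary l[k]}

/-- `K.IsShelling S l`: the list `l` is a shelling of the subcomplex of `K` with the set of cells
`S` (in the not necessarily pure sense of Björner and Wachs). Either the subcomplex has
dimension zero, or
* the boundary of every cell `σⱼ` of the list has a shelling `b j`,
* for every `j` except the first, the complex `∂σⱼ ∩ (⋃ₖ ∂σₖ)`, `k < j`, is pure of
  dimension `dim σⱼ - 1`, and its maximal cells come first in the shelling `b j` of `∂σⱼ`. -/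
inductive IsShelling (K : RegularCellComplex X) : Set (Set X) → List (Set X) → Prop
  | dim_zero (S : Set (Set X)) (l : List (Set X))
      (ordering : IsOrderingOfMaximalCells S l)
      (dim_eq : ∀ σ ∈ S, K.dim σ = 0) : IsShelling K S l
  | step (S : Set (Set X)) (l : List (Set X))
      (ordering : IsOrderingOfMaximalCells S l)
      (b : Fin l.length → List (Set X))
      (shelling_boundary : ∀ j : Fin l.length, IsShelling K (K.boundary l[j]) (b j))
      (pure : ∀ j : Fin l.length, 0 < (j : ℕ) →
        K.IsPureOfDim (K.attaching l j) ((K.dim l[j] : ℤ) - 1))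
      (initial : ∀ j : Fin l.length, 0 < (j : ℕ) →
        ∃ r : ℕ, ∀ τ, τ ∈ (b j).take r ↔ Maximal (fun ρ => ρ ∈ K.attaching l j) τ) :
      IsShelling K S l

end RegularCellComplex

/-- The tropical projective torus `ℝᵈ / ℝ𝟏`. -/
abbrev TropicalTorus (d : ℕ) : Type :=
  (Fin d → ℝ) ⧸ Submodule.span ℝ {(1 : Fin d → ℝ)}

/-- The covector `(G₁(x), …, G_d(x))` of a point with representative `x ∈ ℝᵈ`: the set `Gᵢ(x)`
consists of all `j` for which the minimum of `x k - V k j` over all `k` is attained at `k = i`. -/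
def covector {d n : ℕ} (V : Matrix (Fin d) (Fin n) ℝ) (x : Fin d → ℝ) : Fin d → Set (Fin n) :=
  fun i => {j | ∀ k, x i - V i j ≤ x k - V k j}

/-- The covector only depends on the class of `x` in the tropical projective torus. -/
theorem covector_eq_of_mk_eq {d n : ℕ} (V : Matrix (Fin d) (Fin n) ℝ) (x y : Fin d → ℝ)
    (h : (Submodule.Quotient.mk x : TropicalTorus d) = Submodule.Quotient.mk y) :
    covector V x = covector V y := by
  rw [Submodule.Quotient.eq, Submodule.mem_span_singleton] at h
  obtain ⟨c, hc⟩ := h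
  have key : ∀ i, x i = y i + c := fun i => by
    have := congrFun hc i
    simp at this
    linarith
  funext i
  ext j
  simp only [covector, Set.mem_ofPred_eq, key]
  exact forall_congr' fun k => by constructor <;> intro h <;> linarith

/-- The covector of a point of the tropical projective torus. -/
def TropicalTorus.covector {d n : ℕ} (V : Matrix (Fin d) (Fin n) ℝ) (p : TropicalTorus d) :
    Fin d → Set (Fin n) :=
  Quotient.liftOn' p (_root_.covector V) fun x y h =>
    covector_eq_of_mk_eq V x y (Quotient.sound' h)

/-- The covector cell `X_H`: all points whose covector contains `H` componentwise. -/
def covectorCell {d n : ℕ} (V : Matrix (Fin d) (Fin n) ℝ) (H : Fin d → Set (Fin n)) :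
    Set (TropicalTorus d) :=
  {p | ∀ i, H i ⊆ TropicalTorus.covector V p i}

/-- The covector decomposition: the cells `X_H`, where `H` ranges over the covectors of points. -/
def covectorDecomposition {d n : ℕ} (V : Matrix (Fin d) (Fin n) ℝ) : Set (Set (TropicalTorus d)) :=
  {σ | ∃ H ∈ Set.range (TropicalTorus.covector V), covectorCell V H = σ}

/-- The covectors of the maximal cells of the covector decomposition. -/
def IsMaximalCovector {d n : ℕ} (V : Matrix (Fin d) (Fin n) ℝ) (H : Fin d → Set (Fin n)) : Prop :=
  H ∈ Set.range (TropicalTorus.covector V) ∧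
    Maximal (fun σ => σ ∈ covectorDecomposition V) (covectorCell V H)

/-- The coarse type `(|H₁|, …, |H_d|)` of a covector, with the lexicographic order. -/
noncomputable def coarseType {d n : ℕ} (H : Fin d → Set (Fin n)) : Lex (Fin d → ℕ) :=
  toLex fun i => (H i).ncard

/-- The closure of a cell of the torus in the one-point compactification of the torus: a bounded
cell stays as it is, and an unbounded cell receives the additional point `∞`. -/
def compactifiedCell {d : ℕ} (σ : Set (TropicalTorus d)) : Set (OnePoint (TropicalTorus d)) :=
  closure ((OnePoint.some : TropicalTorus d → OnePoint (TropicalTorus d)) '' σ)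

/-- The cells of the one-point compactification of the covector decomposition: the compactified
covector cells and the vertex `∞`. -/
def compactifiedDecomposition {d n : ℕ} (V : Matrix (Fin d) (Fin n) ℝ) :
    Set (Set (OnePoint (TropicalTorus d))) :=
  compactifiedCell '' covectorDecomposition V ∪ {{OnePoint.infty}}

/-! ### Small perturbations and hyperplane sections of subspaces -/

open Filter Topology
set_option linter.unusedSectionVars false

/-! The function `y ↦ ∑ j, min_k (y k - V k j)` is concave, piecewise linear and has slope `n` along
the diagonal. The boundary of the polyhedron on which it is nonnegative is therefore a graph over
the torus, and its proper faces project to the covector cells: the inequality with index `κ : Fin n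
→ Fin d` is tight exactly if `κ j` attains the `j`-th minimum for every `j` (`mem_tight_iff`).
Facets correspond to maximal cells (`isMaximalCovector_iff`). A facet has a single tight `κ`, and
its coarse type is the normal vector of that inequality up to sign, so two facets with the same
coarse type would be parallel and hence equal (`eq_of_coarseType_eq`).

The shelling is a Bruggesser–Mani line shelling of this polyhedron, carried out in homogeneous
coordinates. A facet is visible from `w + r • p` exactly if its parameter exceeds `r`
(`sweepParam_lt_iff`). So each facet is attached to the earlier ones along its own facets that are
visible from the point where the line meets its span (`maximal_attaching_iff`). Induction on the
dimension gives shellings of the boundary of every face that begin with the facets visible from a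
given point (`hasVisibleShellings`).

The polyhedron is unbounded, and all its unbounded faces share the point `∞`. A functional `h` is
chosen that is positive on bounded faces and negative on nonzero recession directions, so that the
hyperplane `h = 0` meets the relative interior of every unbounded face and misses the bounded ones
(`exists_center`). For unbounded faces the sweeping lines are kept inside this hyperplane. Then
facets hit within it are unbounded, and `∞` lies in a visible facet whenever it lies in the
attaching complex (`exists_visible_unbdd_facet`). A generic `h` leaves room in the hyperplane for
lines that meet distinct facets at distinct parameters (`exists_sweep`).

The lexicographic order comes from a direction `w` with coordinates `(n + 1) ^ rev i`: coarse types
are read as digits in base `n + 1`. The homogenizing coordinates `α` of `p` and `β` of `w` are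
forced by `h p = h w = 0` and become small when the leading coefficient of `h` is large; the
parameter of `κ` is then close to `-weight κ / n` (`sweepParam_lt_of_weight_lt`).

Regularity is proved directly: a covector cell is the product of a compact convex body and an
orthant (`exists_cell_homeomorph`). With a trivial orthant it is already a ball; otherwise it is a
closed half-space, which an inversion identifies with a closed ball minus a boundary point, and `∞`
fills the gap. -/

theorem eventually_add_mul_neg {A : ℝ} (B : ℝ) (hA : A < 0) :
    ∀ᶠ ε in 𝓝[>] (0 : ℝ), A + ε * B < 0 := by
  have h : Tendsto (fun ε : ℝ => A + ε * B) (𝓝 0) (𝓝 (A + 0 * B)) := by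
    apply Continuous.tendsto; fun_prop
  rw [zero_mul, add_zero] at h
  exact (h.mono_left nhdsWithin_le_nhds).eventually_lt_const hA

theorem eventually_add_mul_pos {A : ℝ} (B : ℝ) (hA : 0 < A) :
    ∀ᶠ ε in 𝓝[>] (0 : ℝ), 0 < A + ε * B := by
  filter_upwards [eventually_add_mul_neg (-B) (neg_neg_of_pos hA)] with ε h
  linarith

theorem eventually_add_mul_ne (A : ℝ) {B : ℝ} (h : B ≠ 0) :
    ∀ᶠ ε in 𝓝[>] (0 : ℝ), A + ε * B ≠ 0 := by
  by_cases hA : A = 0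
  · filter_upwards [self_mem_nhdsWithin] with ε hε
    rw [hA, zero_add]
    exact mul_ne_zero (ne_of_gt hε) h
  · rcases lt_or_gt_of_ne hA with hA | hA
    · filter_upwards [eventually_add_mul_neg B hA] with ε hε using hε.ne
    · filter_upwards [eventually_add_mul_pos B hA] with ε hε using hε.ne'

theorem finrank_inf_ker_add_one {V : Type*} [AddCommGroup V] [Module ℝ V] [FiniteDimensional ℝ V]
    (W : Submodule ℝ V) (f : V →ₗ[ℝ] ℝ) {x : V} (hx : x ∈ W) (hfx : f x ≠ 0) :
    Module.finrank ℝ ↥(W ⊓ LinearMap.ker f) + 1 = Module.finrank ℝ W := by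
  have hne : f.domRestrict W ≠ 0 := fun h => hfx (by simpa using LinearMap.congr_fun h ⟨x, hx⟩)
  rw [← Module.Dual.finrank_ker_add_one_of_ne_zero hne, add_left_inj]
  rw [← Submodule.finrank_map_subtype_eq]
  have key : W ⊓ LinearMap.ker f = (LinearMap.ker (f.domRestrict W)).map W.subtype := by
    ext v
    simp [and_comm]
  rw [key]

/-! ### Faces of polyhedra in homogeneous coordinates -/

/-- A homogenized finite system of linear inequalities `a t v ≤ 0`, with the homogenizing
coordinate `z`. The points of the polyhedron are represented by the solutions with `0 < z v`. -/
structure HomogenizedSystem (V I : Type*) [AddCommGroup V] [Module ℝ V] where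
  z : V →ₗ[ℝ] ℝ
  a : I → V →ₗ[ℝ] ℝ

namespace HomogenizedSystem

variable {V I : Type*} [AddCommGroup V] [Module ℝ V] (P : HomogenizedSystem V I)

/-- The vector represents a point of the polyhedron. -/
def IsPt (v : V) : Prop := 0 < P.z v ∧ ∀ t, P.a t v ≤ 0

/-- The inequalities that hold with equality. -/
def tight (v : V) : Set I := {t | P.a t v = 0}

/-- The linear span of the face whose relative interior contains the given point. -/
def faceSpan (v : V) : Submodule ℝ V := ⨅ t ∈ P.tight v, LinearMap.ker (P.a t)

/-- The face of the given point contains a ray. -/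
def Unbdd (v : V) : Prop := ∃ u ∈ P.faceSpan v, u ≠ 0 ∧ P.z u = 0 ∧ ∀ t, P.a t u ≤ 0

/-- The point `y` lies in the relative interior of a facet of the face of `x`. -/
def IsFacet (y x : V) : Prop :=
  P.IsPt y ∧ P.tight x ⊆ P.tight y ∧
    Module.finrank ℝ (P.faceSpan y) + 1 = Module.finrank ℝ (P.faceSpan x)

/-- The polyhedron contains no line. -/
def Pointed : Prop := ∀ u, P.z u = 0 → (∀ t, P.a t u = 0) → u = 0

/-- The functional `h` is positive on bounded faces and negative on the recession cone. -/
def Separates (h : V →ₗ[ℝ] ℝ) : Prop :=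
  (∀ u, u ≠ 0 → P.z u = 0 → (∀ t, P.a t u ≤ 0) → h u < 0) ∧
    ∀ y, P.IsPt y → ¬ P.Unbdd y → 0 < h y

/-- No face of dimension at least two has a span on which `h` is a combination of two of the
functionals of the system. -/
def IsGeneric (h : V →ₗ[ℝ] ℝ) : Prop :=
  ∀ x, P.IsPt x → 3 ≤ Module.finrank ℝ (P.faceSpan x) →
    ∀ t s, ∃ v ∈ P.faceSpan x, P.a t v = 0 ∧ P.a s v = 0 ∧ h v ≠ 0

variable {P}

theorem mem_tight {v : V} {t : I} : t ∈ P.tight v ↔ P.a t v = 0 := Iff.rfl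

theorem mem_faceSpan {v w : V} : w ∈ P.faceSpan v ↔ ∀ t ∈ P.tight v, P.a t w = 0 := by
  simp [faceSpan, Submodule.mem_iInf]

theorem self_mem_faceSpan (v : V) : v ∈ P.faceSpan v := mem_faceSpan.2 fun _ h => h

theorem faceSpan_mono {x y : V} (h : P.tight x ⊆ P.tight y) : P.faceSpan y ≤ P.faceSpan x :=
  fun _ hw => mem_faceSpan.2 fun t ht => mem_faceSpan.1 hw t (h ht)

theorem faceSpan_congr {x y : V} (h : P.tight x = P.tight y) : P.faceSpan x = P.faceSpan y :=
  le_antisymm (faceSpan_mono h.ge) (faceSpan_mono h.le)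

theorem IsPt.neg_of_notMem {v : V} (h : P.IsPt v) {t : I} (ht : t ∉ P.tight v) : P.a t v < 0 :=
  lt_of_le_of_ne (h.2 t) ht

theorem Unbdd.mono {x y : V} (h : P.tight x ⊆ P.tight y) : P.Unbdd y → P.Unbdd x :=
  fun ⟨u, hu, h'⟩ => ⟨u, faceSpan_mono h hu, h'⟩

theorem IsFacet.ssubset {x y : V} (h : P.IsFacet y x) : P.tight x ⊂ P.tight y := by
  refine lt_of_le_of_ne h.2.1 fun h' => ?_
  have := h.2.2
  rw [faceSpan_congr h'] at this
  omega

section Finite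

variable [Finite I]

/-- The first inequality from the set `T` that the ray from `p` in the direction `w` violates. -/
theorem exists_first_hit (T : Set I) {p w : V} (hp : ∀ s ∈ T, 0 < P.a s w → P.a s p < 0)
    (hp' : ∀ s ∈ T, P.a s p ≤ 0) {t : I} (htT : t ∈ T) (ht : 0 < P.a t w) :
    ∃ τ : ℝ, 0 < τ ∧ (∀ s ∈ T, P.a s (p + τ • w) ≤ 0) ∧
      ∃ s ∈ T, P.a s (p + τ • w) = 0 ∧ 0 < P.a s w := by
  obtain ⟨s, ⟨hsT, hs⟩, hmin⟩ := Set.exists_min_image {s | s ∈ T ∧ 0 < P.a s w}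
    (fun s => -P.a s p / P.a s w) (Set.toFinite _) ⟨t, htT, ht⟩
  have hτ : 0 < -P.a s p / P.a s w := div_pos (neg_pos.2 (hp s hsT hs)) hs
  refine ⟨_, hτ, fun r hrT => ?_, s, hsT, ?_, hs⟩
  · rw [map_add, map_smul, smul_eq_mul]
    by_cases hr : 0 < P.a r w
    · have := hmin r ⟨hrT, hr⟩
      rw [le_div_iff₀ hr] at this
      linarith
    · nlinarith [hp' r hrT]
  · rw [map_add, map_smul, smul_eq_mul]
    field_simp
    ring

/-- A point of the relative interior of a face, in general position with respect to a
direction `w`. -/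
theorem exists_generic_point {x : V} (T : Set ((V →ₗ[ℝ] ℝ))) (hT : T.Finite)
    (W : Submodule ℝ V) {p : V} (hpW : p ∈ W) (hp : ∀ s ∉ P.tight x, P.a s p < 0)
    (h : ∀ f ∈ T, ∃ v ∈ W, f v ≠ 0) :
    ∃ q ∈ W, (∀ s ∉ P.tight x, P.a s q < 0) ∧ ∀ f ∈ T, f q ≠ 0 := by
  have := hT.to_subtype
  obtain ⟨v, hvW, hv⟩ := Module.Dual.exists_forall_mem_ne_zero_of_forall_exists W
    (fun f : T => (f : V →ₗ[ℝ] ℝ)) (fun f => by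
      obtain ⟨v, hv, hv'⟩ := h f f.2
      exact ⟨v, hv, hv'⟩)
  have h1 : ∀ᶠ ε in 𝓝[>] (0 : ℝ), ∀ s : I, s ∉ P.tight x → P.a s (p + ε • v) < 0 := by
    refine eventually_all.2 fun s => ?_
    by_cases hs : s ∈ P.tight x
    · exact Eventually.of_forall fun _ h => absurd hs h
    · filter_upwards [eventually_add_mul_neg (P.a s v) (hp s hs)] with ε hε _
      simpa using hε
  have h2 : ∀ᶠ ε in 𝓝[>] (0 : ℝ), ∀ f : T, (f : V →ₗ[ℝ] ℝ) (p + ε • v) ≠ 0 := by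
    refine eventually_all.2 fun f => ?_
    filter_upwards [eventually_add_mul_ne ((f : V →ₗ[ℝ] ℝ) p) (hv f)] with ε hε
    simpa using hε
  obtain ⟨ε, h1, h2⟩ := (h1.and h2).exists
  exact ⟨p + ε • v, add_mem hpW (W.smul_mem _ hvW), h1, fun f hf => h2 ⟨f, hf⟩⟩

end Finite

section FiniteDimensional

variable [FiniteDimensional ℝ V]

theorem finrank_faceSpan_lt {x y : V} (hxy : P.tight x ⊂ P.tight y) :
    Module.finrank ℝ (P.faceSpan y) < Module.finrank ℝ (P.faceSpan x) := by
  obtain ⟨t, hty, htx⟩ := Set.exists_of_ssubset hxy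
  refine Submodule.finrank_lt_finrank_of_lt (lt_of_le_of_ne (faceSpan_mono hxy.1) fun h => htx ?_)
  have := self_mem_faceSpan (P := P) x
  rw [← h] at this
  exact mem_faceSpan.1 this t hty

theorem IsFacet.faceSpan_eq {x y : V} (hxy : P.IsFacet y x) {s : I} (hsy : s ∈ P.tight y)
    (hsx : s ∉ P.tight x) : P.faceSpan y = P.faceSpan x ⊓ LinearMap.ker (P.a s) := by
  refine Submodule.eq_of_le_of_finrank_eq
    (le_inf (faceSpan_mono hxy.2.1) fun w hw => mem_faceSpan.1 hw s hsy) ?_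
  have := finrank_inf_ker_add_one (P.faceSpan x) (P.a s) (self_mem_faceSpan x) hsx
  have := hxy.2.2
  omega

/-- On the span of the face of `x` both functionals have the span of the facet as kernel, so they
are proportional; both are negative at `x`, so the factor is positive. -/
theorem IsFacet.exists_pos_mul {x y : V} (hx : P.IsPt x) (hxy : P.IsFacet y x) {s s' : I}
    (hs : s ∈ P.tight y) (hsx : s ∉ P.tight x) (hs' : s' ∈ P.tight y) (hsx' : s' ∉ P.tight x) :
    ∃ γ > 0, ∀ v ∈ P.faceSpan x, P.a s v = γ * P.a s' v := by
  refine ⟨P.a s x / P.a s' x, div_pos_of_neg_of_neg (hx.neg_of_notMem hsx)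
    (hx.neg_of_notMem hsx'), fun v hv => ?_⟩
  have h0 : P.a s' x ≠ 0 := hsx'
  have : v - (P.a s' v / P.a s' x) • x ∈ P.faceSpan y := by
    rw [hxy.faceSpan_eq hs' hsx']
    refine ⟨sub_mem hv (Submodule.smul_mem _ _ (self_mem_faceSpan x)), ?_⟩
    simp [h0]
  have := mem_faceSpan.1 this s hs
  simp only [map_sub, map_smul, smul_eq_mul] at this
  field_simp at this ⊢
  linarith

theorem IsFacet.tight_subset {x y u : V} (hy : P.IsFacet y x) (hu : P.IsFacet u x) {s : I}
    (hsx : s ∉ P.tight x) (hsy : s ∈ P.tight y) (hsu : s ∈ P.tight u) :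
    P.tight y ⊆ P.tight u := by
  intro t ht
  have : u ∈ P.faceSpan y := by
    rw [hy.faceSpan_eq hsy hsx, ← hu.faceSpan_eq hsu hsx]
    exact self_mem_faceSpan u
  exact mem_faceSpan.1 this t ht

theorem IsFacet.tight_eq {x y u : V} (hy : P.IsFacet y x) (hu : P.IsFacet u x) {s : I}
    (hsx : s ∉ P.tight x) (hsy : s ∈ P.tight y) (hsu : s ∈ P.tight u) :
    P.tight y = P.tight u :=
  (hy.tight_subset hu hsx hsy hsu).antisymm (hu.tight_subset hy hsx hsu hsy)

variable [Finite I]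

/-- If moving from `y` in the direction `w` leaves the face of `x`, then this happens through a
facet that contains `y`. -/
theorem exists_visible_facet_of_mem_tight {x y w : V} (hx : P.IsPt x) (hy : P.IsPt y)
    (hxy : P.tight x ⊆ P.tight y) (hw : w ∈ P.faceSpan x) {t : I} (ht : t ∈ P.tight y)
    (htw : 0 < P.a t w) :
    ∃ R, P.IsFacet R x ∧ P.tight R ⊆ P.tight y ∧ ∃ s ∈ P.tight R, 0 < P.a s w := by
  -- Two functionals vanish at the same point `x' + τ • w` of the ray only if this combination of
  -- them vanishes at `x'`. A generic `x'` allows that only when the combination vanishes on the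
  -- whole span, that is, when the two functionals cut out the same facet.
  obtain ⟨x', hx'W, hx'neg, hx'⟩ := exists_generic_point
    ({f | (∃ v ∈ P.faceSpan x, f v ≠ 0) ∧
      f ∈ Set.range fun i : I × I => P.a i.1 w • P.a i.2 - P.a i.2 w • P.a i.1})
    ((Set.finite_range _).subset fun f hf => hf.2) (P.faceSpan x) (self_mem_faceSpan x)
    (fun s hs => hx.neg_of_notMem hs) (fun f hf => hf.1)
  have hvan : ∀ {s}, s ∈ P.tight x → P.a s w = 0 := fun hs => mem_faceSpan.1 hw _ hs
  have hvan' : ∀ {s}, s ∈ P.tight x → P.a s x' = 0 := fun hs => mem_faceSpan.1 hx'W _ hs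
  -- Only the constraints tight at `y` count here: `q` lies in the tangent cone at `y`, not
  -- necessarily in the polyhedron.
  obtain ⟨τ, hτ, hle, s₀, hs₀, hs₀0, hs₀w⟩ := exists_first_hit (P := P) (P.tight y) (p := x')
    (w := w) (fun s _ hs => hx'neg s fun h => hs.ne' (hvan h))
    (fun s _ => by
      by_cases h : s ∈ P.tight x
      · exact (hvan' h).le
      · exact (hx'neg s h).le) ht htw
  set q := x' + τ • w with hq
  have h1 : ∀ᶠ δ in 𝓝[>] (0 : ℝ), ∀ s : I, s ∉ P.tight y → P.a s (y + δ • q) < 0 := by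
    refine eventually_all.2 fun s => ?_
    by_cases hs : s ∈ P.tight y
    · exact Eventually.of_forall fun _ h => absurd hs h
    · filter_upwards [eventually_add_mul_neg (P.a s q) (hy.neg_of_notMem hs)] with ε hε _
      simpa using hε
  have h2 : ∀ᶠ δ in 𝓝[>] (0 : ℝ), 0 < P.z (y + δ • q) := by
    filter_upwards [eventually_add_mul_pos (P.z q) hy.1] with ε hε
    simpa using hε
  -- A short step from `y` in the direction `q` returns to the polyhedron and keeps tight exactly
  -- those constraints of `y` that vanish at `q`.
  obtain ⟨δ, ⟨h1, h2⟩, hδ⟩ := ((h1.and h2).and self_mem_nhdsWithin).exists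
  have hδ : 0 < δ := hδ
  have hval : ∀ s ∈ P.tight y, P.a s (y + δ • q) = δ * P.a s q := fun s hs => by
    simp [mem_tight.1 hs]
  have htR : P.tight (y + δ • q) = {s | s ∈ P.tight y ∧ P.a s q = 0} := by
    ext s
    constructor
    · intro hs
      have hsy : s ∈ P.tight y := by
        by_contra h
        exact (h1 s h).ne hs
      refine ⟨hsy, ?_⟩
      have := hval s hsy
      rw [mem_tight.1 hs] at this
      rcases mul_eq_zero.1 this.symm with h | h
      · exact absurd h hδ.ne'
      · exact h
    · rintro ⟨hs, hs0⟩
      rw [mem_tight, hval s hs, hs0, mul_zero]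
  have hxR : P.tight x ⊆ P.tight (y + δ • q) := fun s hs => by
    rw [htR]
    exact ⟨hxy hs, by simp [hq, hvan hs, hvan' hs]⟩
  have hs₀R : s₀ ∈ P.tight (y + δ • q) := by rw [htR]; exact ⟨hs₀, hs₀0⟩
  have hs₀x : s₀ ∉ P.tight x := fun h => hs₀w.ne' (hvan h)
  refine ⟨y + δ • q, ⟨⟨h2, fun s => ?_⟩, hxR, ?_⟩, fun s hs => ?_, s₀, hs₀R, hs₀w⟩
  · by_cases hs : s ∈ P.tight y
    · rw [hval s hs]
      exact mul_nonpos_of_nonneg_of_nonpos hδ.le (hle s hs)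
    · exact (h1 s hs).le
  · rw [← finrank_inf_ker_add_one (P.faceSpan x) (P.a s₀) (self_mem_faceSpan x) hs₀x]
    suffices key : P.faceSpan (y + δ • q) = P.faceSpan x ⊓ LinearMap.ker (P.a s₀) by rw [key]
    refine le_antisymm (le_inf (faceSpan_mono hxR)
      fun v hv => mem_faceSpan.1 hv s₀ hs₀R) fun v hv => mem_faceSpan.2 fun s hs => ?_
    by_cases hsx : s ∈ P.tight x
    · exact mem_faceSpan.1 hv.1 s hsx
    have hsq : P.a s q = 0 := by rw [htR] at hs; exact hs.2
    have hsx' := hx'neg s hsx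
    simp only [hq, map_add, map_smul, smul_eq_mul] at hsq hs₀0
    have hsw : P.a s w ≠ 0 := fun h => by rw [h] at hsq; linarith
    have hf : ¬ ∃ v ∈ P.faceSpan x, (P.a s w • P.a s₀ - P.a s₀ w • P.a s) v ≠ 0 := fun h => by
      refine hx' _ ⟨h, ⟨(s, s₀), rfl⟩⟩ ?_
      simp only [LinearMap.sub_apply, LinearMap.smul_apply, smul_eq_mul]
      linear_combination P.a s w * hs₀0 - P.a s₀ w * hsq
    push Not at hf
    have := hf v hv.1
    simp only [LinearMap.sub_apply, LinearMap.smul_apply, smul_eq_mul,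
      LinearMap.mem_ker.1 hv.2, mul_zero, zero_sub, neg_eq_zero, mul_eq_zero, hs₀w.ne',
      false_or] at this
    exact this
  · rw [htR] at hs
    exact hs.1

/-- In the direction `-x` every functional that is strict at `x` is positive, so every facet through
`y` counts as visible. -/
theorem exists_facet_of_ssubset {x y : V} (hx : P.IsPt x) (hy : P.IsPt y)
    (hxy : P.tight x ⊂ P.tight y) : ∃ R, P.IsFacet R x ∧ P.tight R ⊆ P.tight y := by
  obtain ⟨t, hty, htx⟩ := Set.exists_of_ssubset hxy
  obtain ⟨R, hR, hRy, -⟩ := exists_visible_facet_of_mem_tight hx hy hxy.1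
    (neg_mem (self_mem_faceSpan x)) hty (by simpa using hx.neg_of_notMem htx)
  exact ⟨R, hR, hRy⟩

end FiniteDimensional

end HomogenizedSystem

/-! ### Unbounded faces, visible facets and sweeping lines -/

namespace HomogenizedSystem

variable {V I : Type*} [AddCommGroup V] [Module ℝ V] {P : HomogenizedSystem V I}
variable [FiniteDimensional ℝ V] [Finite I]

/-- The span contains a nonzero direction `u` with `z u = 0`. As there are no lines, moving from `x`
along `u` or `-u` leaves the face, and it does so through a facet. -/
theorem exists_facet (hP : P.Pointed) {x : V} (hx : P.IsPt x)
    (hdim : 2 ≤ Module.finrank ℝ (P.faceSpan x)) : ∃ R, P.IsFacet R x := by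
  have h1 := finrank_inf_ker_add_one (P.faceSpan x) P.z (self_mem_faceSpan x) hx.1.ne'
  obtain ⟨u, hu, hu0⟩ := Submodule.exists_mem_ne_zero_of_ne_bot
    (p := P.faceSpan x ⊓ LinearMap.ker P.z) (fun h => by
      rw [h, finrank_bot] at h1; omega)
  have key : ∀ u ∈ P.faceSpan x, P.z u = 0 → ∀ t, 0 < P.a t u → ∃ R, P.IsFacet R x := by
    intro u hu huz t ht
    obtain ⟨τ, hτ, hle, s, -, hs0, hsu⟩ := exists_first_hit (P := P) Set.univ (p := x) (w := u)
      (fun s _ hs => hx.neg_of_notMem fun h => hs.ne' (mem_faceSpan.1 hu s h))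
      (fun s _ => hx.2 s) (Set.mem_univ t) ht
    have hsub : P.tight x ⊆ P.tight (x + τ • u) := fun r hr => by
      simp [mem_tight, mem_tight.1 hr, mem_faceSpan.1 hu r hr]
    have hpt : P.IsPt (x + τ • u) := ⟨by simpa [huz] using hx.1, fun s => hle s trivial⟩
    obtain ⟨R, hR, -⟩ := exists_visible_facet_of_mem_tight hx hpt hsub hu hs0 hsu
    exact ⟨R, hR⟩
  obtain ⟨t, ht⟩ : ∃ t, P.a t u ≠ 0 := by
    by_contra! h
    exact hu0 (hP u hu.2 h)
  rcases lt_or_gt_of_ne ht with ht | ht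
  · exact key (-u) (neg_mem hu.1) (by simpa using hu.2) t (by simpa using ht)
  · exact key u hu.1 hu.2 t ht

theorem exists_vertex (hP : P.Pointed) {x : V} (hx : P.IsPt x) :
    ∃ y, P.IsPt y ∧ P.tight x ⊆ P.tight y ∧ Module.finrank ℝ (P.faceSpan y) = 1 := by
  induction hk : Module.finrank ℝ (P.faceSpan x) using Nat.strong_induction_on generalizing x with
  | _ k ih =>
    have h1 := finrank_inf_ker_add_one (P.faceSpan x) P.z (self_mem_faceSpan x) hx.1.ne'
    by_cases hk1 : k = 1
    · exact ⟨x, hx, le_rfl, hk.trans hk1⟩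
    · obtain ⟨R, hR⟩ := exists_facet hP hx (by omega)
      obtain ⟨y, hy, hRy, hy1⟩ := ih _ (by have := hR.2.2; omega) hR.1 rfl
      exact ⟨y, hy, hR.2.1.trans hRy, hy1⟩

theorem not_unbdd_of_finrank_eq_one {y : V} (hy : P.IsPt y)
    (h : Module.finrank ℝ (P.faceSpan y) = 1) : ¬ P.Unbdd y := by
  rintro ⟨u, hu, hu0, huz, -⟩
  have h1 := finrank_inf_ker_add_one (P.faceSpan y) P.z (self_mem_faceSpan y) hy.1.ne'
  rw [h, Nat.add_eq_right, Submodule.finrank_eq_zero] at h1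
  have : u ∈ P.faceSpan y ⊓ LinearMap.ker P.z := ⟨hu, huz⟩
  rw [h1] at this
  exact hu0 ((Submodule.mem_bot ℝ).1 this)

/-- An unbounded face has relative interior points at which a separating functional vanishes. -/
theorem exists_center (hP : P.Pointed) {h : V →ₗ[ℝ] ℝ} (hh : P.Separates h) {x : V}
    (hx : P.IsPt x) (hu : P.Unbdd x) :
    ∃ p ∈ P.faceSpan x, (∀ s ∉ P.tight x, P.a s p < 0) ∧ h p = 0 ∧ 0 < P.z p := by
  obtain ⟨y, hy, hxy, hy1⟩ := exists_vertex hP hx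
  have hhy := hh.2 y hy (not_unbdd_of_finrank_eq_one hy hy1)
  obtain ⟨u, huL, hu0, huz, hua⟩ := hu
  have hhu := hh.1 u hu0 huz hua
  -- Start at a vertex `y`, where `h` is positive; adding `ε • x` makes the inequalities strict
  -- while `h` stays positive, and a suitable multiple of the recession direction `u` brings `h`
  -- down to zero.
  obtain ⟨ε, hε, hε0⟩ := ((eventually_add_mul_pos (h x) hhy).and self_mem_nhdsWithin).exists
  have hε0 : 0 < ε := hε0
  set c := (h y + ε * h x) / -h u with hc
  have hc0 : 0 < c := div_pos hε (neg_pos.2 hhu)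
  refine ⟨y + ε • x + c • u, ?_, fun s hs => ?_, ?_, ?_⟩
  · exact add_mem (add_mem (faceSpan_mono hxy (self_mem_faceSpan y))
      (Submodule.smul_mem _ _ (self_mem_faceSpan x))) (Submodule.smul_mem _ _ huL)
  · have h1 := hx.neg_of_notMem hs
    have h2 := hy.2 s
    have h3 := hua s
    simp only [map_add, map_smul, smul_eq_mul]
    nlinarith
  · have := hhu.ne
    simp only [map_add, map_smul, smul_eq_mul, hc]
    field_simp
    ring
  · have h1 := hx.1
    have h2 := hy.1
    simp only [map_add, map_smul, smul_eq_mul, huz]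
    nlinarith

/-- An unbounded face of dimension at least two has an unbounded facet. -/
theorem exists_unbdd_facet (hP : P.Pointed) {h : V →ₗ[ℝ] ℝ} (hh : P.Separates h) {x : V}
    (hx : P.IsPt x) (hu : P.Unbdd x) (hdim : 3 ≤ Module.finrank ℝ (P.faceSpan x)) :
    ∃ R, P.IsFacet R x ∧ P.Unbdd R := by
  obtain ⟨p, hpL, hp, hhp, hpz⟩ := exists_center hP hh hx hu
  obtain ⟨u, huL, hu0, huz, hua⟩ := hu
  have h1 := finrank_inf_ker_add_one (P.faceSpan x) h huL (hh.1 u hu0 huz hua).ne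
  have h2 := finrank_inf_ker_add_one (P.faceSpan x ⊓ LinearMap.ker h) P.z ⟨hpL, hhp⟩ hpz.ne'
  obtain ⟨w, hw, hw0⟩ := Submodule.exists_mem_ne_zero_of_ne_bot
    (p := P.faceSpan x ⊓ LinearMap.ker h ⊓ LinearMap.ker P.z) (fun h => by
      rw [h, finrank_bot] at h2; omega)
  have key : ∀ w ∈ P.faceSpan x, h w = 0 → P.z w = 0 → ∀ t, 0 < P.a t w →
      ∃ R, P.IsFacet R x ∧ P.Unbdd R := by
    intro w hw hhw hwz t ht
    obtain ⟨τ, hτ, hle, s, -, hs0, hsw⟩ := exists_first_hit (P := P) Set.univ (p := p) (w := w)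
      (fun s _ hs => hp s fun h => hs.ne' (mem_faceSpan.1 hw s h))
      (fun s _ => by
        by_cases hs : s ∈ P.tight x
        · exact (mem_faceSpan.1 hpL s hs).le
        · exact (hp s hs).le) (Set.mem_univ t) ht
    have hpt : P.IsPt (p + τ • w) := ⟨by simpa [hwz] using hpz, fun s => hle s trivial⟩
    have hsub : P.tight x ⊆ P.tight (p + τ • w) := fun r hr => by
      simp [mem_tight, mem_faceSpan.1 hpL r hr, mem_faceSpan.1 hw r hr]
    obtain ⟨R, hR, hRq, -⟩ := exists_visible_facet_of_mem_tight hx hpt hsub hw hs0 hsw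
    refine ⟨R, hR, Unbdd.mono hRq ?_⟩
    by_contra hq
    have := hh.2 _ hpt hq
    simp [hhp, hhw] at this
  obtain ⟨t, ht⟩ : ∃ t, P.a t w ≠ 0 := by
    by_contra! h
    exact hw0 (hP w hw.2 h)
  rcases lt_or_gt_of_ne ht with ht | ht
  · exact key (-w) (neg_mem hw.1.1) (by simpa using hw.1.2) (by simpa using hw.2) t
      (by simpa using ht)
  · exact key w hw.1.1 hw.1.2 hw.2 t ht

/-- The ray from a relative interior point of a face in a direction that leaves the polyhedron
leaves it in a point, unless the direction is opposite to the starting point. -/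
theorem exists_hit_point {x p w : V} (hpL : p ∈ P.faceSpan x)
    (hp : ∀ s ∉ P.tight x, P.a s p < 0) (hpz : 0 < P.z p) (hw : w ∈ P.faceSpan x) {t : I}
    (ht : 0 < P.a t w)
    (hz : ∀ τ : ℝ, P.z (p + τ • w) = 0 → (∀ s, P.a s (p + τ • w) ≤ 0) → p + τ • w = 0) :
    (∃ τ : ℝ, P.IsPt (p + τ • w) ∧ P.tight x ⊆ P.tight (p + τ • w) ∧
      ∃ s ∈ P.tight (p + τ • w), 0 < P.a s w) ∨ ∀ s ∉ P.tight x, 0 < P.a s w := by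
  have hple : ∀ s, P.a s p ≤ 0 := fun s => by
    by_cases hs : s ∈ P.tight x
    · exact (mem_faceSpan.1 hpL s hs).le
    · exact (hp s hs).le
  obtain ⟨τ, hτ, hle, s, -, hs0, hsw⟩ := exists_first_hit (P := P) Set.univ (p := p) (w := w)
    (fun s _ hs => hp s fun h => hs.ne' (mem_faceSpan.1 hw s h))
    (fun s _ => hple s) (Set.mem_univ t) ht
  by_cases hq : 0 < P.z (p + τ • w)
  · refine Or.inl ⟨τ, ⟨hq, fun s => hle s trivial⟩, fun r hr => ?_, s, hs0, hsw⟩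
    simp [mem_tight, mem_faceSpan.1 hpL r hr, mem_faceSpan.1 hw r hr]
  · right
    simp only [map_add, map_smul, smul_eq_mul, not_lt] at hq
    have hzw : P.z w < 0 := by
      by_contra hzw
      nlinarith
    -- If the hit does not have positive `z`, the ray first passes `z = 0` at `σ`. There it is a
    -- recession direction, hence zero by `hz`, so `w` is a negative multiple of `p` and sees
    -- everything.
    set σ := P.z p / -P.z w with hσ
    have hσ0 : 0 < σ := div_pos hpz (neg_pos.2 hzw)
    have hστ : σ ≤ τ := by
      rw [hσ, div_le_iff₀ (neg_pos.2 hzw)]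
      linarith
    have h0 := hz σ (by
      have := hzw.ne
      simp only [map_add, map_smul, smul_eq_mul, hσ]
      field_simp
      ring) (fun r => by
      have h1 := hle r trivial
      have h2 := hple r
      simp only [map_add, map_smul, smul_eq_mul] at h1 ⊢
      by_cases hr : 0 < P.a r w
      · nlinarith
      · nlinarith)
    intro r hr
    have h1 := congrArg (P.a r) h0
    have h2 := hp r hr
    simp only [map_add, map_smul, smul_eq_mul, map_zero] at h1
    by_contra h3
    nlinarith

/-- A ray from a center in a direction of `ker h` stays in `ker h`, where no bounded face has
points. So the facet through which it leaves is unbounded. -/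
theorem exists_visible_unbdd_facet_or (hP : P.Pointed) {h : V →ₗ[ℝ] ℝ} (hh : P.Separates h)
    {x w : V} (hx : P.IsPt x) (hu : P.Unbdd x) (hw : w ∈ P.faceSpan x) (hhw : h w = 0) {t : I}
    (ht : 0 < P.a t w) :
    (∃ R, P.IsFacet R x ∧ P.Unbdd R ∧ ∃ s ∈ P.tight R, 0 < P.a s w) ∨
      ∀ s ∉ P.tight x, 0 < P.a s w := by
  obtain ⟨p, hpL, hp, hhp, hpz⟩ := exists_center hP hh hx hu
  refine (exists_hit_point hpL hp hpz hw ht fun τ hz hle => ?_).imp_left ?_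
  · by_contra h0
    have := hh.1 _ h0 hz hle
    simp [hhp, hhw] at this
  · rintro ⟨τ, hpt, hsub, s, hs0, hsw⟩
    obtain ⟨R, hR, hRq, hvis⟩ := exists_visible_facet_of_mem_tight hx hpt hsub hw hs0 hsw
    refine ⟨R, hR, Unbdd.mono hRq ?_, hvis⟩
    by_contra hq
    have := hh.2 _ hpt hq
    simp [hhp, hhw] at this

/-- If `w` sees all facets, any unbounded facet will do. The dimension bound is what provides one: a
ray has only a vertex as facet. -/
theorem exists_visible_unbdd_facet (hP : P.Pointed) {h : V →ₗ[ℝ] ℝ} (hh : P.Separates h)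
    {x w : V} (hx : P.IsPt x) (hu : P.Unbdd x) (hdim : 3 ≤ Module.finrank ℝ (P.faceSpan x))
    (hw : w ∈ P.faceSpan x) (hhw : h w = 0) {t : I} (ht : 0 < P.a t w) :
    ∃ R, P.IsFacet R x ∧ P.Unbdd R ∧ ∃ s ∈ P.tight R, 0 < P.a s w := by
  refine (exists_visible_unbdd_facet_or hP hh hx hu hw hhw ht).elim id fun hall => ?_
  obtain ⟨R, hR, hRu⟩ := exists_unbdd_facet hP hh hx hu hdim
  obtain ⟨s, hs, hsx⟩ := Set.exists_of_ssubset hR.ssubset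
  exact ⟨R, hR, hRu, s, hs, hall s hsx⟩

theorem exists_visible_facet (hP : P.Pointed) {h : V →ₗ[ℝ] ℝ} (hh : P.Separates h)
    {x w : V} (hx : P.IsPt x) (hdim : 2 ≤ Module.finrank ℝ (P.faceSpan x))
    (hw : w ∈ P.faceSpan x) (hhw : P.Unbdd x → h w = 0) {t : I} (ht : 0 < P.a t w) :
    ∃ R, P.IsFacet R x ∧ ∃ s ∈ P.tight R, 0 < P.a s w := by
  have hall : (∀ s ∉ P.tight x, 0 < P.a s w) →
      ∃ R, P.IsFacet R x ∧ ∃ s ∈ P.tight R, 0 < P.a s w := by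
    intro hall
    obtain ⟨R, hR⟩ := exists_facet hP hx hdim
    obtain ⟨s, hs, hsx⟩ := Set.exists_of_ssubset hR.ssubset
    exact ⟨R, hR, s, hs, hall s hsx⟩
  by_cases hu : P.Unbdd x
  · refine (exists_visible_unbdd_facet_or hP hh hx hu hw (hhw hu) ht).elim ?_ hall
    rintro ⟨R, hR, -, hvis⟩
    exact ⟨R, hR, hvis⟩
  · refine (exists_hit_point (self_mem_faceSpan x) (fun s hs => hx.neg_of_notMem hs) hx.1 hw ht
      fun τ hz hle => ?_).elim ?_ hall
    · by_contra h0
      exact hu ⟨_, add_mem (self_mem_faceSpan x) (Submodule.smul_mem _ _ hw), h0, hz, hle⟩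
    · rintro ⟨τ, hpt, hsub, s, hs0, hsw⟩
      obtain ⟨R, hR, -, hvis⟩ := exists_visible_facet_of_mem_tight hx hpt hsub hw hs0 hsw
      exact ⟨R, hR, hvis⟩

/-- The hypotheses under which the facets of the face of `x` can be ordered by the
parameter at which the line from `p` in direction `w` meets them. -/
structure IsSweep (P : HomogenizedSystem V I) (h : V →ₗ[ℝ] ℝ) (x w p : V) : Prop where
  dir_mem : w ∈ P.faceSpan x
  center_mem : p ∈ P.faceSpan x
  center_neg : ∀ s ∉ P.tight x, P.a s p < 0
  dir_eq_zero : P.Unbdd x → h w = 0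
  center_eq_zero : P.Unbdd x → h p = 0

/-- Every direction that is parallel to no facet belongs to a sweep that distinguishes the
facets. -/
theorem exists_sweep (hP : P.Pointed) {h : V →ₗ[ℝ] ℝ} (hh : P.Separates h) (hgen : P.IsGeneric h)
    {x w : V} (hx : P.IsPt x) (hdim : 3 ≤ Module.finrank ℝ (P.faceSpan x))
    (hw : w ∈ P.faceSpan x) (hhw : P.Unbdd x → h w = 0)
    (hne : ∀ y, P.IsFacet y x → ∀ s ∈ P.tight y, s ∉ P.tight x → P.a s w ≠ 0) :
    ∃ p, P.IsSweep h x w p ∧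
      ∀ y u, P.IsFacet y x → P.IsFacet u x → ∀ s ∈ P.tight y, s ∉ P.tight x →
        ∀ s' ∈ P.tight u, s' ∉ P.tight x → P.a s w * P.a s' p = P.a s' w * P.a s p →
          P.tight y = P.tight u := by
  let F : I × I → (V →ₗ[ℝ] ℝ) := fun i => P.a i.1 w • P.a i.2 - P.a i.2 w • P.a i.1
  -- equality on the whole span of the face identifies the facets
  have key : ∀ y u, P.IsFacet y x → P.IsFacet u x → ∀ s ∈ P.tight y, s ∉ P.tight x →
      ∀ s' ∈ P.tight u, s' ∉ P.tight x → (∀ v ∈ P.faceSpan x, F (s, s') v = 0) →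
        P.tight y = P.tight u := by
    intro y u hy hu s hsy hsx s' hsu hsx' hF
    refine hy.tight_eq hu hsx' ?_ hsu
    have h1 := hF y (faceSpan_mono hy.2.1 (self_mem_faceSpan y))
    have h2 := hne y hy s hsy hsx
    simpa [F, mem_tight.1 hsy, h2, mem_tight (t := s')] using h1
  obtain ⟨W, p₀, hWL, hp₀W, hp₀, hWh, hWF⟩ : ∃ (W : Submodule ℝ V) (p₀ : V), W ≤ P.faceSpan x ∧
      p₀ ∈ W ∧ (∀ s ∉ P.tight x, P.a s p₀ < 0) ∧ (P.Unbdd x → ∀ v ∈ W, h v = 0) ∧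
      ∀ i, (∃ v ∈ P.faceSpan x, F i v ≠ 0) → ∃ v ∈ W, F i v ≠ 0 := by
    by_cases hu : P.Unbdd x
    · obtain ⟨p₀, hp₀L, hp₀, hhp₀, -⟩ := exists_center hP hh hx hu
      refine ⟨P.faceSpan x ⊓ LinearMap.ker h, p₀, inf_le_left, ⟨hp₀L, hhp₀⟩, hp₀,
        fun _ v hv => hv.2, fun i => ?_⟩
      rintro ⟨v, hv, hv0⟩
      obtain ⟨v', hv', h1, h2, h3⟩ := hgen x hx hdim i.1 i.2
      have hFv' : F i v' = 0 := by simp [F, h1, h2]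
      -- Genericity enters here: `F i` vanishes at `v'` and `h` does not, so a multiple of `v'`
      -- moves `v` into `ker h` without changing `F i`.
      refine ⟨v - (h v / h v') • v', ⟨sub_mem hv (Submodule.smul_mem _ _ hv'), ?_⟩, ?_⟩
      · simp [h3]
      · rwa [map_sub, map_smul, hFv', smul_zero, sub_zero]
    · exact ⟨P.faceSpan x, x, le_rfl, self_mem_faceSpan x, fun s hs => hx.neg_of_notMem hs,
        fun h => absurd h hu, fun i h => h⟩
  obtain ⟨p, hpW, hpneg, hp⟩ := exists_generic_point
    ({f | (∃ v ∈ W, f v ≠ 0) ∧ f ∈ Set.range F})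
    ((Set.finite_range _).subset fun f hf => hf.2) W hp₀W hp₀ (fun f hf => hf.1)
  refine ⟨p, ⟨hw, hWL hpW, hpneg, hhw, fun hu => hWh hu p hpW⟩, ?_⟩
  intro y u hy hu s hsy hsx s' hsu hsx' heq
  refine key y u hy hu s hsy hsx s' hsu hsx' ?_
  by_contra! hcon
  refine hp _ ⟨hWF (s, s') hcon, ⟨(s, s'), rfl⟩⟩ ?_
  simp [F, heq]

end HomogenizedSystem

/-! ### Sorted lists and their initial segments -/

theorem List.exists_take_iff_of_pairwise {α : Type*} {R : α → α → Prop} {p : α → Prop}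
    (h : ∀ a b, R a b → p b → p a) {l : List α} (hl : l.Pairwise R) :
    ∃ r : ℕ, ∀ x, x ∈ l.take r ↔ x ∈ l ∧ p x := by
  induction l with
  | nil => exact ⟨0, by simp⟩
  | cons a l ih =>
    rw [List.pairwise_cons] at hl
    obtain ⟨r, hr⟩ := ih hl.2
    by_cases ha : p a
    · refine ⟨r + 1, fun x => ?_⟩
      rw [List.take_succ_cons, List.mem_cons, List.mem_cons, hr]
      constructor
      · rintro (rfl | ⟨h1, h2⟩)
        exacts [⟨Or.inl rfl, ha⟩, ⟨Or.inr h1, h2⟩]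
      · rintro ⟨rfl | h1, h2⟩
        exacts [Or.inl rfl, Or.inr ⟨h1, h2⟩]
    · refine ⟨0, fun x => ?_⟩
      simp only [List.take_zero, List.not_mem_nil, false_iff, not_and]
      intro hx hpx
      rcases List.mem_cons.1 hx with rfl | hx
      exacts [ha hpx, ha (h _ _ (hl.1 x hx) hpx)]

/-- Keeps one representative for each value of `f` and sorts by decreasing value. `S` itself may be
infinite, as is the set of relative interior points of facets. -/
theorem List.exists_pairwise_of_finite_image {α β : Type*} [LinearOrder β] (S : Set α) (f : α → β)
    (hf : (f '' S).Finite) :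
    ∃ l : List α, (∀ y ∈ l, y ∈ S) ∧ (∀ y ∈ S, ∃ u ∈ l, f u = f y) ∧
      l.Pairwise fun u y => f y < f u := by
  rcases isEmpty_or_nonempty α with hα | hα
  · exact ⟨[], by simp, fun y => hα.elim y, List.Pairwise.nil⟩
  choose! g hg using fun (r : β) (hr : r ∈ f '' S) => hr
  have hs : ∀ r ∈ hf.toFinset.sort (· ≥ ·), g r ∈ S ∧ f (g r) = r := fun r hr =>
    hg r (by simpa using hr)
  refine ⟨(hf.toFinset.sort (· ≥ ·)).map g, ?_, ?_, ?_⟩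
  · simp only [List.mem_map]
    rintro y ⟨r, hr, rfl⟩
    exact (hs r hr).1
  · intro y hy
    have hr : f y ∈ hf.toFinset.sort (· ≥ ·) := by
      simpa using ⟨y, hy, rfl⟩
    exact ⟨g (f y), List.mem_map_of_mem hr, (hs _ hr).2⟩
  · rw [List.pairwise_map]
    have h1 := Finset.pairwise_sort hf.toFinset (· ≥ ·)
    have h2 : (hf.toFinset.sort (· ≥ ·)).Nodup := Finset.sort_nodup _ _
    refine (h1.and h2).imp_of_mem ?_
    rintro a b ha hb ⟨hab, hne⟩
    rw [(hs a ha).2, (hs b hb).2]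
    exact lt_of_le_of_ne hab (Ne.symm hne)

theorem Set.Finite.exists_list_with_prefix {α : Type*} {S A : Set α} (hS : S.Finite)
    (hA : A ⊆ S) :
    ∃ l : List α, l.Nodup ∧ (∀ x, x ∈ l ↔ x ∈ S) ∧ ∃ r : ℕ, ∀ x, x ∈ l.take r ↔ x ∈ A := by
  classical
  have hfA := hS.subset hA
  have hfB := hS.subset (Set.sdiff_subset : S \ A ⊆ S)
  refine ⟨hfA.toFinset.toList ++ hfB.toFinset.toList, ?_, fun x => ?_,
    hfA.toFinset.toList.length, fun x => ?_⟩
  · refine List.Nodup.append (Finset.nodup_toList _) (Finset.nodup_toList _) ?_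
    intro x hx hx'
    simp only [Finset.mem_toList, Set.Finite.mem_toFinset] at hx hx'
    exact hx'.2 hx
  · simp only [List.mem_append, Finset.mem_toList, Set.Finite.mem_toFinset, Set.mem_sdiff]
    by_cases hx : x ∈ A
    · simp [hx, hA hx]
    · simp [hx]
  · rw [List.take_left]
    simp

/-! ### Faces as cells, and the parameters of a sweep -/

namespace HomogenizedSystem

variable {V I X : Type*} [AddCommGroup V] [Module ℝ V] [TopologicalSpace X]

/-- The complex `K` consists of the cells `c v` for the boundary points `v` of the polyhedron, one
for each proper face, together with a vertex `o` at infinity. -/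
structure IsRealizedBy (P : HomogenizedSystem V I) (K : RegularCellComplex X) (c : V → Set X)
    (o : Set X) : Prop where
  mem_cells : ∀ τ, τ ∈ K.cells ↔ (∃ v, P.IsPt v ∧ (P.tight v).Nonempty ∧ c v = τ) ∨ τ = o
  subset_iff : ∀ v v', P.IsPt v → (P.tight v).Nonempty → P.IsPt v' → (P.tight v').Nonempty →
    (c v ⊆ c v' ↔ P.tight v' ⊆ P.tight v)
  not_subset : ∀ v, P.IsPt v → (P.tight v).Nonempty → ¬ c v ⊆ o
  subset_iff_unbdd : ∀ v, P.IsPt v → (P.tight v).Nonempty → (o ⊆ c v ↔ P.Unbdd v)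
  dim_cell : ∀ v, P.IsPt v → (P.tight v).Nonempty →
    K.dim (c v) + 1 = Module.finrank ℝ (P.faceSpan v)
  dim_infty : K.dim o = 0

/-- The cells of the proper faces of the face of `x`. -/
def properFaces (P : HomogenizedSystem V I) (c : V → Set X) (o : Set X) (x : V) : Set (Set X) :=
  {τ | (∃ v, P.IsPt v ∧ P.tight x ⊂ P.tight v ∧ c v = τ) ∨ (τ = o ∧ P.Unbdd x)}

/-- The parameter at which the line from `p` in direction `w` meets a facet. -/
noncomputable def sweepParam (P : HomogenizedSystem V I) (w p : V) (s : I) : ℝ :=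
  P.a s w / -P.a s p

/-- The boundary of the face of `x` has shellings that start with the facets visible from a given
direction and, in dimension one, with any given set of vertices. -/
def HasVisibleShellings (P : HomogenizedSystem V I) (h : V →ₗ[ℝ] ℝ) (K : RegularCellComplex X)
    (c : V → Set X) (o : Set X) (x : V) : Prop :=
  (Module.finrank ℝ (P.faceSpan x) = 2 → ∀ A ⊆ P.properFaces c o x,
    ∃ b, K.IsShelling (P.properFaces c o x) b ∧ ∃ r : ℕ, ∀ τ, τ ∈ b.take r ↔ τ ∈ A) ∧
  (3 ≤ Module.finrank ℝ (P.faceSpan x) → ∀ w ∈ P.faceSpan x, (P.Unbdd x → h w = 0) →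
    (∀ y, P.IsFacet y x → ∀ s ∈ P.tight y, s ∉ P.tight x → P.a s w ≠ 0) →
    ∃ b, K.IsShelling (P.properFaces c o x) b ∧
      ∃ r : ℕ, ∀ τ, τ ∈ b.take r ↔ ∃ R, P.IsFacet R x ∧ c R = τ ∧ ∃ s ∈ P.tight R, 0 < P.a s w)

variable {P : HomogenizedSystem V I} {K : RegularCellComplex X} {c : V → Set X} {o : Set X}
  {h : V →ₗ[ℝ] ℝ}

theorem IsFacet.nonempty {x y : V} (hy : P.IsFacet y x) [FiniteDimensional ℝ V] :
    (P.tight y).Nonempty := by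
  obtain ⟨t, ht, -⟩ := Set.exists_of_ssubset hy.ssubset
  exact ⟨t, ht⟩

theorem nonempty_of_ssubset {x v : V} (h : P.tight x ⊂ P.tight v) : (P.tight v).Nonempty := by
  obtain ⟨t, ht, -⟩ := Set.exists_of_ssubset h
  exact ⟨t, ht⟩

theorem IsRealizedBy.eq_iff (hK : P.IsRealizedBy K c o) {v v' : V} (hv : P.IsPt v)
    (hvt : (P.tight v).Nonempty) (hv' : P.IsPt v') (hvt' : (P.tight v').Nonempty) :
    c v = c v' ↔ P.tight v = P.tight v' := by
  rw [Set.Subset.antisymm_iff, hK.subset_iff v v' hv hvt hv' hvt',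
    hK.subset_iff v' v hv' hvt' hv hvt, and_comm, Set.Subset.antisymm_iff]

theorem IsRealizedBy.ssubset_iff (hK : P.IsRealizedBy K c o) {v v' : V} (hv : P.IsPt v)
    (hvt : (P.tight v).Nonempty) (hv' : P.IsPt v') (hvt' : (P.tight v').Nonempty) :
    c v ⊂ c v' ↔ P.tight v' ⊂ P.tight v := by
  rw [ssubset_iff_subset_not_subset, hK.subset_iff v v' hv hvt hv' hvt',
    hK.subset_iff v' v hv' hvt' hv hvt, ssubset_iff_subset_not_subset]

theorem IsRealizedBy.boundary_eq (hK : P.IsRealizedBy K c o) {x : V} (hx : P.IsPt x)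
    (hxt : (P.tight x).Nonempty) : K.boundary (c x) = P.properFaces c o x := by
  ext τ
  simp only [RegularCellComplex.boundary, properFaces, Set.mem_ofPred_eq, hK.mem_cells]
  constructor
  · rintro ⟨⟨v, hv, hvt, rfl⟩ | rfl, hτ⟩
    · exact Or.inl ⟨v, hv, (hK.ssubset_iff hv hvt hx hxt).1 hτ, rfl⟩
    · exact Or.inr ⟨rfl, (hK.subset_iff_unbdd x hx hxt).1 hτ.1⟩
  · rintro (⟨v, hv, hvx, rfl⟩ | ⟨rfl, hu⟩)
    · have hvt := nonempty_of_ssubset hvx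
      exact ⟨Or.inl ⟨v, hv, hvt, rfl⟩, (hK.ssubset_iff hv hvt hx hxt).2 hvx⟩
    · exact ⟨Or.inr rfl, (hK.subset_iff_unbdd x hx hxt).2 hu, hK.not_subset x hx hxt⟩

variable [FiniteDimensional ℝ V]

theorem IsFacet.mem_properFaces {x y : V} (hy : P.IsFacet y x) : c y ∈ P.properFaces c o x :=
  Or.inl ⟨y, hy.1, hy.ssubset, rfl⟩

/-- Otherwise the dimension would drop twice between `x` and `y`, but a facet has codimension one.
-/
theorem IsFacet.eq_of_subset {x y v : V} (hy : P.IsFacet y x) (hxv : P.tight x ⊂ P.tight v)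
    (hvy : P.tight v ⊆ P.tight y) : P.tight v = P.tight y := by
  by_contra hne
  have h1 := finrank_faceSpan_lt hxv
  have h2 := finrank_faceSpan_lt (lt_of_le_of_ne hvy hne)
  have := hy.2.2
  omega

variable [Finite I]

/-- The vertex `o` is no exception: from dimension two on, an unbounded face has an unbounded facet,
so `o` is not a maximal cell of the boundary. -/
theorem exists_facet_above (hP : P.Pointed) (hh : P.Separates h) (hK : P.IsRealizedBy K c o)
    {x : V} (hx : P.IsPt x) (hdim : 3 ≤ Module.finrank ℝ (P.faceSpan x)) {τ : Set X}
    (hτ : τ ∈ P.properFaces c o x) : ∃ R, P.IsFacet R x ∧ τ ⊆ c R := by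
  rcases hτ with ⟨v, hv, hxv, rfl⟩ | ⟨rfl, hu⟩
  · obtain ⟨R, hR, hRv⟩ := exists_facet_of_ssubset hx hv hxv
    exact ⟨R, hR, (hK.subset_iff v R hv (nonempty_of_ssubset hxv) hR.1 hR.nonempty).2 hRv⟩
  · obtain ⟨R, hR, hRu⟩ := exists_unbdd_facet hP hh hx hu hdim
    exact ⟨R, hR, (hK.subset_iff_unbdd R hR.1 hR.nonempty).2 hRu⟩

theorem IsFacet.subset_of_mem_properFaces (hK : P.IsRealizedBy K c o) {x R : V}
    (hR : P.IsFacet R x) {τ : Set X} (hτ : τ ∈ P.properFaces c o x) (hRτ : c R ⊆ τ) :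
    τ ⊆ c R := by
  rcases hτ with ⟨v, hv, hxv, rfl⟩ | ⟨rfl, hu⟩
  · have hvt := nonempty_of_ssubset hxv
    have := hR.eq_of_subset hxv ((hK.subset_iff R v hR.1 hR.nonempty hv hvt).1 hRτ)
    exact (hK.subset_iff v R hv hvt hR.1 hR.nonempty).2 this.ge
  · exact absurd hRτ (hK.not_subset R hR.1 hR.nonempty)

theorem maximal_properFaces_iff (hP : P.Pointed) (hh : P.Separates h)
    (hK : P.IsRealizedBy K c o) {x : V} (hx : P.IsPt x)
    (hdim : 3 ≤ Module.finrank ℝ (P.faceSpan x)) {τ : Set X} :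
    Maximal (fun ρ => ρ ∈ P.properFaces c o x) τ ↔ ∃ R, P.IsFacet R x ∧ c R = τ := by
  constructor
  · rintro ⟨hτ, hmax⟩
    obtain ⟨R, hR, hτR⟩ := exists_facet_above hP hh hK hx hdim hτ
    exact ⟨R, hR, (hmax hR.mem_properFaces hτR).antisymm hτR⟩
  · rintro ⟨R, hR, rfl⟩
    exact ⟨hR.mem_properFaces, fun τ hτ hRτ => hR.subset_of_mem_properFaces hK hτ hRτ⟩

/-- The link between order and visibility: from the point with parameter `r` one sees precisely the
facets with larger parameter, and these come earlier in the sweep. -/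
theorem sweepParam_lt_iff {w p : V} {s : I} (hp : P.a s p < 0) (r : ℝ) :
    r < P.sweepParam w p s ↔ 0 < P.a s (w + r • p) := by
  rw [sweepParam, lt_div_iff₀ (neg_pos.2 hp), map_add, map_smul, smul_eq_mul]
  constructor <;> intro h <;> linarith

theorem apply_add_sweepParam {w p : V} {s : I} (hp : P.a s p < 0) :
    P.a s (w + P.sweepParam w p s • p) = 0 := by
  have := hp.ne
  rw [sweepParam, map_add, map_smul, smul_eq_mul]
  field_simp
  ring

theorem IsSweep.mem_faceSpan_facet {x w p y : V} (hs : P.IsSweep h x w p) (hy : P.IsFacet y x)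
    {s : I} (hsy : s ∈ P.tight y) (hsx : s ∉ P.tight x) :
    w + P.sweepParam w p s • p ∈ P.faceSpan y := by
  rw [hy.faceSpan_eq hsy hsx]
  exact ⟨add_mem hs.dir_mem (Submodule.smul_mem _ _ hs.center_mem),
    apply_add_sweepParam (hs.center_neg s hsx)⟩

/-- Functionals defining the same facet are positive multiples of each other on the span, so the
quotient does not depend on the choice. -/
theorem sweepParam_eq {x w p y : V} (hx : P.IsPt x) (hs : P.IsSweep h x w p)
    (hy : P.IsFacet y x) {s s' : I} (hsy : s ∈ P.tight y) (hsx : s ∉ P.tight x)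
    (hsy' : s' ∈ P.tight y) (hsx' : s' ∉ P.tight x) :
    P.sweepParam w p s = P.sweepParam w p s' := by
  obtain ⟨γ, hγ, hmul⟩ := hy.exists_pos_mul hx hsy hsx hsy' hsx'
  rw [sweepParam, sweepParam, hmul w hs.dir_mem, hmul p hs.center_mem, ← mul_neg,
    mul_div_mul_left _ _ hγ.ne']

end HomogenizedSystem

/-! ### Sweep orders are shellings -/

namespace HomogenizedSystem

variable {V I X : Type*} [AddCommGroup V] [Module ℝ V] [TopologicalSpace X]
variable {P : HomogenizedSystem V I} {K : RegularCellComplex X} {c : V → Set X} {o : Set X}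
  {h : V →ₗ[ℝ] ℝ} [FiniteDimensional ℝ V] [Finite I]

/-- The list consists of representatives of the facets of the face of `x`, in the order in which
the line from `p` in the direction `w` meets them. -/
structure IsSweepOrder (P : HomogenizedSystem V I) (x w p : V) (l : List V) : Prop where
  isFacet : ∀ y ∈ l, P.IsFacet y x
  exists_eq : ∀ y, P.IsFacet y x → ∃ u ∈ l, P.tight u = P.tight y
  sorted : l.Pairwise fun u y => ∀ s ∈ P.tight u, s ∉ P.tight x → ∀ s' ∈ P.tight y,
    s' ∉ P.tight x → P.sweepParam w p s' < P.sweepParam w p s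

theorem IsSweepOrder.lt {x w p : V} {l : List V} (hl : P.IsSweepOrder x w p l) {i j : ℕ}
    (hi : i < l.length) (hj : j < l.length) (hij : i < j) {s s' : I} (hs : s ∈ P.tight l[i])
    (hsx : s ∉ P.tight x) (hs' : s' ∈ P.tight l[j]) (hsx' : s' ∉ P.tight x) :
    P.sweepParam w p s' < P.sweepParam w p s :=
  List.pairwise_iff_getElem.1 hl.sorted i j hi hj hij s hs hsx s' hs' hsx'

theorem IsSweepOrder.index_lt {x w p : V} {l : List V} (hl : P.IsSweepOrder x w p l)
    (hx : P.IsPt x) (hs : P.IsSweep h x w p) {i j : ℕ}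
    (hi : i < l.length) (hj : j < l.length) {s s' : I} (hsi : s ∈ P.tight l[i])
    (hsx : s ∉ P.tight x) (hsj : s' ∈ P.tight l[j]) (hsx' : s' ∉ P.tight x)
    (hlt : P.sweepParam w p s' < P.sweepParam w p s) : i < j := by
  rcases lt_trichotomy i j with hij | rfl | hij
  · exact hij
  · rw [sweepParam_eq hx hs (hl.isFacet _ (List.getElem_mem hi)) hsi hsx hsj hsx'] at hlt
    exact absurd hlt (lt_irrefl _)
  · exact absurd (hl.lt hj hi hij hsj hsx' hsi hsx) hlt.asymm

section Attaching

variable (hP : P.Pointed) (hh : P.Separates h) (hK : P.IsRealizedBy K c o) {x w p : V}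
  (hx : P.IsPt x) (hs : P.IsSweep h x w p) {l : List V} (hl : P.IsSweepOrder x w p l)

include hK hl in
theorem mem_attaching_iff {j : Fin (l.map c).length} {y : V}
    (hyj : y = l[(j : ℕ)]'(by simpa using j.2)) {τ : Set X} :
    τ ∈ K.attaching (l.map c) j ↔ τ ∈ P.properFaces c o y ∧
      ∃ (k : ℕ) (hk : k < l.length), k < j ∧ τ ∈ P.properFaces c o l[k] := by
  have hbd : ∀ (k : ℕ) (hk : k < l.length), K.boundary (c l[k]) = P.properFaces c o l[k] :=
    fun k hk => hK.boundary_eq (hl.isFacet _ (List.getElem_mem hk)).1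
      (hl.isFacet _ (List.getElem_mem hk)).nonempty
  simp only [RegularCellComplex.attaching, Set.mem_inter_iff, Set.mem_ofPred_eq]
  subst hyj
  refine and_congr ?_ ⟨?_, ?_⟩
  · rw [← hbd]
    simp
  · rintro ⟨k, hkj, hk⟩
    have hkl : (k : ℕ) < l.length := by simpa using k.2
    refine ⟨k, hkl, hkj, ?_⟩
    rw [← hbd]
    simpa using hk
  · rintro ⟨k, hkl, hkj, hk⟩
    refine ⟨⟨k, by simpa using hkl⟩, hkj, ?_⟩
    rw [← hbd] at hk
    simpa using hk

-- Ray shooting from `R` inside the face of `x` finds a facet of `x` that contains `R` and is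
-- visible from the same point. Visibility means a larger parameter, so this facet precedes `y`.
include hK hl hx hs in
theorem visible_mem_attaching {j : Fin (l.map c).length} {y : V}
    (hyj : y = l[(j : ℕ)]'(by simpa using j.2)) {s : I} (hsy : s ∈ P.tight y)
    (hsx : s ∉ P.tight x) {R : V} (hR : P.IsFacet R y) {t : I} (htR : t ∈ P.tight R)
    (ht : 0 < P.a t (w + P.sweepParam w p s • p)) : c R ∈ K.attaching (l.map c) j := by
  have hjl : (j : ℕ) < l.length := by simpa using j.2
  have hy : P.IsFacet y x := hyj ▸ hl.isFacet _ (List.getElem_mem hjl)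
  have hwx := faceSpan_mono hy.2.1 (hs.mem_faceSpan_facet hy hsy hsx)
  rw [mem_attaching_iff hK hl hyj]
  refine ⟨hR.mem_properFaces, ?_⟩
  obtain ⟨u, hu, huR, t', ht'u, ht'⟩ :=
    exists_visible_facet_of_mem_tight hx hR.1 (hy.2.1.trans hR.2.1) hwx htR ht
  have ht'x : t' ∉ P.tight x := fun h => ht'.ne' (mem_faceSpan.1 hwx t' h)
  obtain ⟨u', hu'l, hu'⟩ := hl.exists_eq u hu
  obtain ⟨k, hk, rfl⟩ := List.getElem_of_mem hu'l
  rw [← hu'] at ht'u huR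
  have hlt := (sweepParam_lt_iff (w := w) (hs.center_neg t' ht'x) _).2 ht'
  refine ⟨k, hk, hl.index_lt hx hs hk hjl ht'u ht'x (hyj ▸ hsy) hsx hlt,
    Or.inl ⟨R, hR.1, lt_of_le_of_ne huR fun heq => ?_, rfl⟩⟩
  have h1 := (hl.isFacet _ hu'l).2.2
  have h2 := hy.2.2
  have h3 := hR.2.2
  rw [faceSpan_congr heq] at h1
  omega

-- A functional of the earlier facet is positive at the point where the line meets the span of `y`,
-- and it is tight on `τ` if `τ` is a face. Ray shooting inside the face of `y` then finds a visible
-- facet through `τ`. For `τ = o` the point lies in `ker h`, and a visible unbounded facet takes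
-- this role.
include hP hh hK hl hx hs in
theorem exists_visible_of_mem_attaching {j : Fin (l.map c).length} {y : V}
    (hyj : y = l[(j : ℕ)]'(by simpa using j.2)) {s : I} (hsy : s ∈ P.tight y)
    (hsx : s ∉ P.tight x) (hdim : 3 ≤ Module.finrank ℝ (P.faceSpan y)) {τ : Set X}
    (hτ : τ ∈ K.attaching (l.map c) j) :
    ∃ R, P.IsFacet R y ∧ τ ⊆ c R ∧ ∃ t ∈ P.tight R, 0 < P.a t (w + P.sweepParam w p s • p) := by
  have hjl : (j : ℕ) < l.length := by simpa using j.2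
  have hy : P.IsFacet y x := hyj ▸ hl.isFacet _ (List.getElem_mem hjl)
  have hwy := hs.mem_faceSpan_facet hy hsy hsx
  obtain ⟨hτy, k, hk, hkj, hτk⟩ := (mem_attaching_iff hK hl hyj).1 hτ
  have hlk := hl.isFacet _ (List.getElem_mem hk)
  obtain ⟨s', hs', hsx'⟩ := Set.exists_of_ssubset hlk.ssubset
  have hvis := (sweepParam_lt_iff (hs.center_neg s' hsx') _).1
    (hl.lt hk hjl hkj hs' hsx' (hyj ▸ hsy) hsx)
  rcases hτy with ⟨v, hv, hyv, rfl⟩ | ⟨rfl, hu⟩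
  · have hvt := nonempty_of_ssubset hyv
    have hs'v : s' ∈ P.tight v := by
      rcases hτk with ⟨v', hv', hkv', heq⟩ | ⟨heq, -⟩
      · rw [← (hK.eq_iff hv' (nonempty_of_ssubset hkv') hv hvt).1 heq]
        exact hkv'.1 hs'
      · exact absurd heq.subset (hK.not_subset v hv hvt)
    obtain ⟨R, hR, hRv, hvisR⟩ :=
      exists_visible_facet_of_mem_tight hy.1 hv hyv.1 hwy hs'v hvis
    exact ⟨R, hR, (hK.subset_iff v R hv hvt hR.1 hR.nonempty).2 hRv, hvisR⟩
  · have hux : P.Unbdd x := Unbdd.mono hy.2.1 hu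
    obtain ⟨R, hR, hRu, hvisR⟩ := exists_visible_unbdd_facet hP hh hy.1 hu hdim hwy
      (by simp [hs.dir_eq_zero hux, hs.center_eq_zero hux]) hvis
    exact ⟨R, hR, (hK.subset_iff_unbdd R hR.1 hR.nonempty).2 hRu, hvisR⟩

-- A functional of the first facet in the list is positive at the point where the line meets the
-- span of `y`, so at least one facet of `y` is visible from there.
include hP hh hK hl hx hs in
theorem attaching_nonempty {j : Fin (l.map c).length} (hj : 0 < (j : ℕ)) {y : V}
    (hyj : y = l[(j : ℕ)]'(by simpa using j.2)) {s : I} (hsy : s ∈ P.tight y)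
    (hsx : s ∉ P.tight x) (hdim : 2 ≤ Module.finrank ℝ (P.faceSpan y)) :
    (K.attaching (l.map c) j).Nonempty := by
  have hjl : (j : ℕ) < l.length := by simpa using j.2
  have hy : P.IsFacet y x := hyj ▸ hl.isFacet _ (List.getElem_mem hjl)
  have hwy := hs.mem_faceSpan_facet hy hsy hsx
  have hl0 := hl.isFacet _ (List.getElem_mem (hj.trans hjl))
  obtain ⟨s', hs', hsx'⟩ := Set.exists_of_ssubset hl0.ssubset
  have hvis := (sweepParam_lt_iff (hs.center_neg s' hsx') _).1
    (hl.lt (hj.trans hjl) hjl hj hs' hsx' (hyj ▸ hsy) hsx)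
  obtain ⟨R, hR, t, htR, ht⟩ := exists_visible_facet hP hh hy.1 hdim hwy (fun hu => by
    have hux : P.Unbdd x := Unbdd.mono hy.2.1 hu
    simp [hs.dir_eq_zero hux, hs.center_eq_zero hux]) hvis
  exact ⟨_, visible_mem_attaching hK hx hs hl hyj hsy hsx hR htR ht⟩

include hP hh hK hl hx hs in
theorem maximal_attaching_iff {j : Fin (l.map c).length} {y : V}
    (hyj : y = l[(j : ℕ)]'(by simpa using j.2)) {s : I} (hsy : s ∈ P.tight y)
    (hsx : s ∉ P.tight x) (hdim : 3 ≤ Module.finrank ℝ (P.faceSpan y)) {τ : Set X} :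
    Maximal (fun ρ => ρ ∈ K.attaching (l.map c) j) τ ↔
      ∃ R, P.IsFacet R y ∧ c R = τ ∧
        ∃ t ∈ P.tight R, 0 < P.a t (w + P.sweepParam w p s • p) := by
  constructor
  · rintro ⟨hτ, hmax⟩
    obtain ⟨R, hR, hτR, t, htR, ht⟩ :=
      exists_visible_of_mem_attaching hP hh hK hx hs hl hyj hsy hsx hdim hτ
    exact ⟨R, hR, (hmax (visible_mem_attaching hK hx hs hl hyj hsy hsx hR htR ht)
      hτR).antisymm hτR, t, htR, ht⟩
  · rintro ⟨R, hR, rfl, t, htR, ht⟩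
    exact ⟨visible_mem_attaching hK hx hs hl hyj hsy hsx hR htR ht, fun τ hτ hRτ =>
      hR.subset_of_mem_properFaces hK ((mem_attaching_iff hK hl hyj).1 hτ).1 hRτ⟩

end Attaching

theorem dim_of_mem_properFaces (hK : P.IsRealizedBy K c o) {y : V}
    (hdim : Module.finrank ℝ (P.faceSpan y) = 2) {τ : Set X} (hτ : τ ∈ P.properFaces c o y) :
    K.dim τ = 0 := by
  rcases hτ with ⟨v, hv, hyv, rfl⟩ | ⟨rfl, -⟩
  · have h1 := hK.dim_cell v hv (nonempty_of_ssubset hyv)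
    have h2 := finrank_faceSpan_lt hyv
    omega
  · exact hK.dim_infty

/-- The proper faces of an edge are vertices and possibly `o`. A vertex is bounded, so `o` is not
contained in it, and no strict inclusion remains. -/
theorem eq_of_subset_of_mem_properFaces (hK : P.IsRealizedBy K c o) {y : V}
    (hdim : Module.finrank ℝ (P.faceSpan y) = 2) {τ τ' : Set X} (hτ : τ ∈ P.properFaces c o y)
    (hτ' : τ' ∈ P.properFaces c o y) (hsub : τ ⊆ τ') : τ' ⊆ τ := by
  have hone : ∀ v, P.IsPt v → P.tight y ⊂ P.tight v →
      Module.finrank ℝ (P.faceSpan v) = 1 := fun v hv hyv => by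
    have h1 := finrank_inf_ker_add_one (P.faceSpan v) P.z (self_mem_faceSpan v) hv.1.ne'
    have h2 := finrank_faceSpan_lt hyv
    omega
  rcases hτ' with ⟨v', hv', hyv', rfl⟩ | ⟨rfl, -⟩
  · have hvt' := nonempty_of_ssubset hyv'
    rcases hτ with ⟨v, hv, hyv, rfl⟩ | ⟨rfl, -⟩
    · have hvt := nonempty_of_ssubset hyv
      have hsub' := (hK.subset_iff v v' hv hvt hv' hvt').1 hsub
      rw [hK.subset_iff v' v hv' hvt' hv hvt]
      by_contra hne
      have := finrank_faceSpan_lt (lt_of_le_not_ge hsub' hne)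
      rw [hone v hv hyv, hone v' hv' hyv'] at this
      exact absurd this (lt_irrefl _)
    · exact absurd ((hK.subset_iff_unbdd v' hv' hvt').1 hsub)
        (not_unbdd_of_finrank_eq_one hv' (hone v' hv' hyv'))
  · rcases hτ with ⟨v, hv, hyv, rfl⟩ | ⟨rfl, -⟩
    · exact absurd hsub (hK.not_subset v hv (nonempty_of_ssubset hyv))
    · exact le_rfl

/-- The facets in sweep order form a shelling of the boundary of a face. -/
theorem isShelling_of_isSweepOrder (hP : P.Pointed) (hh : P.Separates h)
    (hK : P.IsRealizedBy K c o) {x w p : V} (hx : P.IsPt x)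
    (hdim : 3 ≤ Module.finrank ℝ (P.faceSpan x)) (hs : P.IsSweep h x w p) {l : List V}
    (hl : P.IsSweepOrder x w p l)
    (ih : ∀ y, P.IsFacet y x → P.HasVisibleShellings h K c o y) :
    K.IsShelling (P.properFaces c o x) (l.map c) := by
  have hfacet : ∀ j : Fin (l.map c).length, ∃ y, P.IsFacet y x ∧ (l.map c)[j] = c y ∧
      y = l[(j : ℕ)]'(by simpa using j.2) := fun j => by
    have hjl : (j : ℕ) < l.length := by simpa using j.2
    exact ⟨l[(j : ℕ)], hl.isFacet _ (List.getElem_mem hjl), by simp, rfl⟩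
  have hbd : ∀ j : Fin (l.map c).length, ∃ b, K.IsShelling (K.boundary (l.map c)[j]) b ∧
      ∃ r : ℕ, ∀ τ, τ ∈ b.take r ↔ Maximal (fun ρ => ρ ∈ K.attaching (l.map c) j) τ := by
    intro j
    obtain ⟨y, hy, hjy, hyj⟩ := hfacet j
    have hjl : (j : ℕ) < l.length := by simpa using j.2
    obtain ⟨s, hsy, hsx⟩ := Set.exists_of_ssubset hy.ssubset
    rw [hjy, hK.boundary_eq hy.1 hy.nonempty]
    have hdimy := hy.2.2
    rcases (by omega : Module.finrank ℝ (P.faceSpan y) = 2 ∨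
      3 ≤ Module.finrank ℝ (P.faceSpan y)) with h2 | h3
    · refine (ih y hy).1 h2 _ fun τ hτ => ((mem_attaching_iff hK hl hyj).1 hτ.1).1
    · have hwy := hs.mem_faceSpan_facet hy hsy hsx
      -- The viewpoint for the boundary of `y` is the point where the line meets the span of `y`. If
      -- `y` is unbounded so is `x`, and the line lies in `ker h`.
      obtain ⟨b, hb, r, hr⟩ := (ih y hy).2 h3 _ hwy (fun hu => by
        have hux : P.Unbdd x := Unbdd.mono hy.2.1 hu
        simp [hs.dir_eq_zero hux, hs.center_eq_zero hux]) (by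
        intro R hR t htR hty h0
        -- the functional `t` is proportional to that of another facet through `R`
        have h1 : 0 < P.a t (-y) := by simpa using hy.1.neg_of_notMem hty
        have hyx := faceSpan_mono hy.2.1 (self_mem_faceSpan (P := P) y)
        obtain ⟨u, hu, huR, t', ht'u, ht'⟩ := exists_visible_facet_of_mem_tight hx hR.1
          (hy.2.1.trans hR.2.1) (neg_mem hyx) htR h1
        have ht'y : t' ∉ P.tight y := fun h => by simp [mem_tight.1 h] at ht'
        have ht'x : t' ∉ P.tight x := fun h => ht'y (hy.2.1 h)
        obtain ⟨γ, hγ, hmul⟩ := hR.exists_pos_mul hy.1 htR hty (huR ht'u) ht'y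
        rw [hmul _ hwy, mul_eq_zero, or_iff_right hγ.ne'] at h0
        obtain ⟨u', hu'l, hu'⟩ := hl.exists_eq u hu
        obtain ⟨k, hk, rfl⟩ := List.getElem_of_mem hu'l
        rw [← hu'] at ht'u
        have hne : P.sweepParam w p t' ≠ P.sweepParam w p s := fun heq => by
          rcases lt_trichotomy k (j : ℕ) with hkj | hkj | hkj
          · exact (hl.lt hk hjl hkj ht'u ht'x (hyj ▸ hsy) hsx).ne' heq
          · subst hkj
            exact ht'y (hyj ▸ ht'u)
          · exact (hl.lt hjl hk hkj (hyj ▸ hsy) hsx ht'u ht'x).ne heq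
        have hneg := hs.center_neg t' ht'x
        refine hne ?_
        rw [sweepParam, div_eq_iff (neg_ne_zero.2 hneg.ne)]
        simp only [map_add, map_smul, smul_eq_mul] at h0
        linarith)
      refine ⟨b, hb, r, fun τ => ?_⟩
      rw [hr, maximal_attaching_iff hP hh hK hx hs hl hyj hsy hsx h3]
  choose b hb hb' using hbd
  refine RegularCellComplex.IsShelling.step _ _ ⟨?_, fun σ => ?_⟩ b hb (fun j hj => ?_)
    (fun j _ => hb' j)
  · rw [List.Nodup, List.pairwise_map]
    refine hl.sorted.imp_of_mem fun {u y} hu hy hlt heq => ?_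
    have hu := hl.isFacet u hu
    have hy := hl.isFacet y hy
    have ht := (hK.eq_iff hu.1 hu.nonempty hy.1 hy.nonempty).1 heq
    obtain ⟨s, hsu, hsx⟩ := Set.exists_of_ssubset hu.ssubset
    exact lt_irrefl _ (hlt s hsu hsx s (ht ▸ hsu) hsx)
  · rw [maximal_properFaces_iff hP hh hK hx hdim, List.mem_map]
    constructor
    · rintro ⟨y, hy, rfl⟩
      exact ⟨y, hl.isFacet y hy, rfl⟩
    · rintro ⟨R, hR, rfl⟩
      obtain ⟨u, hu, huR⟩ := hl.exists_eq R hR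
      have hu' := hl.isFacet u hu
      exact ⟨u, hu, (hK.eq_iff hu'.1 hu'.nonempty hR.1 hR.nonempty).2 huR⟩
  · obtain ⟨y, hy, hjy, hyj⟩ := hfacet j
    obtain ⟨s, hsy, hsx⟩ := Set.exists_of_ssubset hy.ssubset
    have hdimy := hy.2.2
    have hcy := hK.dim_cell y hy.1 hy.nonempty
    refine ⟨fun τ hτ => ?_, fun h0 => ?_⟩
    · rw [hjy]
      rcases (by omega : Module.finrank ℝ (P.faceSpan y) = 2 ∨
        3 ≤ Module.finrank ℝ (P.faceSpan y)) with h2 | h3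
      · rw [dim_of_mem_properFaces hK h2 ((mem_attaching_iff hK hl hyj).1 hτ.1).1]
        rw [h2] at hcy
        have : K.dim (c y) = 1 := by omega
        simp [this]
      · obtain ⟨R, hR, rfl, -⟩ :=
          (maximal_attaching_iff hP hh hK hx hs hl hyj hsy hsx h3).1 hτ
        have h1 := hK.dim_cell R hR.1 hR.nonempty
        have h2 := hR.2.2
        omega
    · exact absurd h0 (attaching_nonempty hP hh hK hx hs hl hj hyj hsy hsx (by omega)).ne_empty

/-- Choosing one facet for each parameter value loses nothing, since `hne`, with the denominators
cleared, says that equal parameters belong to equal facets. -/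
theorem exists_isSweepOrder {x w p : V} (hx : P.IsPt x)
    (hs : P.IsSweep h x w p)
    (hne : ∀ y u, P.IsFacet y x → P.IsFacet u x → ∀ s ∈ P.tight y, s ∉ P.tight x →
        ∀ s' ∈ P.tight u, s' ∉ P.tight x → P.a s w * P.a s' p = P.a s' w * P.a s p →
          P.tight y = P.tight u) :
    ∃ l, P.IsSweepOrder x w p l := by
  rcases isEmpty_or_nonempty I with hI | hI
  · exact ⟨[], by simp, fun y hy => hI.elim hy.nonempty.some, List.Pairwise.nil⟩
  choose! g hg using fun (y : V) (hy : P.IsFacet y x) => Set.exists_of_ssubset hy.ssubset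
  obtain ⟨l, hl, hl', hsort⟩ := List.exists_pairwise_of_finite_image {y | P.IsFacet y x}
    (fun y => P.sweepParam w p (g y))
    ((Set.finite_range (P.sweepParam w p)).subset (by rintro _ ⟨y, -, rfl⟩; exact ⟨_, rfl⟩))
  refine ⟨l, hl, fun y hy => ?_, hsort.imp_of_mem fun {u y} hu hy hlt s hsu hsx s' hsy hsx' => ?_⟩
  · obtain ⟨u, hu, heq⟩ := hl' y hy
    have hu' := hl u hu
    refine ⟨u, hu, hne u y hu' hy (g u) (hg u hu').1 (hg u hu').2 (g y) (hg y hy).1 (hg y hy).2 ?_⟩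
    have h1 := hs.center_neg _ (hg u hu').2
    have h2 := hs.center_neg _ (hg y hy).2
    simp only [sweepParam] at heq
    rw [div_eq_div_iff (by linarith) (by linarith)] at heq
    linarith
  · have hu := hl u hu
    have hy := hl y hy
    rw [sweepParam_eq hx hs hu hsu hsx (hg u hu).1 (hg u hu).2,
      sweepParam_eq hx hs hy hsy hsx' (hg y hy).1 (hg y hy).2]
    exact hlt

/-- Induction on the dimension, sweeping along a line through the given viewpoint `w`. This
viewpoint has parameter zero, so the facets visible from it are those with positive parameter, an
initial segment of the sweep. -/
theorem hasVisibleShellings (hP : P.Pointed) (hh : P.Separates h) (hgen : P.IsGeneric h)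
    (hK : P.IsRealizedBy K c o) {x : V} (hx : P.IsPt x) :
    P.HasVisibleShellings h K c o x := by
  induction hk : Module.finrank ℝ (P.faceSpan x) using Nat.strong_induction_on generalizing x with
  | _ k ih =>
    subst hk
    refine ⟨fun h2 A hA => ?_, fun h3 w hw hhw hne => ?_⟩
    · have hfin : (P.properFaces c o x).Finite := by
        refine K.finite_cells.subset fun τ hτ => ?_
        rw [hK.mem_cells]
        rcases hτ with ⟨v, hv, hxv, rfl⟩ | ⟨rfl, -⟩
        · exact Or.inl ⟨v, hv, nonempty_of_ssubset hxv, rfl⟩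
        · exact Or.inr rfl
      -- The boundary of an edge has dimension zero, so every ordering of it is a shelling and any
      -- prescribed set can come first.
      obtain ⟨b, hb, hbS, r, hr⟩ := hfin.exists_list_with_prefix hA
      refine ⟨b, RegularCellComplex.IsShelling.dim_zero _ _ ⟨hb, fun σ => ?_⟩
        (fun σ hσ => dim_of_mem_properFaces hK h2 hσ), r, hr⟩
      rw [hbS]
      exact ⟨fun hσ => ⟨hσ, fun τ hτ hστ => eq_of_subset_of_mem_properFaces hK h2 hσ hτ hστ⟩,
        fun hσ => hσ.1⟩
    · obtain ⟨p, hs, hp⟩ := exists_sweep hP hh hgen hx h3 hw hhw hne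
      obtain ⟨l, hl⟩ := exists_isSweepOrder hx hs hp
      refine ⟨l.map c, isShelling_of_isSweepOrder hP hh hK hx h3 hs hl fun y hy =>
        ih _ (by have := hy.2.2; omega) hy.1 rfl, ?_⟩
      have hvis : ∀ s ∉ P.tight x, 0 < P.sweepParam w p s ↔ 0 < P.a s w := fun s hsx => by
        rw [sweepParam_lt_iff (hs.center_neg s hsx), zero_smul, add_zero]
      have hnot : ∀ s ∈ P.tight x, ¬ 0 < P.a s w := fun s hs h =>
        h.ne' (mem_faceSpan.1 hw s hs)
      obtain ⟨r, hr⟩ := List.exists_take_iff_of_pairwise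
        (p := fun y => P.IsFacet y x ∧ ∃ s ∈ P.tight y, 0 < P.a s w)
        (R := fun u y => P.IsFacet u x ∧ ∀ s ∈ P.tight u, s ∉ P.tight x → ∀ s' ∈ P.tight y,
          s' ∉ P.tight x → P.sweepParam w p s' < P.sweepParam w p s) (l := l) (by
          rintro u y ⟨hu, hlt⟩ ⟨hy, s', hs'y, hs'⟩
          have hsx' : s' ∉ P.tight x := fun h => hnot s' h hs'
          obtain ⟨s, hsu, hsx⟩ := Set.exists_of_ssubset hu.ssubset
          exact ⟨hu, s, hsu, (hvis s hsx).1
            (((hvis s' hsx').2 hs').trans (hlt s hsu hsx s' hs'y hsx'))⟩)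
        (hl.sorted.imp_of_mem fun {u y} hu _ hlt => ⟨hl.isFacet u hu, hlt⟩)
      refine ⟨r, fun τ => ?_⟩
      rw [← List.map_take, List.mem_map]
      constructor
      · rintro ⟨y, hy, rfl⟩
        obtain ⟨-, hy, hvisy⟩ := (hr y).1 hy
        exact ⟨y, hy, rfl, hvisy⟩
      · rintro ⟨R, hR, rfl, s, hsR, hsw⟩
        obtain ⟨u, hul, hu⟩ := hl.exists_eq R hR
        have hu' := hl.isFacet u hul
        exact ⟨u, (hr u).2 ⟨hul, hu', s, hu ▸ hsR, hsw⟩,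
          (hK.eq_iff hu'.1 hu'.nonempty hR.1 hR.nonempty).2 hu⟩

end HomogenizedSystem

/-! ### Half-spaces and balls in one-point compactifications -/

section HalfSpace

open Metric

variable {E : Type*} [NormedAddCommGroup E] [InnerProductSpace ℝ E]

/-- The inversion with centre `-e` that exchanges the unit sphere and the hyperplane `eᗮ`. -/
noncomputable def ballInversion (e x : E) : E := -e + (2 / ‖x + e‖ ^ 2) • (x + e)

theorem ballInversion_ballInversion {e x : E} (hx : x + e ≠ 0) :
    ballInversion e (ballInversion e x) = x := by
  have h0 : ‖x + e‖ ≠ 0 := norm_ne_zero_iff.2 hx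
  have h1 : ballInversion e x + e = (2 / ‖x + e‖ ^ 2) • (x + e) := by
    simp [ballInversion]
  rw [ballInversion, h1, norm_smul, smul_smul, Real.norm_eq_abs, abs_of_nonneg (by positivity)]
  have : 2 / (2 / ‖x + e‖ ^ 2 * ‖x + e‖) ^ 2 * (2 / ‖x + e‖ ^ 2) = 1 := by
    field_simp
  rw [this, one_smul]
  abel

theorem ballInversion_add_ne_zero {e x : E} (hx : x + e ≠ 0) : ballInversion e x + e ≠ 0 := by
  have h0 : ‖x + e‖ ≠ 0 := norm_ne_zero_iff.2 hx
  have h1 : ballInversion e x + e = (2 / ‖x + e‖ ^ 2) • (x + e) := by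
    simp [ballInversion]
  rw [h1]
  exact smul_ne_zero (by positivity) hx

/-- The sign of `inner ℝ e x` decides on which side of the unit sphere the image lies. Together with
`inner_ballInversion` this shows that the half-space and the punctured ball are exchanged. -/
theorem norm_ballInversion_sq {e x : E} (he : ‖e‖ = 1) (hx : x + e ≠ 0) :
    ‖ballInversion e x‖ ^ 2 = 1 - 4 * inner ℝ e x / ‖x + e‖ ^ 2 := by
  have h0 : ‖x + e‖ ≠ 0 := norm_ne_zero_iff.2 hx
  rw [ballInversion, norm_add_sq_real, norm_neg, he, inner_neg_left, inner_smul_right,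
    inner_add_right, real_inner_self_eq_norm_sq, he, norm_smul, Real.norm_eq_abs,
    abs_of_nonneg (by positivity)]
  field_simp
  ring

theorem inner_ballInversion {e x : E} (he : ‖e‖ = 1) (hx : x + e ≠ 0) :
    inner ℝ e (ballInversion e x) * ‖x + e‖ ^ 2 = 1 - ‖x‖ ^ 2 := by
  have h0 : ‖x + e‖ ≠ 0 := norm_ne_zero_iff.2 hx
  have h1 : ‖x + e‖ ^ 2 = ‖x‖ ^ 2 + 2 * inner ℝ e x + 1 := by
    rw [norm_add_sq_real, he, real_inner_comm]
    ring
  rw [ballInversion, inner_add_right, inner_neg_right, inner_smul_right, inner_add_right,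
    real_inner_self_eq_norm_sq, he]
  field_simp
  linarith

theorem add_ne_zero_of_inner_nonneg {e x : E} (he : ‖e‖ = 1) (hx : 0 ≤ inner ℝ e x) :
    x + e ≠ 0 := by
  intro h
  rw [eq_neg_of_add_eq_zero_left h, inner_neg_right, real_inner_self_eq_norm_sq, he] at hx
  norm_num at hx

/-- A half-space is homeomorphic to the closed unit ball without a boundary point. -/
noncomputable def halfSpaceHomeomorph (e : E) (he : ‖e‖ = 1) :
    {x : E // 0 ≤ inner ℝ e x} ≃ₜ {y : E // ‖y‖ ≤ 1 ∧ y + e ≠ 0} where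
  toFun x := ⟨ballInversion e x, by
    have hx := add_ne_zero_of_inner_nonneg he x.2
    refine ⟨?_, ballInversion_add_ne_zero hx⟩
    have := norm_ballInversion_sq he hx
    have h2 : 0 ≤ 4 * inner ℝ e (x : E) / ‖(x : E) + e‖ ^ 2 := by
      have := x.2
      positivity
    nlinarith [norm_nonneg (ballInversion e (x : E))]⟩
  invFun y := ⟨ballInversion e y, by
    have h1 := inner_ballInversion he y.2.2
    have h2 : 0 < ‖(y : E) + e‖ ^ 2 := by
      have := norm_pos_iff.2 y.2.2
      positivity
    have h3 : ‖(y : E)‖ ^ 2 ≤ 1 := by nlinarith [y.2.1, norm_nonneg (y : E)]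
    by_contra h
    nlinarith⟩
  left_inv x := Subtype.ext (ballInversion_ballInversion (add_ne_zero_of_inner_nonneg he x.2))
  right_inv y := Subtype.ext (ballInversion_ballInversion y.2.2)
  continuous_toFun := by
    refine Continuous.subtype_mk ?_ _
    unfold ballInversion
    refine continuous_const.add (Continuous.smul (continuous_const.div (by fun_prop) fun x => ?_)
      (by fun_prop))
    have := norm_ne_zero_iff.2 (add_ne_zero_of_inner_nonneg he x.2)
    positivity
  continuous_invFun := by
    refine Continuous.subtype_mk ?_ _
    unfold ballInversion
    refine continuous_const.add (Continuous.smul (continuous_const.div (by fun_prop) fun x => ?_)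
      (by fun_prop))
    have := norm_ne_zero_iff.2 x.2.2
    positivity

theorem norm_halfSpaceHomeomorph_eq_one_iff (e : E) (he : ‖e‖ = 1)
    (x : {x : E // 0 ≤ inner ℝ e x}) :
    ‖(halfSpaceHomeomorph e he x : E)‖ = 1 ↔ inner ℝ e (x : E) = 0 := by
  have hx := add_ne_zero_of_inner_nonneg he x.2
  have h0 : ‖(x : E) + e‖ ≠ 0 := norm_ne_zero_iff.2 hx
  have h1 := norm_ballInversion_sq he hx
  change ‖ballInversion e (x : E)‖ = 1 ↔ _
  rw [← sq_eq_sq₀ (norm_nonneg _) zero_le_one, one_pow, h1, sub_eq_self, div_eq_zero_iff]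
  simp [h0]

theorem not_isCompact_halfSpace {e : E} (he : ‖e‖ = 1) : ¬ IsCompact {x : E | 0 ≤ inner ℝ e x} := by
  intro h
  obtain ⟨C, hC⟩ := h.isBounded.exists_norm_le
  have h1 := hC ((|C| + 1) • e) (by
    simp only [Set.mem_ofPred_eq, inner_smul_right, real_inner_self_eq_norm_sq, he]
    positivity)
  rw [norm_smul, he, Real.norm_eq_abs, abs_of_nonneg (by positivity)] at h1
  linarith [le_abs_self C]

/-- If the closure missed `∞`, its preimage in `T` would be compact, and so would the closed set `P`
inside it. -/
theorem closure_coe_image_eq_insert {T : Type*} [TopologicalSpace T] [T2Space T]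
    [LocallyCompactSpace T] {P : Set T} (hP : IsClosed P) (hPc : ¬ IsCompact P) :
    closure ((OnePoint.some : T → OnePoint T) '' P) =
      insert OnePoint.infty ((OnePoint.some : T → OnePoint T) '' P) := by
  refine Set.Subset.antisymm ?_ ?_
  · refine closure_minimal (Set.subset_insert _ _) ?_
    rw [OnePoint.isClosed_iff_of_mem (Set.mem_insert _ _)]
    convert hP
    ext p
    simp
  · refine Set.insert_subset ?_ subset_closure
    by_contra h
    have h2 := (OnePoint.isClosed_iff_of_notMem h).1 isClosed_closure
    refine hPc (h2.2.of_isClosed_subset hP fun p hp => subset_closure ⟨p, hp, rfl⟩)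

theorem closure_coe_image_eq_self {T : Type*} [TopologicalSpace T] [T2Space T]
    [LocallyCompactSpace T] {P : Set T} (hP : IsCompact P) :
    closure ((OnePoint.some : T → OnePoint T) '' P) = (OnePoint.some : T → OnePoint T) '' P :=
  (hP.image OnePoint.continuous_coe).isClosed.closure_eq

/-- The closure in the one-point compactification of a closed set homeomorphic to a half-space is
a closed ball. -/
theorem exists_homeomorph_closure_of_halfSpace {T : Type*} [TopologicalSpace T] [T2Space T]
    [LocallyCompactSpace T] [ProperSpace E] {e : E} (he : ‖e‖ = 1) {P : Set T} (hP : IsClosed P)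
    (g : {x : E // 0 ≤ inner ℝ e x} ≃ₜ P) :
    ∃ φ : closedBall (0 : E) 1 ≃ₜ closure ((OnePoint.some : T → OnePoint T) '' P),
      (fun x => (φ x : OnePoint T)) '' {x | ‖(x : E)‖ = 1} =
        insert OnePoint.infty ((OnePoint.some : T → OnePoint T) ''
          {p | ∃ x : {x : E // 0 ≤ inner ℝ e x}, inner ℝ e (x : E) = 0 ∧ (g x : T) = p}) := by
  have hPc : ¬ IsCompact P := fun h => not_isCompact_halfSpace he (by
    rw [isCompact_iff_compactSpace] at h ⊢
    exact g.symm.compactSpace)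
  have hcl := closure_coe_image_eq_insert hP hPc
  have : CompactSpace (closure ((OnePoint.some : T → OnePoint T) '' P)) :=
    isCompact_iff_compactSpace.1 isClosed_closure.isCompact
  have : CompactSpace (closedBall (0 : E) 1) :=
    isCompact_iff_compactSpace.1 (isCompact_closedBall 0 1)
  -- the ball as a compactification
  let k : P → closedBall (0 : E) 1 := fun p =>
    ⟨halfSpaceHomeomorph e he (g.symm p), by simpa using (halfSpaceHomeomorph e he _).2.1⟩
  have hk : IsEmbedding k := (IsEmbedding.subtypeVal.comp
    (g.symm.trans (halfSpaceHomeomorph e he)).isEmbedding).codRestrict _ _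
  have hmem : -e ∈ closedBall (0 : E) 1 := by simp [he]
  have hkr : Set.range k = {⟨-e, hmem⟩}ᶜ := by
    ext y
    simp only [Set.mem_range, Set.mem_compl_iff, Set.mem_singleton_iff]
    constructor
    · rintro ⟨p, rfl⟩ h
      refine (halfSpaceHomeomorph e he (g.symm p)).2.2 ?_
      rw [show (halfSpaceHomeomorph e he (g.symm p) : E) = -e from congrArg Subtype.val h]
      simp
    · intro h
      have hy : (y : E) + e ≠ 0 := fun h' => h (Subtype.ext (eq_neg_of_add_eq_zero_left h'))
      refine ⟨g ((halfSpaceHomeomorph e he).symm ⟨y, mem_closedBall_zero_iff.1 y.2, hy⟩),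
        Subtype.ext ?_⟩
      simp [k]
  -- the closure as a compactification
  let k' : P → closure ((OnePoint.some : T → OnePoint T) '' P) := fun p =>
    ⟨(p : T), subset_closure ⟨p, p.2, rfl⟩⟩
  have hk' : IsEmbedding k' := (OnePoint.isOpenEmbedding_coe.isEmbedding.comp
    IsEmbedding.subtypeVal).codRestrict _ _
  have hmem' : OnePoint.infty ∈ closure ((OnePoint.some : T → OnePoint T) '' P) := by
    rw [hcl]; exact Set.mem_insert _ _
  have hkr' : Set.range k' = {⟨OnePoint.infty, hmem'⟩}ᶜ := by
    ext ⟨y, hy⟩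
    simp only [Set.mem_range, Set.mem_compl_iff, Set.mem_singleton_iff, Subtype.mk.injEq, k']
    rw [hcl] at hy
    constructor
    · rintro ⟨p, rfl⟩
      exact OnePoint.coe_ne_infty _
    · intro h
      obtain ⟨p, hp, rfl⟩ := hy.resolve_left h
      exact ⟨⟨p, hp⟩, rfl⟩
  let Φ := OnePoint.equivOfIsEmbeddingOfRangeEq _ k hk hkr
  let Φ' := OnePoint.equivOfIsEmbeddingOfRangeEq _ k' hk' hkr'
  have hφ : ∀ p : P, (Φ.symm.trans Φ') (k p) = k' p := fun p => by
    have h1 : Φ p = k p := OnePoint.equivOfIsEmbeddingOfRangeEq_apply_coe _ k hk hkr p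
    have h2 : Φ' p = k' p := OnePoint.equivOfIsEmbeddingOfRangeEq_apply_coe _ k' hk' hkr' p
    rw [← h1, Homeomorph.trans_apply, Homeomorph.symm_apply_apply, h2]
  have hφ' : (Φ.symm.trans Φ') ⟨-e, hmem⟩ = ⟨OnePoint.infty, hmem'⟩ := by
    have h1 : Φ OnePoint.infty = _ := OnePoint.equivOfIsEmbeddingOfRangeEq_apply_infty _ k hk hkr
    have h2 : Φ' OnePoint.infty = _ :=
      OnePoint.equivOfIsEmbeddingOfRangeEq_apply_infty _ k' hk' hkr'
    rw [← h1, Homeomorph.trans_apply, Homeomorph.symm_apply_apply, h2]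
  refine ⟨Φ.symm.trans Φ', ?_⟩
  ext q
  simp only [Set.mem_image, Set.mem_ofPred_eq, Set.mem_insert_iff]
  constructor
  · rintro ⟨y, hy, rfl⟩
    by_cases h : y = ⟨-e, hmem⟩
    · left; rw [h, hφ']
    · right
      have h' : y ∈ Set.range k := by rw [hkr]; exact h
      obtain ⟨p, rfl⟩ := h'
      rw [hφ]
      exact ⟨p, ⟨g.symm p, (norm_halfSpaceHomeomorph_eq_one_iff e he _).1 hy, by simp⟩, rfl⟩
  · rintro (rfl | ⟨p, ⟨x, hx, rfl⟩, rfl⟩)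
    · exact ⟨⟨-e, hmem⟩, by simp [he], by rw [hφ']⟩
    · refine ⟨k (g x), ?_, by rw [hφ]⟩
      simpa [k] using (norm_halfSpaceHomeomorph_eq_one_iff e he x).2 hx

end HalfSpace

/-! ### Solution sets of affine inequalities -/

section Polyhedron

variable {E ι : Type*} [NormedAddCommGroup E] [NormedSpace ℝ E] [Finite ι]

theorem isOpen_setOf_forall_add_neg (β : ι → ℝ) (ℓ : ι → E →L[ℝ] ℝ) :
    IsOpen {u : E | ∀ t, β t + ℓ t u < 0} := by
  simp only [Set.ofPred_forall]
  exact isOpen_iInter_of_finite fun t => isOpen_lt (by fun_prop) continuous_const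

theorem isClosed_setOf_forall_add_nonpos (β : ι → ℝ) (ℓ : ι → E →L[ℝ] ℝ) :
    IsClosed {u : E | ∀ t, β t + ℓ t u ≤ 0} := by
  simp only [Set.ofPred_forall]
  exact isClosed_iInter fun t => isClosed_le (by fun_prop) continuous_const

theorem convex_setOf_forall_add_nonpos (β : ι → ℝ) (ℓ : ι → E →L[ℝ] ℝ) :
    Convex ℝ {u : E | ∀ t, β t + ℓ t u ≤ 0} := by
  intro u hu v hv a b ha hb hab t
  have h1 := hu t
  have h2 := hv t
  simp only [map_add, map_smul, smul_eq_mul]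
  have : β t = a * β t + b * β t := by rw [← add_mul, hab, one_mul]
  nlinarith

theorem interior_setOf_forall_add_nonpos {β : ι → ℝ} (ℓ : ι → E →L[ℝ] ℝ) (hβ : ∀ t, β t < 0) :
    interior {u : E | ∀ t, β t + ℓ t u ≤ 0} = {u | ∀ t, β t + ℓ t u < 0} := by
  refine Set.Subset.antisymm (fun u hu t => ?_)
    (interior_maximal (fun u hu t => (hu t).le) (isOpen_setOf_forall_add_neg β ℓ))
  refine lt_of_le_of_ne (interior_subset hu t) fun h0 => ?_
  -- Since `β t < 0`, dilating `u` slightly away from the origin violates any inequality that is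
  -- tight at `u`.
  have hc : Tendsto (fun ε : ℝ => u + ε • u) (𝓝[>] 0) (𝓝 u) := by
    have : Tendsto (fun ε : ℝ => u + ε • u) (𝓝 0) (𝓝 (u + (0 : ℝ) • u)) :=
      Continuous.tendsto (by fun_prop) 0
    rw [zero_smul, add_zero] at this
    exact this.mono_left nhdsWithin_le_nhds
  obtain ⟨ε, hε, hε0⟩ :=
    ((hc.eventually (mem_interior_iff_mem_nhds.1 hu)).and self_mem_nhdsWithin).exists
  have hε0 : 0 < ε := hε0
  have h1 := hε t
  simp only [map_add, map_smul, smul_eq_mul] at h1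
  nlinarith [hβ t]

end Polyhedron

/-! ### The product of a convex body and an orthant -/

section Orthant

variable {E J : Type*} [NormedAddCommGroup E] [NormedSpace ℝ E] [Fintype J] [Nonempty J]

/-- The least coordinate of a vector. -/
noncomputable def minCoord (x : J → ℝ) : ℝ := Finset.univ.inf' Finset.univ_nonempty x

theorem minCoord_le (x : J → ℝ) (j : J) : minCoord x ≤ x j :=
  Finset.inf'_le _ (Finset.mem_univ j)

theorem exists_eq_minCoord (x : J → ℝ) : ∃ j, minCoord x = x j := by
  obtain ⟨j, -, hj⟩ := Finset.exists_mem_eq_inf' (s := Finset.univ) Finset.univ_nonempty x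
  exact ⟨j, hj⟩

theorem minCoord_add_const (x : J → ℝ) (r : ℝ) : minCoord (fun j => x j + r) = minCoord x + r := by
  obtain ⟨j, hj⟩ := exists_eq_minCoord x
  obtain ⟨k, hk : _ = x k + r⟩ := exists_eq_minCoord fun j => x j + r
  have h1 := minCoord_le x k
  have h2 : _ ≤ x j + r := minCoord_le (fun j => x j + r) j
  linarith

@[fun_prop]
theorem continuous_minCoord : Continuous (minCoord : (J → ℝ) → ℝ) := by
  unfold minCoord
  exact Continuous.finset_inf'_apply _ fun i _ => continuous_apply i

theorem minCoord_nonneg {x : J → ℝ} (hx : ∀ j, 0 ≤ x j) : 0 ≤ minCoord x := by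
  obtain ⟨j, hj⟩ := exists_eq_minCoord x
  exact hj ▸ hx j

/-- The amount by which the gauge of a set exceeds one. -/
noncomputable def gaugeExcess (s : Set E) (y : E) : ℝ := max 0 (gauge s y - 1)

theorem gaugeExcess_nonneg (s : Set E) (y : E) : 0 ≤ gaugeExcess s y := le_max_left _ _

theorem gauge_le_one_add_gaugeExcess (s : Set E) (y : E) : gauge s y ≤ 1 + gaugeExcess s y := by
  have : gauge s y - 1 ≤ gaugeExcess s y := le_max_right _ _
  linarith

theorem gaugeExcess_smul_le {s : Set E} {u : E} (hu : u ∈ s) {r : ℝ} (hr : 0 ≤ r) :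
    gaugeExcess s ((1 + r) • u) ≤ r := by
  refine max_le hr ?_
  rw [gauge_smul_of_nonneg (by linarith), smul_eq_mul]
  nlinarith [gauge_le_one_of_mem hu]

/-- The product of a closed convex body and an orthant is homeomorphic to a half-space. -/
noncomputable def prodOrthantHomeomorph {s : Set E} (hc : Convex ℝ s) (hcl : IsClosed s)
    (h0 : s ∈ 𝓝 0) (j₀ : J) :
    {q : E × (J → ℝ) // q.1 ∈ s ∧ ∀ j, 0 ≤ q.2 j} ≃ₜ {q : E × (J → ℝ) // 0 ≤ q.2 j₀} where
  -- Write `m` for the least orthant coordinate. The pairs of `y = (1 + m) • u` and `m` fill the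
  -- region where `m` is at least the gauge excess of `y`. A common shift of all orthant coordinates
  -- places `m` minus this excess in coordinate `j₀`, which flattens the region to a half-space.
  toFun q := ⟨((1 + minCoord q.1.2) • q.1.1, fun j => q.1.2 j +
    (minCoord q.1.2 - q.1.2 j₀ - gaugeExcess s ((1 + minCoord q.1.2) • q.1.1))), by
      have := gaugeExcess_smul_le q.2.1 (minCoord_nonneg q.2.2)
      simp only
      linarith⟩
  invFun q := ⟨((1 + (q.1.2 j₀ + gaugeExcess s q.1.1))⁻¹ • q.1.1, fun j => q.1.2 j +
    (q.1.2 j₀ - minCoord q.1.2 + gaugeExcess s q.1.1)), by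
      have h1 := gaugeExcess_nonneg s q.1.1
      have h2 := q.2
      constructor
      · refine hcl.closure_subset ?_
        rw [← gauge_le_one_iff_mem_closure hc h0,
          gauge_smul_of_nonneg (by positivity), smul_eq_mul, inv_mul_le_iff₀ (by linarith)]
        have := gauge_le_one_add_gaugeExcess s q.1.1
        linarith
      · intro j
        have := minCoord_le q.1.2 j
        simp only
        linarith⟩
  left_inv q := by
    have h1 := minCoord_nonneg q.2.2
    refine Subtype.ext (Prod.ext ?_ (funext fun j => ?_))
    · simp only [smul_smul]
      rw [show (1 + (q.1.2 j₀ + (minCoord q.1.2 - q.1.2 j₀ -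
        gaugeExcess s ((1 + minCoord q.1.2) • q.1.1)) + gaugeExcess s
        ((1 + minCoord q.1.2) • q.1.1))) = 1 + minCoord q.1.2 by ring,
        inv_mul_cancel₀ (by positivity), one_smul]
    · simp only [minCoord_add_const]
      ring
  right_inv q := by
    have h1 := gaugeExcess_nonneg s q.1.1
    have h2 := q.2
    have h3 : (1 + (minCoord q.1.2 + (q.1.2 j₀ - minCoord q.1.2 + gaugeExcess s q.1.1))) •
        (1 + (q.1.2 j₀ + gaugeExcess s q.1.1))⁻¹ • q.1.1 = q.1.1 := by
      rw [smul_smul, show 1 + (minCoord q.1.2 + (q.1.2 j₀ - minCoord q.1.2 +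
        gaugeExcess s q.1.1)) = 1 + (q.1.2 j₀ + gaugeExcess s q.1.1) by ring,
        mul_inv_cancel₀ (by linarith), one_smul]
    refine Subtype.ext (Prod.ext ?_ (funext fun j => ?_))
    · simp only [minCoord_add_const]
      exact h3
    · simp only [minCoord_add_const, h3]
      ring
  continuous_toFun := by
    have hg : Continuous (gaugeExcess s) := by
      unfold gaugeExcess
      exact continuous_const.max ((continuous_gauge hc h0).sub continuous_const)
    fun_prop
  continuous_invFun := by
    have hg : Continuous (gaugeExcess s) := by
      unfold gaugeExcess
      exact continuous_const.max ((continuous_gauge hc h0).sub continuous_const)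
    refine Continuous.subtype_mk (Continuous.prodMk (Continuous.smul (Continuous.inv₀
      (by fun_prop) fun q => ?_) (by fun_prop)) (by fun_prop)) _
    have h1 := gaugeExcess_nonneg s q.1.1
    have h2 := q.2
    linarith

/-- With `m` the least coordinate and `u` the point of the body, `m` equals the excess of `(1 + m) •
u` exactly if `m = 0` or `u` has gauge one. So boundary goes to boundary. -/
theorem prodOrthantHomeomorph_eq_zero_iff {s : Set E} (hc : Convex ℝ s) (hcl : IsClosed s)
    (h0 : s ∈ 𝓝 0) (j₀ : J) (q : {q : E × (J → ℝ) // q.1 ∈ s ∧ ∀ j, 0 ≤ q.2 j}) :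
    (prodOrthantHomeomorph hc hcl h0 j₀ q).1.2 j₀ = 0 ↔
      q.1.1 ∉ interior s ∨ ∃ j, q.1.2 j = 0 := by
  have h1 := minCoord_nonneg q.2.2
  have h2 := gauge_le_one_of_mem q.2.1
  have h3 : (prodOrthantHomeomorph hc hcl h0 j₀ q).1.2 j₀ =
      minCoord q.1.2 - gaugeExcess s ((1 + minCoord q.1.2) • q.1.1) := by
    change q.1.2 j₀ + (minCoord q.1.2 - q.1.2 j₀ - _) = _
    ring
  rw [h3, ← gauge_lt_one_iff_mem_interior hc h0, not_lt, gaugeExcess,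
    gauge_smul_of_nonneg (by linarith), smul_eq_mul]
  constructor
  · intro h
    rcases max_choice 0 ((1 + minCoord q.1.2) * gauge s q.1.1 - 1) with hm | hm
    · obtain ⟨j, hj⟩ := exists_eq_minCoord q.1.2
      rw [hm] at h
      exact Or.inr ⟨j, by linarith⟩
    · rw [hm] at h
      left
      by_contra hlt
      nlinarith
  · rintro (h | ⟨j, hj⟩)
    · have : gauge s q.1.1 = 1 := le_antisymm h2 h
      rw [this, max_eq_right] <;> linarith
    · have : minCoord q.1.2 = 0 := le_antisymm ((minCoord_le _ j).trans hj.le) h1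
      rw [this, max_eq_left] <;> linarith

end Orthant

/-! ### From half-spaces and convex bodies to Euclidean balls -/

section Transport

open Metric

variable {F T : Type*} [NormedAddCommGroup F] [NormedSpace ℝ F] [FiniteDimensional ℝ F]
  [TopologicalSpace T] [T2Space T] [LocallyCompactSpace T] {r : ℕ}

/-- In linear coordinates the functional is the inner product with a nonzero vector, which may be
normalized without changing the half-space. -/
theorem exists_ball_homeomorph_of_halfSpace (hr : Module.finrank ℝ F = r) {ℓ : F →L[ℝ] ℝ}
    (hℓ : ℓ ≠ 0) {P : Set T} (hP : IsClosed P) (g : {q : F // 0 ≤ ℓ q} ≃ₜ P) :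
    ∃ φ : closedBall (0 : EuclideanSpace ℝ (Fin r)) 1 ≃ₜ
        closure ((OnePoint.some : T → OnePoint T) '' P),
      (fun x => (φ x : OnePoint T)) '' {x | ‖(x : EuclideanSpace ℝ (Fin r))‖ = 1} =
        insert OnePoint.infty ((OnePoint.some : T → OnePoint T) ''
          {p | ∃ q : {q : F // 0 ≤ ℓ q}, ℓ q = 0 ∧ (g q : T) = p}) := by
  let L : EuclideanSpace ℝ (Fin r) ≃L[ℝ] F := ContinuousLinearEquiv.ofFinrankEq (by simp [hr])
  obtain ⟨a, ha⟩ := (InnerProductSpace.toDual ℝ (EuclideanSpace ℝ (Fin r))).surjective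
    (ℓ.comp L.toContinuousLinearMap)
  have ha' : ∀ x, inner ℝ a x = ℓ (L x) := fun x => by
    rw [← InnerProductSpace.toDual_apply_apply, ha]
    rfl
  have ha0 : a ≠ 0 := by
    rintro rfl
    refine hℓ (ContinuousLinearMap.ext fun q => ?_)
    have := ha' (L.symm q)
    simpa using this.symm
  have hna : 0 < ‖a‖ := norm_pos_iff.2 ha0
  set e := ‖a‖⁻¹ • a with he
  have he1 : ‖e‖ = 1 := by
    rw [he, norm_smul, norm_inv, norm_norm, inv_mul_cancel₀ hna.ne']
  have hin : ∀ x, inner ℝ e x = ‖a‖⁻¹ * ℓ (L x) := fun x => by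
    rw [he, real_inner_smul_left, ha']
  let g' : {x : EuclideanSpace ℝ (Fin r) // 0 ≤ inner ℝ e x} ≃ₜ {q : F // 0 ≤ ℓ q} :=
    L.toHomeomorph.subtype fun x => by
      rw [hin]
      exact mul_nonneg_iff_of_pos_left (inv_pos.2 hna)
  obtain ⟨φ, hφ⟩ := exists_homeomorph_closure_of_halfSpace he1 hP (g'.trans g)
  refine ⟨φ, hφ.trans ?_⟩
  congr 2
  ext p
  constructor
  · rintro ⟨x, hx, rfl⟩
    refine ⟨g' x, ?_, rfl⟩
    rw [hin] at hx
    exact (mul_eq_zero.1 hx).resolve_left (inv_pos.2 hna).ne'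
  · rintro ⟨q, hq, rfl⟩
    refine ⟨g'.symm q, ?_, by simp⟩
    have h1 : L (g'.symm q : EuclideanSpace ℝ (Fin r)) = q :=
      congrArg Subtype.val (g'.apply_symm_apply q)
    rw [hin, h1, hq, mul_zero]

theorem exists_ball_homeomorph_of_convexBody (hr : Module.finrank ℝ F = r) {s : Set F}
    (hc : Convex ℝ s) (hcl : IsClosed s) (hb : Bornology.IsBounded s) (h0 : (interior s).Nonempty)
    {P : Set T} (g : s ≃ₜ P) :
    ∃ φ : closedBall (0 : EuclideanSpace ℝ (Fin r)) 1 ≃ₜ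
        closure ((OnePoint.some : T → OnePoint T) '' P),
      (fun x => (φ x : OnePoint T)) '' {x | ‖(x : EuclideanSpace ℝ (Fin r))‖ = 1} =
        (OnePoint.some : T → OnePoint T) ''
          {p | ∃ q : s, (q : F) ∉ interior s ∧ (g q : T) = p} := by
  let L : EuclideanSpace ℝ (Fin r) ≃L[ℝ] F := ContinuousLinearEquiv.ofFinrankEq (by simp [hr])
  have hsc : IsCompact s := isCompact_of_isClosed_isBounded hcl hb
  have hP : IsCompact P := by
    rw [isCompact_iff_compactSpace] at hsc ⊢
    exact g.compactSpace
  set s' : Set (EuclideanSpace ℝ (Fin r)) := L ⁻¹' s with hs'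
  have hint : interior s' = L ⁻¹' interior s := (L.toHomeomorph.preimage_interior s).symm
  have hcomp : IsCompact s' := L.toHomeomorph.isCompact_preimage.2 hsc
  obtain ⟨h, hi, hcl', -⟩ := exists_homeomorph_image_interior_closure_frontier_eq_unitBall
    (s := s') (hc.linear_preimage L.toLinearMap) (by
      rw [hint]
      obtain ⟨q, hq⟩ := h0
      exact ⟨L.symm q, by simpa using hq⟩) hcomp.isBounded
  rw [hcomp.isClosed.closure_eq] at hcl'
  have hcle := closure_coe_image_eq_self hP
  let φ₁ : closedBall (0 : EuclideanSpace ℝ (Fin r)) 1 ≃ₜ s' :=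
    (h.subtype (p := (· ∈ s')) (q := (· ∈ closedBall 0 1)) fun x => by
      rw [← hcl', h.injective.mem_set_image]).symm
  let φ₂ : s' ≃ₜ s := L.toHomeomorph.subtype fun x => Iff.rfl
  let φ₃ : P ≃ₜ (OnePoint.some : T → OnePoint T) '' P :=
    OnePoint.isOpenEmbedding_coe.isEmbedding.homeomorphImage P
  let φ : closedBall (0 : EuclideanSpace ℝ (Fin r)) 1 ≃ₜ
      closure ((OnePoint.some : T → OnePoint T) '' P) :=
    (((φ₁.trans φ₂).trans g).trans φ₃).trans (Homeomorph.setCongr hcle.symm)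
  have hφ : ∀ x, (φ x : OnePoint T) = ((g (φ₂ (φ₁ x)) : T) : OnePoint T) := fun x => rfl
  have hnorm : ∀ x : s', ‖(φ₁.symm x : EuclideanSpace ℝ (Fin r))‖ = 1 ↔
      (φ₂ x : F) ∉ interior s := fun x => by
    have h1 : (φ₁.symm x : EuclideanSpace ℝ (Fin r)) = h x := rfl
    have h2 : h x ∈ closedBall (0 : EuclideanSpace ℝ (Fin r)) 1 :=
      hcl' ▸ Set.mem_image_of_mem h x.2
    have h3 : h x ∈ ball (0 : EuclideanSpace ℝ (Fin r)) 1 ↔ (φ₂ x : F) ∈ interior s := by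
      rw [← hi, h.injective.mem_set_image, hint]
      rfl
    rw [h1, ← h3, mem_ball_zero_iff, not_lt]
    exact ⟨fun h => h.ge, fun h => le_antisymm (mem_closedBall_zero_iff.1 h2) h⟩
  refine ⟨φ, ?_⟩
  ext p
  constructor
  · rintro ⟨x, hx, rfl⟩
    refine ⟨_, ⟨φ₂ (φ₁ x), (hnorm (φ₁ x)).1 ?_, rfl⟩, (hφ x).symm⟩
    rw [φ₁.symm_apply_apply]
    exact hx
  · rintro ⟨_, ⟨q, hq, rfl⟩, rfl⟩
    refine ⟨φ₁.symm (φ₂.symm q), ?_, ?_⟩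
    · rw [Set.mem_ofPred_eq, hnorm, φ₂.apply_symm_apply]
      exact hq
    · simp only [hφ, Homeomorph.apply_symm_apply]

end Transport

/-! ### Topology of the tropical projective torus -/

namespace TropicalTorus

variable {d n : ℕ}

/-- The representative of a point of the torus whose coordinate `i₀` vanishes. -/
def normalize (i₀ : Fin d) : TropicalTorus d →ₗ[ℝ] (Fin d → ℝ) :=
  Submodule.liftQ _
    { toFun := fun y k => y k - y i₀
      map_add' := fun y y' => by
        ext k
        simp only [Pi.add_apply]
        ring
      map_smul' := fun r y => by
        ext k
        simp only [Pi.smul_apply, smul_eq_mul, RingHom.id_apply]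
        ring } (by
    rw [Submodule.span_singleton_le_iff_mem, LinearMap.mem_ker]
    ext k
    simp)

theorem normalize_mk (i₀ : Fin d) (y : Fin d → ℝ) (k : Fin d) :
    normalize i₀ (Submodule.Quotient.mk y) k = y k - y i₀ := rfl

theorem mk_add_const (y : Fin d → ℝ) (r : ℝ) :
    (Submodule.Quotient.mk (fun k => y k + r) : TropicalTorus d) = Submodule.Quotient.mk y := by
  rw [Submodule.Quotient.eq, Submodule.mem_span_singleton]
  refine ⟨r, ?_⟩
  ext k
  simp

theorem mk_normalize (i₀ : Fin d) (p : TropicalTorus d) :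
    Submodule.Quotient.mk (normalize i₀ p) = p := by
  induction p using Submodule.Quotient.induction_on with
  | _ y =>
    rw [← mk_add_const y (-y i₀)]
    congr 1
    ext k
    rw [normalize_mk]
    ring

theorem continuous_mk : Continuous (Submodule.Quotient.mk : (Fin d → ℝ) → TropicalTorus d) :=
  continuous_quot_mk

theorem continuous_normalize (i₀ : Fin d) : Continuous (normalize i₀) := by
  refine (Submodule.isOpenQuotientMap_mkQ _).isQuotientMap.continuous_iff.2 ?_
  change Continuous fun y : Fin d → ℝ => fun k => y k - y i₀
  fun_prop

/-- Normalizing a coordinate is a continuous section of the quotient map; the Hausdorff and locally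
compact properties are pulled back along it. -/
theorem isClosedEmbedding_normalize (i₀ : Fin d) :
    IsClosedEmbedding (normalize i₀) :=
  Function.LeftInverse.isClosedEmbedding 
    (f := (Submodule.Quotient.mk : (Fin d → ℝ) → TropicalTorus d)) (mk_normalize i₀)
    continuous_mk (continuous_normalize i₀)

theorem t2Space (i₀ : Fin d) : T2Space (TropicalTorus d) :=
  T2Space.of_injective_continuous (Function.LeftInverse.injective (mk_normalize i₀))
    (continuous_normalize i₀)

theorem locallyCompactSpace (i₀ : Fin d) : LocallyCompactSpace (TropicalTorus d) := by
  have := t2Space i₀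
  exact (isClosedEmbedding_normalize i₀).locallyCompactSpace

theorem covector_mk (V : Matrix (Fin d) (Fin n) ℝ) (y : Fin d → ℝ) :
    TropicalTorus.covector V (Submodule.Quotient.mk y) = _root_.covector V y := rfl

end TropicalTorus

/-! ### Covector cells as products of a bounded part and an orthant -/

section Cell

variable {d n : ℕ} (V : Matrix (Fin d) (Fin n) ℝ) (x : Fin d → ℝ)

theorem exists_mem_covector [Nonempty (Fin d)] (y : Fin d → ℝ) (j : Fin n) :
    ∃ i, j ∈ covector V y i := by
  obtain ⟨i, hi⟩ := Finite.exists_min fun k => y k - V k j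
  exact ⟨i, hi⟩

variable {V x}

theorem sub_eq_sub_of_mem_covector {i k : Fin d} {j : Fin n} (hi : j ∈ covector V x i)
    (hk : j ∈ covector V x k) : x i - V i j = x k - V k j :=
  le_antisymm (hi k) (hk i)

theorem sub_lt_sub_of_mem_covector {i k : Fin d} {j : Fin n} (hi : j ∈ covector V x i)
    (hk : j ∉ covector V x k) : x i - V i j < x k - V k j :=
  lt_of_le_of_ne (hi k) fun h => hk fun l => h ▸ hi l

theorem mk_mem_covectorCell {H : Fin d → Set (Fin n)} {y : Fin d → ℝ} :
    (Submodule.Quotient.mk y : TropicalTorus d) ∈ covectorCell V H ↔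
      ∀ i, ∀ j ∈ H i, ∀ k, y i - V i j ≤ y k - V k j := Iff.rfl

variable (V x)

theorem isClosed_covectorCell (i₀ : Fin d) (H : Fin d → Set (Fin n)) :
    IsClosed (covectorCell V H) := by
  have : covectorCell V H = {p | ∀ i, ∀ j ∈ H i, ∀ k,
      TropicalTorus.normalize i₀ p i - V i j ≤ TropicalTorus.normalize i₀ p k - V k j} := by
    ext p
    conv_lhs => rw [← TropicalTorus.mk_normalize i₀ p]
    exact mk_mem_covectorCell
  rw [this]
  have hc := fun k => (continuous_apply k).comp (TropicalTorus.continuous_normalize i₀)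
  simp only [Set.ofPred_forall]
  exact isClosed_iInter fun i => isClosed_iInter fun j => isClosed_iInter fun _ =>
    isClosed_iInter fun k => isClosed_le ((hc i).sub continuous_const) ((hc k).sub continuous_const)

/-- The directions of the bounded part of the cell of `x`. -/
def boundedDirections (i₀ : Fin d) : Submodule ℝ (Fin d → ℝ) where
  carrier := {u | (∀ j i k, j ∈ covector V x i → j ∈ covector V x k → u i = u k) ∧ u i₀ = 0 ∧
    ∀ k, covector V x k = ∅ → u k = 0}
  add_mem' {u v} hu hv := ⟨fun j i k hi hk => by simp [hu.1 j i k hi hk, hv.1 j i k hi hk],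
    by simp [hu.2.1, hv.2.1], fun k hk => by simp [hu.2.2 k hk, hv.2.2 k hk]⟩
  zero_mem' := by simp
  smul_mem' r u hu := ⟨fun j i k hi hk => by simp [hu.1 j i k hi hk], by simp [hu.2.1],
    fun k hk => by simp [hu.2.2 k hk]⟩

/-- The coordinates that are unbounded on the cell of `x`. -/
abbrev FreeCoord : Type := {k : Fin d // covector V x k = ∅}

/-- The indices of the inequalities of the bounded part of the cell of `x` that are strict at
`x`. -/
abbrev StrictIndex : Type := {t : Fin d × Fin n × Fin d //
  t.2.1 ∈ covector V x t.1 ∧ (covector V x t.2.2).Nonempty ∧ t.2.1 ∉ covector V x t.2.2}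

noncomputable def strictConst (t : StrictIndex V x) : ℝ :=
  (x t.1.1 - V t.1.1 t.1.2.1) - (x t.1.2.2 - V t.1.2.2 t.1.2.1)

theorem strictConst_neg (t : StrictIndex V x) : strictConst V x t < 0 :=
  sub_neg.2 (sub_lt_sub_of_mem_covector t.2.1 t.2.2.2)

noncomputable def strictForm (i₀ : Fin d) (t : StrictIndex V x) :
    boundedDirections V x i₀ →L[ℝ] ℝ :=
  (ContinuousLinearMap.proj (R := ℝ) (φ := fun _ : Fin d => ℝ) t.1.1 -
    ContinuousLinearMap.proj (R := ℝ) (φ := fun _ : Fin d => ℝ) t.1.2.2).comp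
    (boundedDirections V x i₀).subtypeL

theorem strictForm_apply (i₀ : Fin d) (t : StrictIndex V x) (u : boundedDirections V x i₀) :
    strictForm V x i₀ t u = u.1 t.1.1 - u.1 t.1.2.2 := rfl

/-- The bounded part of the cell of `x`, as a set of displacements. -/
def boundedPart (i₀ : Fin d) : Set (boundedDirections V x i₀) :=
  {u | ∀ t, strictConst V x t + strictForm V x i₀ t u ≤ 0}

theorem interior_boundedPart (i₀ : Fin d) : interior (boundedPart V x i₀) =
    {u | ∀ t, strictConst V x t + strictForm V x i₀ t u < 0} :=
  interior_setOf_forall_add_nonpos _ (strictConst_neg V x)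

theorem zero_mem_interior_boundedPart (i₀ : Fin d) : 0 ∈ interior (boundedPart V x i₀) := by
  rw [interior_boundedPart]
  intro t
  simpa using strictConst_neg V x t

theorem sub_le_of_mem_boundedPart {i₀ : Fin d} {u : boundedDirections V x i₀}
    (hu : u ∈ boundedPart V x i₀) {i k : Fin d} {j : Fin n} (hi : j ∈ covector V x i)
    (hk : (covector V x k).Nonempty) :
    (x i + u.1 i) - V i j ≤ (x k + u.1 k) - V k j := by
  by_cases hjk : j ∈ covector V x k
  · have h1 := u.2.1 j i k hi hjk
    have h2 := sub_eq_sub_of_mem_covector hi hjk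
    linarith
  · have := hu ⟨(i, j, k), hi, hk, hjk⟩
    rw [strictForm_apply, strictConst] at this
    simp only at this
    linarith

/-- A coordinate `k` with nonempty `G_k(x)` is compared with `i₀` in both directions, through a
minimum attained at `k` and one attained at `i₀`; the displacement at `i₀` is zero. -/
theorem isBounded_boundedPart {i₀ : Fin d} (hi₀ : (covector V x i₀).Nonempty) :
    Bornology.IsBounded (boundedPart V x i₀) := by
  obtain ⟨C, hC⟩ : ∃ C, ∀ t : Fin d × Fin n × Fin d,
      |(x t.2.2 - V t.2.2 t.2.1) - (x t.1 - V t.1 t.2.1)| ≤ C := by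
    obtain ⟨C, hC⟩ := (Set.finite_range fun t : Fin d × Fin n × Fin d =>
      |(x t.2.2 - V t.2.2 t.2.1) - (x t.1 - V t.1 t.2.1)|).bddAbove
    exact ⟨C, fun t => hC ⟨t, rfl⟩⟩
  obtain ⟨j₀, hj₀⟩ := hi₀
  have hC0 : 0 ≤ C := (abs_nonneg _).trans (hC (i₀, j₀, i₀))
  refine (Metric.isBounded_iff_subset_closedBall 0).2 ⟨C, fun u hu => ?_⟩
  rw [mem_closedBall_zero_iff]
  change ‖(u : Fin d → ℝ)‖ ≤ C
  rw [pi_norm_le_iff_of_nonneg hC0]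
  intro k
  rw [Real.norm_eq_abs]
  rcases (covector V x k).eq_empty_or_nonempty with hk | ⟨j, hj⟩
  · rw [u.2.2.2 k hk, abs_zero]
    exact hC0
  · have h1 := sub_le_of_mem_boundedPart V x hu hj₀ ⟨j, hj⟩
    have h2 := sub_le_of_mem_boundedPart V x hu hj ⟨j₀, hj₀⟩
    rw [u.2.2.1] at h1 h2
    have h3 := abs_le.1 (hC (i₀, j₀, k))
    have h4 := abs_le.1 (hC (k, j, i₀))
    simp only at h3 h4
    exact abs_le.2 ⟨by linarith, by linarith⟩

open Classical in
/-- The pairs `(i, j)` with `j ∈ Gᵢ(x)`. -/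
noncomputable def covectorPairs : Finset (Fin d × Fin n) :=
  Finset.univ.filter fun t => t.2 ∈ covector V x t.1

variable {V x} in
theorem mem_covectorPairs {t : Fin d × Fin n} :
    t ∈ covectorPairs V x ↔ t.2 ∈ covector V x t.1 := by
  simp [covectorPairs]

variable {V x} in
theorem covectorPairs_nonempty {i₀ : Fin d} (hi₀ : (covector V x i₀).Nonempty) :
    (covectorPairs V x).Nonempty := by
  obtain ⟨j, hj⟩ := hi₀
  exact ⟨(i₀, j), mem_covectorPairs.2 hj⟩

/-- The least value of an unbounded coordinate on the points of the cell of `x` with given bounded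
coordinates. -/
noncomputable def leastCoord {i₀ : Fin d} (hi₀ : (covector V x i₀).Nonempty) (k : Fin d)
    (y : Fin d → ℝ) : ℝ :=
  (covectorPairs V x).sup' (covectorPairs_nonempty hi₀) fun t => y t.1 - V t.1 t.2 + V k t.2

variable {V x} in
theorem le_leastCoord {i₀ : Fin d} (hi₀ : (covector V x i₀).Nonempty) (k : Fin d)
    (y : Fin d → ℝ) {i : Fin d} {j : Fin n} (hj : j ∈ covector V x i) :
    y i - V i j + V k j ≤ leastCoord V x hi₀ k y :=
  Finset.le_sup' (fun t : Fin d × Fin n => y t.1 - V t.1 t.2 + V k t.2)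
    (mem_covectorPairs.2 hj : (i, j) ∈ covectorPairs V x)

variable {V x} in
theorem exists_eq_leastCoord {i₀ : Fin d} (hi₀ : (covector V x i₀).Nonempty) (k : Fin d)
    (y : Fin d → ℝ) : ∃ i j, j ∈ covector V x i ∧ leastCoord V x hi₀ k y = y i - V i j + V k j := by
  obtain ⟨t, ht, h⟩ := Finset.exists_mem_eq_sup' (covectorPairs_nonempty hi₀)
    fun t : Fin d × Fin n => y t.1 - V t.1 t.2 + V k t.2
  exact ⟨t.1, t.2, mem_covectorPairs.1 ht, h⟩

variable {V x} in
theorem leastCoord_congr {i₀ : Fin d} (hi₀ : (covector V x i₀).Nonempty) (k : Fin d)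
    {y y' : Fin d → ℝ} (h : ∀ i, covector V x i ≠ ∅ → y i = y' i) :
    leastCoord V x hi₀ k y = leastCoord V x hi₀ k y' :=
  Finset.sup'_congr _ rfl fun t ht => by
    rw [h t.1 (Set.nonempty_iff_ne_empty.1 ⟨t.2, mem_covectorPairs.1 ht⟩)]

theorem continuous_leastCoord {i₀ : Fin d} (hi₀ : (covector V x i₀).Nonempty) (k : Fin d) :
    Continuous (leastCoord V x hi₀ k) := by
  unfold leastCoord
  exact Continuous.finset_sup'_apply _ fun t _ => by fun_prop

open Classical in
/-- The representative of a point of the cell of `x` with given bounded coordinates and given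
excess of the unbounded coordinates. -/
noncomputable def cellPoint {i₀ : Fin d} (hi₀ : (covector V x i₀).Nonempty) (u : Fin d → ℝ)
    (s : FreeCoord V x → ℝ) : Fin d → ℝ :=
  fun k => if h : covector V x k = ∅ then s ⟨k, h⟩ + leastCoord V x hi₀ k (fun i => x i + u i)
    else x k + u k

variable {V x}

theorem cellPoint_of_eq_empty {i₀ : Fin d} (hi₀ : (covector V x i₀).Nonempty) (u : Fin d → ℝ)
    (s : FreeCoord V x → ℝ) {k : Fin d} (hk : covector V x k = ∅) :
    cellPoint V x hi₀ u s k = s ⟨k, hk⟩ + leastCoord V x hi₀ k (fun i => x i + u i) :=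
  dif_pos hk

theorem cellPoint_of_ne_empty {i₀ : Fin d} (hi₀ : (covector V x i₀).Nonempty) (u : Fin d → ℝ)
    (s : FreeCoord V x → ℝ) {k : Fin d} (hk : covector V x k ≠ ∅) :
    cellPoint V x hi₀ u s k = x k + u k :=
  dif_neg hk

theorem leastCoord_cellPoint {i₀ : Fin d} (hi₀ : (covector V x i₀).Nonempty) (u : Fin d → ℝ)
    (s : FreeCoord V x → ℝ) (k : Fin d) :
    leastCoord V x hi₀ k (cellPoint V x hi₀ u s) = leastCoord V x hi₀ k fun i => x i + u i :=
  leastCoord_congr hi₀ k fun _ hi => cellPoint_of_ne_empty hi₀ u s hi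

theorem continuous_cellPoint {i₀ : Fin d} (hi₀ : (covector V x i₀).Nonempty) :
    Continuous fun q : (Fin d → ℝ) × (FreeCoord V x → ℝ) => cellPoint V x hi₀ q.1 q.2 := by
  refine continuous_pi fun k => ?_
  by_cases hk : covector V x k = ∅
  · simp only [cellPoint_of_eq_empty hi₀ _ _ hk]
    have := continuous_leastCoord V x hi₀ k
    fun_prop
  · simp only [cellPoint_of_ne_empty hi₀ _ _ hk]
    fun_prop

theorem ne_empty_of_mem {i : Fin d} {j : Fin n} (h : j ∈ covector V x i) : covector V x i ≠ ∅ :=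
  Set.nonempty_iff_ne_empty.1 ⟨j, h⟩

theorem cellPoint_mem {i₀ : Fin d} (hi₀ : (covector V x i₀).Nonempty)
    {u : boundedDirections V x i₀} (hu : u ∈ boundedPart V x i₀) {s : FreeCoord V x → ℝ}
    (hs : ∀ k, 0 ≤ s k) :
    (Submodule.Quotient.mk (cellPoint V x hi₀ u s) : TropicalTorus d) ∈
      covectorCell V (covector V x) := by
  rw [mk_mem_covectorCell]
  intro i j hj k
  rw [cellPoint_of_ne_empty hi₀ _ _ (ne_empty_of_mem hj)]
  by_cases hk : covector V x k = ∅
  · rw [cellPoint_of_eq_empty hi₀ _ _ hk]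
    have h1 := le_leastCoord hi₀ k (fun i => x i + u.1 i) hj
    have h2 := hs ⟨k, hk⟩
    linarith
  · rw [cellPoint_of_ne_empty hi₀ _ _ hk]
    exact sub_le_of_mem_boundedPart V x hu hj (Set.nonempty_iff_ne_empty.2 hk)

/-- A new index enters the covector in one of two ways: a strict inequality between bounded
coordinates becomes tight, or an unbounded coordinate reaches its least value. -/
theorem covector_cellPoint_ne_iff [Nonempty (Fin d)] {i₀ : Fin d}
    (hi₀ : (covector V x i₀).Nonempty)
    {u : boundedDirections V x i₀} (hu : u ∈ boundedPart V x i₀) {s : FreeCoord V x → ℝ}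
    (hs : ∀ k, 0 ≤ s k) :
    covector V (cellPoint V x hi₀ u s) ≠ covector V x ↔
      u ∉ interior (boundedPart V x i₀) ∨ ∃ k, s k = 0 := by
  have hmem := mk_mem_covectorCell.1 (cellPoint_mem hi₀ hu hs)
  rw [interior_boundedPart]
  constructor
  · intro hne
    obtain ⟨k, j, hjk, hjk'⟩ : ∃ k, ∃ j, j ∈ covector V (cellPoint V x hi₀ u s) k ∧
        j ∉ covector V x k := by
      by_contra! hcon
      exact hne (funext fun k => Set.Subset.antisymm (fun j hj => hcon k j hj)
        (fun j hj => hmem k j hj))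
    obtain ⟨i, hi⟩ := exists_mem_covector V x j
    have heq := le_antisymm (hmem i j hi k) (hjk i)
    rw [cellPoint_of_ne_empty hi₀ _ _ (ne_empty_of_mem hi)] at heq
    by_cases hk : covector V x k = ∅
    · right
      refine ⟨⟨k, hk⟩, le_antisymm ?_ (hs _)⟩
      rw [cellPoint_of_eq_empty hi₀ _ _ hk] at heq
      have h1 := le_leastCoord hi₀ k (fun i => x i + u.1 i) hi
      linarith
    · left
      intro hlt
      have := hlt ⟨(i, j, k), hi, Set.nonempty_iff_ne_empty.2 hk, hjk'⟩
      rw [cellPoint_of_ne_empty hi₀ _ _ hk] at heq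
      rw [strictForm_apply, strictConst] at this
      simp only at this
      linarith
  · rintro (h | ⟨⟨k, hk⟩, hsk⟩) heq
    · refine h fun t => lt_of_le_of_ne (hu t) fun h0 => t.2.2.2 ?_
      rw [strictForm_apply, strictConst] at h0
      have h1 := cellPoint_of_ne_empty hi₀ u.1 s (ne_empty_of_mem t.2.1)
      have h2 := cellPoint_of_ne_empty hi₀ u.1 s (Set.nonempty_iff_ne_empty.1 t.2.2.1)
      refine (congrFun heq t.1.2.2).subset (show t.1.2.1 ∈ _ from fun l => ?_)
      have h3 := hmem t.1.1 t.1.2.1 t.2.1 l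
      linarith
    · obtain ⟨i, j, hij, hl⟩ := exists_eq_leastCoord hi₀ k fun i => x i + u.1 i
      have h1 := cellPoint_of_eq_empty hi₀ u.1 s hk
      rw [hsk, zero_add, hl] at h1
      have h2 := cellPoint_of_ne_empty hi₀ u.1 s (ne_empty_of_mem hij)
      have : j ∈ covector V x k := by
        refine (congrFun heq k).subset (show j ∈ _ from fun l => ?_)
        have h3 := hmem i j hij l
        linarith
      rw [hk] at this
      exact this

theorem sub_mem_boundedDirections {i₀ : Fin d}
    {y : Fin d → ℝ} (hy : ∀ i, ∀ j ∈ covector V x i, ∀ k, y i - V i j ≤ y k - V k j)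
    (hyi : y i₀ = x i₀) [DecidablePred fun k => covector V x k = ∅] :
    (fun k => if covector V x k = ∅ then 0 else y k - x k) ∈ boundedDirections V x i₀ := by
  refine ⟨fun j i k hi hk => ?_, ?_, fun k hk => if_pos hk⟩
  · simp only [if_neg (ne_empty_of_mem hi), if_neg (ne_empty_of_mem hk)]
    have h1 := le_antisymm (hy i j hi k) (hy k j hk i)
    have h2 := sub_eq_sub_of_mem_covector hi hk
    linarith
  · simp [hyi]

/-- The cell of `x` is the product of its bounded part and an orthant. -/
theorem exists_cell_homeomorph {i₀ : Fin d} (hi₀ : (covector V x i₀).Nonempty) :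
    ∃ g : {q : boundedDirections V x i₀ × (FreeCoord V x → ℝ) //
        q.1 ∈ boundedPart V x i₀ ∧ ∀ k, 0 ≤ q.2 k} ≃ₜ covectorCell V (covector V x),
      ∀ q, (g q : TropicalTorus d) = Submodule.Quotient.mk (cellPoint V x hi₀ q.1.1 q.1.2) := by
  classical
  let Y : TropicalTorus d → Fin d → ℝ := fun p k => TropicalTorus.normalize i₀ p k + x i₀
  have hY : ∀ p, (Submodule.Quotient.mk (Y p) : TropicalTorus d) = p := fun p => by
    rw [TropicalTorus.mk_add_const, TropicalTorus.mk_normalize]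
  have hYc : Continuous Y := continuous_pi fun k =>
    ((continuous_apply k).comp (TropicalTorus.continuous_normalize i₀)).add continuous_const
  have hYi : ∀ p, Y p i₀ = x i₀ := fun p => by
    obtain ⟨y, rfl⟩ := Submodule.Quotient.mk_surjective _ p
    simp [Y, TropicalTorus.normalize_mk]
  have hYmem : ∀ p ∈ covectorCell V (covector V x), ∀ i, ∀ j ∈ covector V x i, ∀ k,
      Y p i - V i j ≤ Y p k - V k j := fun p hp => by
    rw [← mk_mem_covectorCell, hY]
    exact hp
  have hY' : ∀ (u : boundedDirections V x i₀) (s : FreeCoord V x → ℝ),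
      Y (Submodule.Quotient.mk (cellPoint V x hi₀ u s)) = cellPoint V x hi₀ u s := fun u s => by
    ext k
    simp only [Y, TropicalTorus.normalize_mk]
    rw [cellPoint_of_ne_empty hi₀ _ _ (Set.nonempty_iff_ne_empty.1 hi₀), u.2.2.1]
    ring
  let A : covectorCell V (covector V x) → boundedDirections V x i₀ := fun p =>
    ⟨_, sub_mem_boundedDirections (hYmem p p.2) (hYi p)⟩
  have hA : ∀ p k, (A p).1 k = if covector V x k = ∅ then 0 else Y p k - x k := fun p k => rfl
  let B : covectorCell V (covector V x) → FreeCoord V x → ℝ := fun p k =>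
    Y p k - leastCoord V x hi₀ k (Y p)
  have hleast : ∀ p k, leastCoord V x hi₀ k (fun i => x i + (A p).1 i) =
      leastCoord V x hi₀ k (Y p) := fun p k => leastCoord_congr hi₀ k fun i hi => by
    rw [hA, if_neg hi]
    ring
  have hAB : ∀ p : covectorCell V (covector V x), cellPoint V x hi₀ (A p) (B p) = Y p :=
      fun p => by
    ext k
    by_cases hk : covector V x k = ∅
    · rw [cellPoint_of_eq_empty hi₀ _ _ hk, hleast]
      simp [B]
    · rw [cellPoint_of_ne_empty hi₀ _ _ hk, hA, if_neg hk]
      ring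
  refine ⟨{ toFun := fun q => ⟨_, cellPoint_mem hi₀ q.2.1 q.2.2⟩
            invFun := fun p => ⟨(A p, B p), fun t => ?_, fun k => ?_⟩
            left_inv := fun q => Subtype.ext (Prod.ext (Subtype.ext (funext fun k => ?_))
              (funext fun k => ?_))
            right_inv := fun p => Subtype.ext ?_
            continuous_toFun := ?_
            continuous_invFun := ?_ }, fun q => rfl⟩
  · have h1 := hYmem p p.2 t.1.1 t.1.2.1 t.2.1 t.1.2.2
    rw [strictForm_apply, strictConst, hA, hA, if_neg (ne_empty_of_mem t.2.1),
      if_neg (Set.nonempty_iff_ne_empty.1 t.2.2.1)]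
    linarith
  · obtain ⟨i, j, hij, hl⟩ := exists_eq_leastCoord hi₀ k (Y p)
    have h1 := hYmem p p.2 i j hij k
    simp only [B]
    linarith
  · rw [hA]
    simp only [hY']
    split_ifs with hk
    · exact (q.1.1.2.2.2 k hk).symm
    · rw [cellPoint_of_ne_empty hi₀ _ _ hk]
      ring
  · simp only [B, hY', leastCoord_cellPoint]
    rw [cellPoint_of_eq_empty hi₀ _ _ k.2]
    ring
  · simp only [hAB, hY]
  · refine Continuous.subtype_mk (TropicalTorus.continuous_mk.comp
      ((continuous_cellPoint hi₀).comp (f := fun q : {q : boundedDirections V x i₀ ×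
        (FreeCoord V x → ℝ) // q.1 ∈ boundedPart V x i₀ ∧ ∀ k, 0 ≤ q.2 k} =>
          ((q.1.1 : Fin d → ℝ), q.1.2)) ?_)) _
    fun_prop
  · have hYc' : Continuous fun p : covectorCell V (covector V x) => Y p :=
      hYc.comp continuous_subtype_val
    refine Continuous.subtype_mk (Continuous.prodMk (Continuous.subtype_mk
      (continuous_pi fun k => ?_) _) (continuous_pi fun k => ?_)) _
    · by_cases hk : covector V x k = ∅
      · simp only [if_pos hk]
        exact continuous_const
      · simp only [if_neg hk]
        exact ((continuous_apply k).comp hYc').sub continuous_const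
    · exact ((continuous_apply _).comp hYc').sub ((continuous_leastCoord V x hi₀ k).comp hYc')

/-- The closure of the cell of `x` in the one-point compactification is a closed ball whose
boundary consists of the points with a larger covector, and infinity if the cell is unbounded. -/
theorem exists_ball_homeomorph_covectorCell [Nonempty (Fin d)] {i₀ : Fin d}
    (hi₀ : (covector V x i₀).Nonempty) {r : ℕ}
    (hr : Module.finrank ℝ (boundedDirections V x i₀) + Nat.card (FreeCoord V x) = r) :
    ∃ φ : Metric.closedBall (0 : EuclideanSpace ℝ (Fin r)) 1 ≃ₜ
        compactifiedCell (covectorCell V (covector V x)),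
      (fun y => (φ y : OnePoint (TropicalTorus d))) ''
          {y | ‖(y : EuclideanSpace ℝ (Fin r))‖ = 1} =
        {q | q = OnePoint.infty ∧ ∃ k, covector V x k = ∅} ∪
        (OnePoint.some : TropicalTorus d → OnePoint (TropicalTorus d)) ''
          {p | p ∈ covectorCell V (covector V x) ∧
            TropicalTorus.covector V p ≠ covector V x} := by
  classical
  have := TropicalTorus.t2Space i₀
  have := TropicalTorus.locallyCompactSpace i₀
  obtain ⟨g, hg⟩ := exists_cell_homeomorph hi₀
  have hclosed := isClosed_covectorCell V i₀ (covector V x)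
  have hne := fun q : {q : boundedDirections V x i₀ × (FreeCoord V x → ℝ) //
        q.1 ∈ boundedPart V x i₀ ∧ ∀ k, 0 ≤ q.2 k} =>
    covector_cellPoint_ne_iff hi₀ q.2.1 q.2.2
  have hconv : Convex ℝ (boundedPart V x i₀) := convex_setOf_forall_add_nonpos _ _
  have hcl : IsClosed (boundedPart V x i₀) := isClosed_setOf_forall_add_nonpos _ _
  have h0 := zero_mem_interior_boundedPart V x i₀
  rw [Nat.card_eq_fintype_card] at hr
  rcases isEmpty_or_nonempty (FreeCoord V x) with hJ | hJ
  · let e : boundedPart V x i₀ ≃ₜ {q : boundedDirections V x i₀ × (FreeCoord V x → ℝ) //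
        q.1 ∈ boundedPart V x i₀ ∧ ∀ k, 0 ≤ q.2 k} :=
      { toFun := fun u => ⟨(u, 0), u.2, fun k => le_rfl⟩
        invFun := fun q => ⟨q.1.1, q.2.1⟩
        left_inv := fun u => rfl
        right_inv := fun q => Subtype.ext (Prod.ext rfl (Subsingleton.elim _ _))
        continuous_toFun := by fun_prop
        continuous_invFun := by fun_prop }
    rw [Fintype.card_eq_zero, add_zero] at hr
    obtain ⟨φ, hφ⟩ := exists_ball_homeomorph_of_convexBody hr hconv hcl
      (isBounded_boundedPart V x hi₀) ⟨0, h0⟩ (e.trans g)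
    refine ⟨φ, hφ.trans ?_⟩
    have hemp : {q : OnePoint (TropicalTorus d) |
        q = OnePoint.infty ∧ ∃ k, covector V x k = ∅} = ∅ := by
      ext q
      simp only [Set.mem_ofPred_eq, Set.mem_empty_iff_false, iff_false]
      rintro ⟨-, k, hk⟩
      exact hJ.elim ⟨k, hk⟩
    rw [hemp, Set.empty_union]
    congr 1
    ext p
    constructor
    · rintro ⟨q, hq, rfl⟩
      refine ⟨(g (e q)).2, ?_⟩
      rw [Homeomorph.trans_apply, hg, TropicalTorus.covector_mk, hne]
      exact Or.inl hq
    · rintro ⟨hp, hpne⟩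
      refine ⟨e.symm (g.symm ⟨p, hp⟩), ?_, by simp⟩
      have h1 := hg (g.symm ⟨p, hp⟩)
      rw [Homeomorph.apply_symm_apply] at h1
      simp only at h1
      rw [h1, TropicalTorus.covector_mk, hne] at hpne
      exact hpne.resolve_right fun ⟨k, _⟩ => hJ.elim k
  · obtain ⟨k₀⟩ := id hJ
    let H := prodOrthantHomeomorph hconv hcl (mem_interior_iff_mem_nhds.1 h0) k₀
    let ℓ : boundedDirections V x i₀ × (FreeCoord V x → ℝ) →L[ℝ] ℝ :=
      (ContinuousLinearMap.proj k₀).comp (ContinuousLinearMap.snd ℝ _ _)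
    have hℓ : ℓ ≠ 0 := fun h => by
      have := congrArg (fun f => f (0, 1)) h
      simp [ℓ] at this
    let g' : {q : boundedDirections V x i₀ × (FreeCoord V x → ℝ) // 0 ≤ ℓ q} ≃ₜ
      covectorCell V (covector V x) := H.symm.trans g
    obtain ⟨φ, hφ⟩ := exists_ball_homeomorph_of_halfSpace (r := r) (by
      rw [Module.finrank_prod, Module.finrank_fintype_fun_eq_card, hr]) hℓ hclosed g'
    refine ⟨φ, hφ.trans ?_⟩
    have hsing : {q : OnePoint (TropicalTorus d) | q = OnePoint.infty ∧ ∃ k, covector V x k = ∅} =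
        {OnePoint.infty} := by
      ext q
      exact ⟨fun h => h.1, fun h => ⟨h, k₀, k₀.2⟩⟩
    rw [hsing, Set.insert_eq]
    congr 2
    ext p
    constructor
    · rintro ⟨q, hq, rfl⟩
      refine ⟨(g (H.symm q)).2, ?_⟩
      change TropicalTorus.covector V (g (H.symm q) : TropicalTorus d) ≠ _
      rw [hg, TropicalTorus.covector_mk, hne,
        ← prodOrthantHomeomorph_eq_zero_iff hconv hcl (mem_interior_iff_mem_nhds.1 h0) k₀]
      change (H (H.symm q)).1.2 k₀ = 0
      exact (congrArg (fun q => q.1.2 k₀) (H.apply_symm_apply q)).trans hq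
    · rintro ⟨hp, hpne⟩
      refine ⟨H (g.symm ⟨p, hp⟩), ?_, ?_⟩
      swap
      · change (g (H.symm (H (g.symm ⟨p, hp⟩))) : TropicalTorus d) = p
        rw [H.symm_apply_apply, g.apply_symm_apply]
      have h1 := hg (g.symm ⟨p, hp⟩)
      rw [Homeomorph.apply_symm_apply] at h1
      simp only at h1
      rw [h1, TropicalTorus.covector_mk, hne, ← prodOrthantHomeomorph_eq_zero_iff hconv hcl
        (mem_interior_iff_mem_nhds.1 h0) k₀] at hpne
      exact hpne

end Cell

/-! ### Generic functionals -/

namespace HomogenizedSystem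

section Generic

variable {V I : Type*} [AddCommGroup V] [Module ℝ V] [FiniteDimensional ℝ V] [Finite I]

theorem exists_ne_zero_of_three_le_finrank {W : Submodule ℝ V} (hW : 3 ≤ Module.finrank ℝ W)
    (f g : V →ₗ[ℝ] ℝ) : ∃ v ∈ W, f v = 0 ∧ g v = 0 ∧ v ≠ 0 := by
  have key : ∀ (U : Submodule ℝ V) (f : V →ₗ[ℝ] ℝ),
      Module.finrank ℝ U ≤ Module.finrank ℝ ↥(U ⊓ LinearMap.ker f) + 1 := fun U f => by
    by_cases h : ∃ x ∈ U, f x ≠ 0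
    · obtain ⟨x, hx, hfx⟩ := h
      exact (finrank_inf_ker_add_one U f hx hfx).ge
    · push Not at h
      rw [inf_eq_left.2 fun x hx => LinearMap.mem_ker.2 (h x hx)]
      exact Nat.le_succ _
  have h1 := key W f
  have h2 := key (W ⊓ LinearMap.ker f) g
  have h3 : 0 < Module.finrank ℝ ↥(W ⊓ LinearMap.ker f ⊓ LinearMap.ker g) := by omega
  obtain ⟨⟨v, ⟨hv, hf⟩, hg⟩, hne⟩ := Module.finrank_pos_iff_exists_ne_zero.1 h3
  exact ⟨v, hv, hf, hg, fun h => hne (Subtype.ext h)⟩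

/-- Functionals become generic under a suitable small perturbation. -/
theorem exists_eventually_isGeneric (P : HomogenizedSystem V I) (h : V →ₗ[ℝ] ℝ) :
    ∃ h' : V →ₗ[ℝ] ℝ, ∀ᶠ ε in 𝓝[>] (0 : ℝ), P.IsGeneric (h + ε • h') := by
  -- The span of a face depends only on its tight set, so genericity reduces to finitely many
  -- conditions, one nonzero vector for each.
  let ι := {q : Set I × I × I // ∃ x, P.tight x = q.1 ∧ 3 ≤ Module.finrank ℝ (P.faceSpan x)}
  have hex : ∀ q : ι, ∃ v : V, v ≠ 0 ∧ P.a q.1.2.1 v = 0 ∧ P.a q.1.2.2 v = 0 ∧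
      ∀ x, P.tight x = q.1.1 → v ∈ P.faceSpan x := fun q => by
    obtain ⟨x, hx, hdim⟩ := q.2
    obtain ⟨v, hv, h1, h2, h3⟩ :=
      exists_ne_zero_of_three_le_finrank hdim (P.a q.1.2.1) (P.a q.1.2.2)
    exact ⟨v, h3, h1, h2, fun x' hx' => faceSpan_congr (hx'.trans hx.symm) ▸ hv⟩
  choose v hv0 hv1 hv2 hv3 using hex
  obtain ⟨h', hh'⟩ := Module.exists_dual_forall_apply_ne_zero (K := ℝ) v hv0
  refine ⟨h', ?_⟩
  have hev : ∀ᶠ ε in 𝓝[>] (0 : ℝ), ∀ q, h (v q) + ε * h' (v q) ≠ 0 :=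
    eventually_all.2 fun q => eventually_add_mul_ne _ (hh' q)
  filter_upwards [hev] with ε hε x _ hdim t s
  let q : ι := ⟨(P.tight x, t, s), x, rfl, hdim⟩
  exact ⟨v q, hv3 q x rfl, hv1 q, hv2 q, by simpa using hε q⟩

end Generic

end HomogenizedSystem

/-! ### The polyhedron over the covector decomposition -/

/-- The homogenized system of the polyhedron of all `y` such that
`∑ j, min k, (y k - V k j)` is nonnegative. -/
noncomputable def tropicalSystem {d n : ℕ} (V : Matrix (Fin d) (Fin n) ℝ) :
    HomogenizedSystem ((Fin d → ℝ) × ℝ) (Fin n → Fin d) where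
  z := LinearMap.snd ℝ _ _
  a κ := ∑ j, (V (κ j) j • LinearMap.snd ℝ _ _ -
    (LinearMap.proj (R := ℝ) (φ := fun _ : Fin d => ℝ) (κ j)).comp (LinearMap.fst ℝ _ _))

namespace tropicalSystem

open HomogenizedSystem

variable {d n : ℕ} {V : Matrix (Fin d) (Fin n) ℝ}

theorem z_apply (v : (Fin d → ℝ) × ℝ) : (tropicalSystem V).z v = v.2 := rfl

theorem a_apply (κ : Fin n → Fin d) (v : (Fin d → ℝ) × ℝ) :
    (tropicalSystem V).a κ v = ∑ j, (V (κ j) j * v.2 - v.1 (κ j)) := by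
  simp [tropicalSystem]

theorem a_update (κ : Fin n → Fin d) (j : Fin n) (i : Fin d) (v : (Fin d → ℝ) × ℝ) :
    (tropicalSystem V).a (Function.update κ j i) v + (V (κ j) j * v.2 - v.1 (κ j)) =
      (tropicalSystem V).a κ v + (V i j * v.2 - v.1 i) := by
  rw [a_apply, a_apply, ← Finset.add_sum_erase _ _ (Finset.mem_univ j),
    ← Finset.add_sum_erase Finset.univ (fun j => V (κ j) j * v.2 - v.1 (κ j)) (Finset.mem_univ j),
    Function.update_self, Finset.sum_congr rfl fun l hl => ?_]
  · ring
  · rw [Function.update_of_ne (Finset.ne_of_mem_erase hl)]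

theorem a_const (k : Fin d) (v : (Fin d → ℝ) × ℝ) :
    (tropicalSystem V).a (fun _ => k) v = (∑ j, V k j) * v.2 - n * v.1 k := by
  simp [a_apply, Finset.sum_mul]

/-- The point of `ℝᵈ` with the homogeneous coordinates `v`. -/
noncomputable def point (v : (Fin d → ℝ) × ℝ) : Fin d → ℝ := v.2⁻¹ • v.1

theorem mem_covector_point {v : (Fin d → ℝ) × ℝ} (hv : (tropicalSystem V).IsPt v) {i : Fin d}
    {j : Fin n} : j ∈ covector V (point v) i ↔ ∀ k, V k j * v.2 - v.1 k ≤ V i j * v.2 - v.1 i := by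
  have hz : 0 < v.2 := hv.1
  refine forall_congr' fun k => ?_
  have h : ∀ l, point v l = v.2⁻¹ * v.1 l := fun l => rfl
  rw [h, h, ← mul_le_mul_iff_right₀ hz]
  field_simp
  constructor <;> intro h <;> linarith

/-- If `κ` is tight, changing its value at one `j` cannot make the functional positive, so `κ j`
already attains the minimum. Conversely, such a `κ` maximizes every summand, so its value is at
least that of a tight functional, which is zero. -/
theorem mem_tight_iff {v : (Fin d → ℝ) × ℝ} (hv : (tropicalSystem V).IsPt v)
    (ht : ((tropicalSystem V).tight v).Nonempty) {κ : Fin n → Fin d} :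
    κ ∈ (tropicalSystem V).tight v ↔ ∀ j, j ∈ covector V (point v) (κ j) := by
  simp only [mem_covector_point hv]
  constructor
  · intro h j k
    have h1 := a_update (V := V) κ j k v
    rw [mem_tight.1 h] at h1
    have h2 := hv.2 (Function.update κ j k)
    linarith
  · intro h
    obtain ⟨κ', hκ'⟩ := ht
    refine le_antisymm (hv.2 κ) ?_
    rw [← mem_tight.1 hκ', a_apply, a_apply]
    exact Finset.sum_le_sum fun j _ => h j _

theorem update_mem_tight {v : (Fin d → ℝ) × ℝ} (hv : (tropicalSystem V).IsPt v)
    {κ : Fin n → Fin d} (hκ : κ ∈ (tropicalSystem V).tight v) {i : Fin d} {j : Fin n}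
    (hj : j ∈ covector V (point v) i) : Function.update κ j i ∈ (tropicalSystem V).tight v := by
  have h := mem_tight_iff hv ⟨κ, hκ⟩ (κ := κ)
  rw [mem_tight_iff hv ⟨κ, hκ⟩]
  intro l
  by_cases hl : l = j
  · subst hl
    rwa [Function.update_self]
  · rw [Function.update_of_ne hl]
    exact h.1 hκ l

theorem mem_covector_point_iff {v : (Fin d → ℝ) × ℝ} (hv : (tropicalSystem V).IsPt v)
    (ht : ((tropicalSystem V).tight v).Nonempty) {i : Fin d} {j : Fin n} :
    j ∈ covector V (point v) i ↔ ∃ κ ∈ (tropicalSystem V).tight v, κ j = i := by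
  constructor
  · intro hj
    obtain ⟨κ, hκ⟩ := ht
    exact ⟨_, update_mem_tight hv hκ hj, Function.update_self ..⟩
  · rintro ⟨κ, hκ, rfl⟩
    exact (mem_tight_iff hv ht).1 hκ j

theorem tight_subset_iff {v v' : (Fin d → ℝ) × ℝ} (hv : (tropicalSystem V).IsPt v)
    (ht : ((tropicalSystem V).tight v).Nonempty) (hv' : (tropicalSystem V).IsPt v')
    (ht' : ((tropicalSystem V).tight v').Nonempty) :
    (tropicalSystem V).tight v' ⊆ (tropicalSystem V).tight v ↔
      ∀ i, covector V (point v') i ⊆ covector V (point v) i := by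
  constructor
  · intro h i j hj
    rw [mem_covector_point_iff hv' ht'] at hj
    obtain ⟨κ, hκ, hi⟩ := hj
    exact (mem_covector_point_iff hv ht).2 ⟨κ, h hκ, hi⟩
  · intro h κ hκ
    rw [mem_tight_iff hv' ht'] at hκ
    exact (mem_tight_iff hv ht).2 fun j => h _ (hκ j)

theorem tight_eq_iff {v v' : (Fin d → ℝ) × ℝ} (hv : (tropicalSystem V).IsPt v)
    (ht : ((tropicalSystem V).tight v).Nonempty) (hv' : (tropicalSystem V).IsPt v')
    (ht' : ((tropicalSystem V).tight v').Nonempty) :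
    (tropicalSystem V).tight v' = (tropicalSystem V).tight v ↔
      covector V (point v') = covector V (point v) := by
  rw [Set.Subset.antisymm_iff, tight_subset_iff hv ht hv' ht', tight_subset_iff hv' ht' hv ht]
  exact ⟨fun h => funext fun i => (h.1 i).antisymm (h.2 i),
    fun h => ⟨fun i => (congrFun h i).le, fun i => (congrFun h i).ge⟩⟩

theorem exists_point_covector_eq [Nonempty (Fin d)] [Nonempty (Fin n)] (x : Fin d → ℝ) :
    ∃ v, (tropicalSystem V).IsPt v ∧ ((tropicalSystem V).tight v).Nonempty ∧
      covector V (point v) = covector V x := by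
  have hn : (n : ℝ) ≠ 0 := by
    simpa using Fin.pos_iff_nonempty.2 ‹Nonempty (Fin n)› |>.ne'
  choose κ hκ using exists_mem_covector V x
  -- The shift along the diagonal that makes the sum of the minima zero, that is, puts the point on
  -- the boundary of the polyhedron.
  set r : ℝ := -(∑ j, (x (κ j) - V (κ j) j)) / n with hr
  have hnr : n * r = -(∑ j, (x (κ j) - V (κ j) j)) := by
    rw [hr]
    field_simp
  have ha : ∀ τ : Fin n → Fin d, (tropicalSystem V).a τ (fun k => x k + r, 1) =
      ∑ j, (x (κ j) - V (κ j) j) - ∑ j, (x (τ j) - V (τ j) j) := fun τ => by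
    have : (tropicalSystem V).a τ (fun k => x k + r, 1) =
        -∑ j, (x (τ j) - V (τ j) j) - n * r := by
      rw [a_apply, ← Finset.sum_neg_distrib]
      have : (n : ℝ) * r = ∑ _j : Fin n, r := by simp
      rw [this, ← Finset.sum_sub_distrib]
      exact Finset.sum_congr rfl fun j _ => by ring
    rw [this, hnr]
    ring
  refine ⟨(fun k => x k + r, 1), ⟨one_pos, fun τ => ?_⟩, ⟨κ, ?_⟩, ?_⟩
  · rw [ha, sub_nonpos]
    exact Finset.sum_le_sum fun j _ => hκ j (τ j)
  · rw [mem_tight, ha, sub_self]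
  · refine covector_eq_of_mk_eq V _ _ ?_
    rw [← TropicalTorus.mk_add_const x r]
    simp [point]

/-- The constant map `κ = k` gives the inequality `-n * u k ≤ 0`; hence recession directions lie in
the positive orthant. -/
theorem nonneg_of_recession {u : (Fin d → ℝ) × ℝ} [Nonempty (Fin n)] (hz : u.2 = 0)
    (hu : ∀ κ, (tropicalSystem V).a κ u ≤ 0) (k : Fin d) : 0 ≤ u.1 k := by
  have h := hu fun _ => k
  rw [a_const, hz, mul_zero, zero_sub, neg_nonpos] at h
  have hn : (0 : ℝ) < n := by
    exact_mod_cast Fin.pos_iff_nonempty.2 ‹Nonempty (Fin n)›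
  exact (mul_nonneg_iff_of_pos_left hn).1 h

theorem a_single (κ : Fin n → Fin d) (k : Fin d) :
    (tropicalSystem V).a κ (Pi.single k 1, 0) = -∑ j, if κ j = k then 1 else 0 := by
  rw [a_apply, ← Finset.sum_neg_distrib]
  exact Finset.sum_congr rfl fun j _ => by simp [Pi.single_apply]

/-- A coordinate that occurs in no tight functional can be increased without limit. -/
theorem unbdd_of_forall {v : (Fin d → ℝ) × ℝ} {k : Fin d}
    (h : ∀ κ ∈ (tropicalSystem V).tight v, ∀ j, κ j ≠ k) : (tropicalSystem V).Unbdd v := by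
  refine ⟨(Pi.single k 1, 0), mem_faceSpan.2 fun κ hκ => ?_, fun h0 => ?_, rfl, fun κ => ?_⟩
  · rw [a_single, neg_eq_zero]
    exact Finset.sum_eq_zero fun j _ => if_neg (h κ hκ j)
  · have := congrFun (congrArg Prod.fst h0) k
    simp at this
  · rw [a_single, neg_nonpos]
    exact Finset.sum_nonneg fun j _ => by split_ifs <;> simp

theorem unbdd_iff [Nonempty (Fin n)] {v : (Fin d → ℝ) × ℝ} (hv : (tropicalSystem V).IsPt v)
    (ht : ((tropicalSystem V).tight v).Nonempty) :
    (tropicalSystem V).Unbdd v ↔ ∃ k, covector V (point v) k = ∅ := by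
  constructor
  · rintro ⟨u, hu, hne, hz, hrec⟩
    rw [z_apply] at hz
    by_contra! hG
    refine hne (Prod.ext (funext fun k => ?_) hz)
    obtain ⟨j, hj⟩ := hG k
    obtain ⟨κ, hκ, rfl⟩ := (mem_covector_point_iff hv ht).1 hj
    have h := mem_faceSpan.1 hu κ hκ
    rw [a_apply, hz] at h
    simp only [mul_zero, zero_sub, Finset.sum_neg_distrib, neg_eq_zero] at h
    exact (Finset.sum_eq_zero_iff_of_nonneg fun j _ => nonneg_of_recession hz hrec _).1 h j
      (Finset.mem_univ j)
  · rintro ⟨k, hk⟩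
    refine unbdd_of_forall (k := k) fun κ hκ j hj => ?_
    have := (mem_covector_point_iff hv ht).2 ⟨κ, hκ, hj⟩
    rw [hk] at this
    exact this

theorem pointed [Nonempty (Fin n)] : (tropicalSystem V).Pointed := fun u hz hu => by
  rw [z_apply] at hz
  refine Prod.ext (funext fun k => le_antisymm ?_ ?_) hz
  · have := nonneg_of_recession (V := V) (u := -u) (by simp [hz]) (fun κ => by simp [hu κ]) k
    simpa using this
  · exact nonneg_of_recession hz (fun κ => (hu κ).le) k

/-- The span of the face of `v` describes the directions of the cell of the point of `v`. -/
theorem finrank_faceSpan {v : (Fin d → ℝ) × ℝ} (hv : (tropicalSystem V).IsPt v)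
    (ht : ((tropicalSystem V).tight v).Nonempty) {i₀ : Fin d}
    (hi₀ : (covector V (point v) i₀).Nonempty) :
    Module.finrank ℝ ((tropicalSystem V).faceSpan v) =
      Module.finrank ℝ (boundedDirections V (point v) i₀) +
        Nat.card (FreeCoord V (point v)) + 1 := by
  classical
  obtain ⟨κ₀, hκ₀⟩ := id ht
  have hz : v.2 ≠ 0 := hv.1.ne'
  have hn : (n : ℝ) ≠ 0 := by
    obtain ⟨j, -⟩ := hi₀
    exact_mod_cast (Fin.pos j).ne'
  have hadj : ∀ w ∈ (tropicalSystem V).faceSpan v, ∀ j i k, j ∈ covector V (point v) i →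
      j ∈ covector V (point v) k → V i j * w.2 - w.1 i = V k j * w.2 - w.1 k := by
    intro w hw j i k hi hk
    have h1 := mem_faceSpan.1 hw _ (update_mem_tight hv hκ₀ hi)
    have h2 := mem_faceSpan.1 hw _ (update_mem_tight hv hκ₀ hk)
    have h3 := a_update (V := V) κ₀ j i w
    have h4 := a_update (V := V) κ₀ j k w
    linarith
  have hmem : ∀ u : Fin d → ℝ, (∀ j i k, j ∈ covector V (point v) i →
      j ∈ covector V (point v) k → u i = u k) → ∑ j, u (κ₀ j) = 0 →
      (u, 0) ∈ (tropicalSystem V).faceSpan v := by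
    intro u hu h0
    refine mem_faceSpan.2 fun κ hκ => ?_
    rw [a_apply]
    simp only [mul_zero, zero_sub, Finset.sum_neg_distrib, neg_eq_zero]
    rw [← h0]
    exact Finset.sum_congr rfl fun j _ => hu j _ _ ((mem_tight_iff hv ht).1 hκ j)
      ((mem_tight_iff hv ht).1 hκ₀ j)
  -- Subtracting the multiple of `v` with the same homogenizing coordinate leaves a pure
  -- displacement.
  let D : (tropicalSystem V).faceSpan v → Fin d → ℝ := fun w k => w.1.1 k - w.1.2 / v.2 * v.1 k
  have hD : ∀ w j i k, j ∈ covector V (point v) i → j ∈ covector V (point v) k →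
      D w i = D w k := fun w j i k hi hk => by
    have h1 := hadj w w.2 j i k hi hk
    have h2 := hadj v (self_mem_faceSpan v) j i k hi hk
    have h3 : w.1.2 = w.1.2 / v.2 * v.2 := by field_simp
    simp only [D]
    linear_combination w.1.2 / v.2 * h2 - h1 + (V i j - V k j) * h3
  have hD0 : ∀ w, ∑ j, D w (κ₀ j) = 0 := fun w => by
    have h1 := mem_faceSpan.1 w.2 κ₀ hκ₀
    have h2 := mem_tight.1 hκ₀
    rw [a_apply] at h1 h2
    have h3 : w.1.2 = w.1.2 / v.2 * v.2 := by field_simp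
    have : ∑ j, D w (κ₀ j) = -∑ j, (V (κ₀ j) j * w.1.2 - w.1.1 (κ₀ j)) +
        w.1.2 / v.2 * ∑ j, (V (κ₀ j) j * v.2 - v.1 (κ₀ j)) := by
      rw [Finset.mul_sum, ← Finset.sum_neg_distrib, ← Finset.sum_add_distrib]
      refine Finset.sum_congr rfl fun j _ => ?_
      simp only [D]
      linear_combination V (κ₀ j) j * h3
    rw [this, h1, h2]
    simp
  have hnefree : ∀ {i j}, j ∈ covector V (point v) i → covector V (point v) i ≠ ∅ :=
    fun h => ne_empty_of_mem h
  let Φ : (tropicalSystem V).faceSpan v →ₗ[ℝ]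
      boundedDirections V (point v) i₀ × (FreeCoord V (point v) → ℝ) × ℝ :=
    { toFun := fun w => (⟨fun k => if covector V (point v) k = ∅ then 0 else D w k - D w i₀,
        fun j i k hi hk => by
          beta_reduce
          rw [if_neg (hnefree hi), if_neg (hnefree hk), hD w j i k hi hk],
        by simp, fun k hk => if_pos hk⟩, fun k => D w k, w.1.2)
      map_add' := fun w w' => by
        refine Prod.ext (Subtype.ext (funext fun k => ?_)) (Prod.ext (funext fun k => ?_) rfl)
        · by_cases hk : covector V (point v) k = ∅
          · simp [hk]
          · simp [hk, D]
            ring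
        · simp [D]
          ring
      map_smul' := fun r w => by
        refine Prod.ext (Subtype.ext (funext fun k => ?_)) (Prod.ext (funext fun k => ?_) rfl)
        · by_cases hk : covector V (point v) k = ∅
          · simp [hk]
          · simp [hk, D]
            ring
        · simp [D]
          ring }
  have hΦ1 : ∀ w k, covector V (point v) k ≠ ∅ → (Φ w).1.1 k = D w k - D w i₀ :=
    fun w k hk => if_neg hk
  have hΦ2 : ∀ w k, (Φ w).2.1 k = D w k := fun w k => rfl
  have hΦ3 : ∀ w, (Φ w).2.2 = w.1.2 := fun w => rfl
  have hκfree : ∀ j, covector V (point v) (κ₀ j) ≠ ∅ := fun j =>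
    hnefree ((mem_tight_iff hv ht).1 hκ₀ j)
  have hinj : Function.Injective Φ := by
    rw [← LinearMap.ker_eq_bot, LinearMap.ker_eq_bot']
    intro w hw
    have h3 : w.1.2 = 0 := by rw [← hΦ3, hw]; rfl
    have hDw : ∀ k, D w k = w.1.1 k := fun k => by simp [D, h3]
    have h1 : ∀ k, covector V (point v) k ≠ ∅ → D w k = D w i₀ := fun k hk => by
      have := hΦ1 w k hk
      rw [hw] at this
      exact (sub_eq_zero.1 this.symm)
    have h0 : D w i₀ = 0 := by
      have := hD0 w
      rw [Finset.sum_congr rfl fun j _ => h1 _ (hκfree j)] at this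
      simpa [hn] using this
    refine Subtype.ext (Prod.ext (funext fun k => ?_) h3)
    rw [← hDw]
    by_cases hk : covector V (point v) k = ∅
    · rw [← hΦ2 w ⟨k, hk⟩, hw]
      rfl
    · exact (h1 k hk).trans h0
  have hsurj : Function.Surjective Φ := by
    rintro ⟨b, s, t⟩
    -- `boundedDirections` removes the diagonal by the condition at `i₀`, the span of the face by
    -- the vanishing of the sum over `κ₀`; subtracting `c` passes from the first normalization to
    -- the second.
    set c := (∑ j, b.1 (κ₀ j)) / n with hc
    let u : Fin d → ℝ := fun k => if hk : covector V (point v) k = ∅ then s ⟨k, hk⟩ else b.1 k - c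
    have hu : ∀ k, covector V (point v) k ≠ ∅ → u k = b.1 k - c := fun k hk => dif_neg hk
    have hmu := hmem u (fun j i k hi hk => by
      rw [hu i (hnefree hi), hu k (hnefree hk), b.2.1 j i k hi hk]) (by
      rw [Finset.sum_congr rfl fun j _ => hu _ (hκfree j), Finset.sum_sub_distrib]
      simp [hc]
      field_simp
      simp)
    let w : (tropicalSystem V).faceSpan v := ⟨(u, 0), hmu⟩ + (t / v.2) • ⟨v, self_mem_faceSpan v⟩
    have hw2 : w.1.2 = t := by
      simp [w]
      field_simp
    have hDw : ∀ k, D w k = u k := fun k => by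
      simp only [D, hw2]
      simp [w]
    refine ⟨w, Prod.ext (Subtype.ext (funext fun k => ?_)) (Prod.ext (funext fun k => ?_) hw2)⟩
    · by_cases hk : covector V (point v) k = ∅
      · exact (if_pos hk).trans (b.2.2.2 k hk).symm
      · rw [hΦ1 _ _ hk, hDw, hDw, hu _ hk, hu _ (Set.nonempty_iff_ne_empty.1 hi₀), b.2.2.1]
        ring
    · rw [hΦ2, hDw]
      exact dif_pos k.2
  rw [(LinearEquiv.ofBijective Φ ⟨hinj, hsurj⟩).finrank_eq, Module.finrank_prod,
    Module.finrank_prod, Module.finrank_self, Module.finrank_fintype_fun_eq_card,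
    Nat.card_eq_fintype_card, add_assoc]

end tropicalSystem

/-! ### Points of compactified cells -/

section Compact

variable {d n : ℕ} {V : Matrix (Fin d) (Fin n) ℝ} {x : Fin d → ℝ}

theorem isCompact_covectorCell {i₀ : Fin d} (hi₀ : (covector V x i₀).Nonempty)
    (h : ∀ k, (covector V x k).Nonempty) : IsCompact (covectorCell V (covector V x)) := by
  obtain ⟨g, -⟩ := exists_cell_homeomorph hi₀
  have hJ : IsEmpty (FreeCoord V x) := ⟨fun k => (h k.1).ne_empty k.2⟩
  have hcomp : IsCompact (boundedPart V x i₀) := Metric.isCompact_of_isClosed_isBounded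
    (isClosed_setOf_forall_add_nonpos _ _) (isBounded_boundedPart V x hi₀)
  have := isCompact_iff_compactSpace.1 hcomp
  have hc : Continuous fun u : boundedPart V x i₀ => (g ⟨(u, 0), u.2, fun k => le_rfl⟩).1 := by
    fun_prop
  convert isCompact_range hc
  ext p
  constructor
  · intro hp
    refine ⟨⟨(g.symm ⟨p, hp⟩).1.1, (g.symm ⟨p, hp⟩).2.1⟩, ?_⟩
    have : (⟨((g.symm ⟨p, hp⟩).1.1, 0), (g.symm ⟨p, hp⟩).2.1, fun k => le_rfl⟩ :
        {q : boundedDirections V x i₀ × (FreeCoord V x → ℝ) //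
          q.1 ∈ boundedPart V x i₀ ∧ ∀ k, 0 ≤ q.2 k}) = g.symm ⟨p, hp⟩ :=
      Subtype.ext (Prod.ext rfl (Subsingleton.elim _ _))
    simp only [this, g.apply_symm_apply]
  · rintro ⟨u, rfl⟩
    exact Subtype.prop _

theorem some_mem_compactifiedCell {σ : Set (TropicalTorus d)} (hσ : IsClosed σ)
    {p : TropicalTorus d} : OnePoint.some p ∈ compactifiedCell σ ↔ p ∈ σ := by
  have h := OnePoint.isOpenEmbedding_coe.isInducing.closure_eq_preimage_closure_image σ
  rw [hσ.closure_eq] at h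
  exact (Set.ext_iff.1 h p).symm

theorem mk_mem_covectorCell_self : (Submodule.Quotient.mk x : TropicalTorus d) ∈
    covectorCell V (covector V x) := fun _ => subset_rfl

/-- A cell without free coordinates is compact, so its closure adds nothing; with a free coordinate,
`∞` lies on the boundary sphere of the compactified cell. -/
theorem infty_mem_compactifiedCell [Nonempty (Fin d)] {i₀ : Fin d}
    (hi₀ : (covector V x i₀).Nonempty) :
    OnePoint.infty ∈ compactifiedCell (covectorCell V (covector V x)) ↔
      ∃ k, covector V x k = ∅ := by
  have := TropicalTorus.t2Space i₀
  constructor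
  · intro h
    by_contra! hne
    have hc := (isCompact_covectorCell hi₀ hne).image OnePoint.continuous_coe
    have := TropicalTorus.locallyCompactSpace i₀
    rw [compactifiedCell, hc.isClosed.closure_eq] at h
    obtain ⟨p, -, hp⟩ := h
    exact OnePoint.coe_ne_infty p hp
  · intro h
    obtain ⟨φ, hφ⟩ := exists_ball_homeomorph_covectorCell hi₀ rfl
    obtain ⟨y, -, hy⟩ := hφ.ge (Or.inl ⟨rfl, h⟩)
    exact hy ▸ (φ y).2

end Compact

/-! ### The compactified decomposition as a regular cell complex -/

namespace tropicalSystem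

open HomogenizedSystem

variable {d n : ℕ} (V : Matrix (Fin d) (Fin n) ℝ)

/-- The compactified covector cell of the point with homogeneous coordinates `v`. -/
noncomputable def cell (v : (Fin d → ℝ) × ℝ) : Set (OnePoint (TropicalTorus d)) :=
  compactifiedCell (covectorCell V (covector V (point v)))

variable {V}

theorem exists_covector_nonempty [Nonempty (Fin d)] [Nonempty (Fin n)] (x : Fin d → ℝ) :
    ∃ i, (covector V x i).Nonempty := by
  obtain ⟨j⟩ := ‹Nonempty (Fin n)›
  obtain ⟨i, hi⟩ := exists_mem_covector V x j
  exact ⟨i, j, hi⟩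

theorem isClosed_covectorCell_of_nonempty [Nonempty (Fin d)] (H : Fin d → Set (Fin n)) :
    IsClosed (covectorCell V H) := by
  obtain ⟨i⟩ := ‹Nonempty (Fin d)›
  exact isClosed_covectorCell V i H

theorem mem_cell [Nonempty (Fin d)] {v : (Fin d → ℝ) × ℝ} {p : TropicalTorus d} :
    OnePoint.some p ∈ cell V v ↔ ∀ i, covector V (point v) i ⊆ TropicalTorus.covector V p i :=
  some_mem_compactifiedCell (isClosed_covectorCell_of_nonempty _)

theorem mk_mem_cell [Nonempty (Fin d)] (v : (Fin d → ℝ) × ℝ) :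
    OnePoint.some (Submodule.Quotient.mk (point v) : TropicalTorus d) ∈ cell V v :=
  mem_cell.2 fun _ => subset_rfl

variable [Nonempty (Fin d)] [Nonempty (Fin n)]

theorem infty_mem_cell {v : (Fin d → ℝ) × ℝ} :
    OnePoint.infty ∈ cell V v ↔ ∃ k, covector V (point v) k = ∅ := by
  obtain ⟨i, hi⟩ := exists_covector_nonempty (V := V) (point v)
  exact infty_mem_compactifiedCell hi

theorem cell_subset_iff {v v' : (Fin d → ℝ) × ℝ} :
    cell V v ⊆ cell V v' ↔ ∀ i, covector V (point v') i ⊆ covector V (point v) i := by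
  constructor
  · intro h
    exact mem_cell.1 (h (mk_mem_cell v))
  · intro h
    exact closure_mono (Set.image_mono fun p hp i => (h i).trans (hp i))

theorem cell_subset_cell_iff_tight {v v' : (Fin d → ℝ) × ℝ} (hv : (tropicalSystem V).IsPt v)
    (ht : ((tropicalSystem V).tight v).Nonempty) (hv' : (tropicalSystem V).IsPt v')
    (ht' : ((tropicalSystem V).tight v').Nonempty) :
    cell V v ⊆ cell V v' ↔ (tropicalSystem V).tight v' ⊆ (tropicalSystem V).tight v := by
  rw [cell_subset_iff, tight_subset_iff hv ht hv' ht']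

theorem mem_compactifiedDecomposition {τ : Set (OnePoint (TropicalTorus d))} :
    τ ∈ compactifiedDecomposition V ↔ (∃ v, (tropicalSystem V).IsPt v ∧
      ((tropicalSystem V).tight v).Nonempty ∧ cell V v = τ) ∨ τ = {OnePoint.infty} := by
  refine or_congr ?_ Iff.rfl
  constructor
  · rintro ⟨_, ⟨_, ⟨p, rfl⟩, rfl⟩, rfl⟩
    obtain ⟨x, rfl⟩ := Submodule.Quotient.mk_surjective _ p
    obtain ⟨v, hv, ht, hvx⟩ := exists_point_covector_eq (V := V) x
    refine ⟨v, hv, ht, ?_⟩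
    rw [cell, hvx]
    rfl
  · rintro ⟨v, -, -, rfl⟩
    exact ⟨_, ⟨_, ⟨Submodule.Quotient.mk (point v), rfl⟩, rfl⟩, rfl⟩

theorem finite_compactifiedDecomposition (V : Matrix (Fin d) (Fin n) ℝ) :
    (compactifiedDecomposition V).Finite := by
  refine Set.Finite.union (Set.Finite.image _ ?_) (Set.finite_singleton _)
  exact (Set.toFinite (Set.range (covectorCell V))).subset fun σ ⟨H, _, hH⟩ => ⟨H, hH⟩

theorem not_cell_subset_infty (v : (Fin d → ℝ) × ℝ) : ¬ cell V v ⊆ {OnePoint.infty} := fun h =>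
  OnePoint.coe_ne_infty _ (h (mk_mem_cell v))

theorem not_ssubset_singleton_infty {τ : Set (OnePoint (TropicalTorus d))}
    (hτ : τ ∈ compactifiedDecomposition V) : ¬ τ ⊂ {OnePoint.infty} := by
  rcases mem_compactifiedDecomposition.1 hτ with ⟨v, -, -, rfl⟩ | rfl
  · exact fun h => not_cell_subset_infty v h.subset
  · exact fun h => h.ne rfl

theorem singleton_infty_ssubset_cell {v : (Fin d → ℝ) × ℝ} :
    {OnePoint.infty} ⊂ cell V v ↔ ∃ k, covector V (point v) k = ∅ := by
  rw [← infty_mem_cell, ssubset_iff_subset_not_subset, Set.singleton_subset_iff]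
  exact and_iff_left (not_cell_subset_infty v)

/-- The points of the smaller cells of a compactified cell. -/
theorem sUnion_ssubset_cell (v : (Fin d → ℝ) × ℝ) :
    ⋃₀ {τ | τ ∈ compactifiedDecomposition V ∧ τ ⊂ cell V v} =
      {q | q = OnePoint.infty ∧ ∃ k, covector V (point v) k = ∅} ∪
      (OnePoint.some : TropicalTorus d → OnePoint (TropicalTorus d)) ''
        {p | p ∈ covectorCell V (covector V (point v)) ∧
          TropicalTorus.covector V p ≠ covector V (point v)} := by
  ext q
  constructor
  · rintro ⟨τ, ⟨hτ, hss⟩, hq⟩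
    rcases ne_or_eq q OnePoint.infty with h | rfl
    · obtain ⟨p, rfl⟩ := OnePoint.ne_infty_iff_exists.1 h
      refine Or.inr ⟨p, ⟨mem_cell.1 (hss.subset hq), fun hp => ?_⟩, rfl⟩
      rcases mem_compactifiedDecomposition.1 hτ with ⟨v', -, -, rfl⟩ | rfl
      · exact hss.not_subset (cell_subset_iff.2 (hp ▸ mem_cell.1 hq))
      · exact OnePoint.coe_ne_infty _ hq
    · exact Or.inl ⟨rfl, infty_mem_cell.1 (hss.subset hq)⟩
  · rintro (⟨rfl, hk⟩ | ⟨p, ⟨hp, hne⟩, rfl⟩)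
    · exact ⟨_, ⟨mem_compactifiedDecomposition.2 (Or.inr rfl),
        singleton_infty_ssubset_cell.2 hk⟩, rfl⟩
    · obtain ⟨x, rfl⟩ := Submodule.Quotient.mk_surjective _ p
      obtain ⟨v', hv', ht', hvx⟩ := exists_point_covector_eq (V := V) x
      have hx : TropicalTorus.covector V (Submodule.Quotient.mk x) = covector V (point v') :=
        hvx.symm
      rw [hx] at hne
      have hp' : ∀ i, covector V (point v) i ⊆ covector V (point v') i := fun i =>
        (hp i).trans (congrFun hx i).le
      refine ⟨cell V v', ⟨mem_compactifiedDecomposition.2 (Or.inl ⟨v', hv', ht', rfl⟩),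
        cell_subset_iff.2 hp', fun h => hne ?_⟩, mem_cell.2 fun i => (congrFun hx i).ge⟩
      exact funext fun i => (cell_subset_iff.1 h i).antisymm (hp' i)

/-- The finite points of an open cell are those with exactly the covector of the cell, and `∞` is in
the boundary of every other cell that contains it. -/
theorem existsUnique_open_cell (q : OnePoint (TropicalTorus d)) :
    ∃! σ, σ ∈ compactifiedDecomposition V ∧
      q ∈ σ \ ⋃₀ {τ | τ ∈ compactifiedDecomposition V ∧ τ ⊂ σ} := by
  induction q using OnePoint.rec with
  | infty =>
    refine ⟨{OnePoint.infty}, ⟨mem_compactifiedDecomposition.2 (Or.inr rfl), rfl, ?_⟩, ?_⟩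
    · rintro ⟨τ, ⟨hτ, hss⟩, -⟩
      exact not_ssubset_singleton_infty hτ hss
    · rintro σ ⟨hσ, hmem, hnot⟩
      rcases mem_compactifiedDecomposition.1 hσ with ⟨v, -, -, rfl⟩ | rfl
      · rw [sUnion_ssubset_cell] at hnot
        exact absurd (Or.inl ⟨rfl, infty_mem_cell.1 hmem⟩) hnot
      · rfl
  | coe p =>
    have key : ∀ v,
        (OnePoint.some p ∈ cell V v \ ⋃₀ {τ | τ ∈ compactifiedDecomposition V ∧ τ ⊂ cell V v} ↔
          TropicalTorus.covector V p = covector V (point v)) := by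
      intro v
      rw [sUnion_ssubset_cell]
      constructor
      · rintro ⟨h1, h2⟩
        by_contra hne
        exact h2 (Or.inr ⟨p, ⟨mem_cell.1 h1, hne⟩, rfl⟩)
      · intro h
        refine ⟨mem_cell.2 fun i => (congrFun h i).ge, ?_⟩
        rintro (⟨h0, -⟩ | ⟨p', ⟨-, hne⟩, hp'⟩)
        · exact OnePoint.coe_ne_infty p h0
        · exact hne (OnePoint.coe_injective hp' ▸ h)
    obtain ⟨x, rfl⟩ := Submodule.Quotient.mk_surjective _ p
    obtain ⟨v, hv, ht, hvx⟩ := exists_point_covector_eq (V := V) x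
    refine ⟨cell V v, ⟨mem_compactifiedDecomposition.2 (Or.inl ⟨v, hv, ht, rfl⟩),
      (key v).2 hvx.symm⟩, ?_⟩
    rintro σ ⟨hσ, hmem⟩
    rcases mem_compactifiedDecomposition.1 hσ with ⟨v', -, -, rfl⟩ | rfl
    · have h := (key v').1 hmem
      rw [cell, cell, ← h, hvx]
      rfl
    · exact absurd hmem.1 (OnePoint.coe_ne_infty _)

open Classical in
/-- The dimension of a compactified cell. -/
noncomputable def cellDim (V : Matrix (Fin d) (Fin n) ℝ) (σ : Set (OnePoint (TropicalTorus d))) :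
    ℕ :=
  if h : ∃ v, (tropicalSystem V).IsPt v ∧ ((tropicalSystem V).tight v).Nonempty ∧ cell V v = σ then
    -- The span of a face in homogeneous coordinates has one dimension more than the face.
    Module.finrank ℝ ((tropicalSystem V).faceSpan h.choose) - 1
  else 0

theorem cellDim_cell {v : (Fin d → ℝ) × ℝ} (hv : (tropicalSystem V).IsPt v)
    (ht : ((tropicalSystem V).tight v).Nonempty) :
    cellDim V (cell V v) + 1 = Module.finrank ℝ ((tropicalSystem V).faceSpan v) := by
  have hex : ∃ v', (tropicalSystem V).IsPt v' ∧ ((tropicalSystem V).tight v').Nonempty ∧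
    cell V v' = cell V v := ⟨v, hv, ht, rfl⟩
  obtain ⟨hv', ht', h⟩ := hex.choose_spec
  have h1 := (cell_subset_cell_iff_tight hv' ht' hv ht).1 h.le
  have h2 := (cell_subset_cell_iff_tight hv ht hv' ht').1 h.ge
  rw [cellDim, dif_pos hex, faceSpan_congr (h2.antisymm h1)]
  obtain ⟨i, hi⟩ := exists_covector_nonempty (V := V) (point v)
  rw [finrank_faceSpan hv ht hi]
  rfl

theorem cellDim_infty : cellDim V {OnePoint.infty} = 0 := by
  refine dif_neg ?_
  rintro ⟨v, -, -, h⟩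
  exact not_cell_subset_infty v h.le

variable (V) in
/-- The one-point compactification of the covector decomposition. -/
noncomputable def compactification : RegularCellComplex (OnePoint (TropicalTorus d)) where
  cells := compactifiedDecomposition V
  dim := cellDim V
  t2Space := by
    obtain ⟨i⟩ := ‹Nonempty (Fin d)›
    have := TropicalTorus.t2Space i
    have := TropicalTorus.locallyCompactSpace i
    infer_instance
  finite_cells := finite_compactifiedDecomposition V
  exists_homeomorph := by
    intro σ hσ
    rcases mem_compactifiedDecomposition.1 hσ with ⟨v, hv, ht, rfl⟩ | rfl
    · obtain ⟨i, hi⟩ := exists_covector_nonempty (V := V) (point v)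
      have hdim := (cellDim_cell hv ht).trans (finrank_faceSpan hv ht hi)
      obtain ⟨φ, hφ⟩ := exists_ball_homeomorph_covectorCell hi (Nat.succ.inj hdim).symm
      exact ⟨φ, hφ.trans (sUnion_ssubset_cell v).symm⟩
    · have h0 := cellDim_infty (V := V)
      have : IsEmpty (Fin (cellDim V {OnePoint.infty})) := by
        rw [h0]
        infer_instance
      let u : Metric.closedBall
        (0 : EuclideanSpace ℝ (Fin (cellDim V {OnePoint.infty}))) 1 := ⟨0, by simp⟩
      have : Unique (Metric.closedBall
        (0 : EuclideanSpace ℝ (Fin (cellDim V {OnePoint.infty}))) 1) :=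
        ⟨⟨u⟩, fun _ => Subtype.ext (Subsingleton.elim _ _)⟩
      refine ⟨Homeomorph.homeomorphOfUnique _ _, ?_⟩
      rw [Set.sUnion_eq_empty.2 fun τ hτ => absurd hτ.2 (not_ssubset_singleton_infty hτ.1),
        Set.image_eq_empty]
      ext y
      have : (y : EuclideanSpace ℝ (Fin (cellDim V {OnePoint.infty}))) = 0 := Subsingleton.elim _ _
      simp [this]
  existsUnique_open_cell := existsUnique_open_cell

theorem isRealizedBy : (tropicalSystem V).IsRealizedBy (compactification V) (cell V)
    {OnePoint.infty} where
  mem_cells _ := mem_compactifiedDecomposition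
  subset_iff _ _ hv ht hv' ht' := cell_subset_cell_iff_tight hv ht hv' ht'
  not_subset v _ _ := not_cell_subset_infty v
  subset_iff_unbdd v hv ht := by
    rw [Set.singleton_subset_iff, infty_mem_cell, unbdd_iff hv ht]
  dim_cell _ hv ht := cellDim_cell hv ht
  dim_infty := cellDim_infty

end tropicalSystem

/-! ### Lexicographic order and digits in base `n + 1` -/

section Lex

theorem sum_mul_pow_rev_lt {d n : ℕ} {g : Fin d → ℕ} (hg : ∀ i, g i ≤ n) :
    ∑ i, g i * (n + 1) ^ (Fin.rev i : ℕ) < (n + 1) ^ d := by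
  induction d with
  | zero => simp
  | succ d ih =>
    have h := ih (g := fun i => g i.succ) fun i => hg _
    rw [Fin.sum_univ_succ]
    simp only [Fin.rev_succ, Fin.val_castSucc, Fin.rev_zero, Fin.val_last]
    have h0 := Nat.mul_le_mul_right ((n + 1) ^ d) (hg 0)
    rw [pow_succ]
    nlinarith

/-- Entries of `g` are at most `n`, hence digits in base `n + 1`, with index `0` leading. Below the
first difference the digits of `g` add up to less than one unit of that place. -/
theorem sum_mul_pow_rev_lt_of_lex {d n : ℕ} {g g' : Fin d → ℕ} (hg : ∀ i, g i ≤ n)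
    (h : toLex g < toLex g') :
    ∑ i, g i * (n + 1) ^ (Fin.rev i : ℕ) < ∑ i, g' i * (n + 1) ^ (Fin.rev i : ℕ) := by
  obtain ⟨i, hi, hlt⟩ := h
  simp only [Pi.toLex_apply] at hi hlt
  induction d with
  | zero => exact i.elim0
  | succ d ih =>
    rw [Fin.sum_univ_succ, Fin.sum_univ_succ]
    simp only [Fin.rev_succ, Fin.val_castSucc, Fin.rev_zero, Fin.val_last]
    induction i using Fin.cases with
    | zero =>
      have h1 := sum_mul_pow_rev_lt (g := fun i => g i.succ) fun i => hg _
      have h2 := Nat.mul_le_mul_right ((n + 1) ^ d) (Nat.succ_le_of_lt hlt)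
      rw [Nat.succ_mul] at h2
      omega
    | succ i =>
      rw [hi 0 (Fin.succ_pos i)]
      exact Nat.add_lt_add_left (ih (g := fun i => g i.succ) (g' := fun i => g' i.succ)
        (fun i => hg _) i (fun j hj => hi _ (Fin.succ_lt_succ_iff.2 hj)) hlt) _

end Lex

/-! ### A generic functional that separates infinity from the bounded faces -/

namespace tropicalSystem

open HomogenizedSystem

variable {d n : ℕ} {V : Matrix (Fin d) (Fin n) ℝ}

/-- The linear functional with the given coefficients. -/
noncomputable def heightForm (M : ℝ) (η : Fin d → ℝ) : (Fin d → ℝ) × ℝ →ₗ[ℝ] ℝ :=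
  M • LinearMap.snd ℝ _ _ -
    ∑ i, η i • (LinearMap.proj (R := ℝ) (φ := fun _ : Fin d => ℝ) i).comp (LinearMap.fst ℝ _ _)

theorem heightForm_apply (M : ℝ) (η : Fin d → ℝ) (v : (Fin d → ℝ) × ℝ) :
    heightForm M η v = M * v.2 - ∑ i, η i * v.1 i := by
  simp [heightForm]

theorem eq_heightForm (f : (Fin d → ℝ) × ℝ →ₗ[ℝ] ℝ) :
    f = heightForm (f (0, 1)) fun i => -f (Pi.single i 1, 0) := by
  refine LinearMap.ext fun v => ?_
  have hv : v = v.2 • ((0 : Fin d → ℝ), (1 : ℝ)) + ∑ i, v.1 i • (Pi.single i (1 : ℝ), (0 : ℝ)) := by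
    refine Prod.ext ?_ ?_
    · ext k
      simp [Prod.fst_sum, Finset.sum_apply, Pi.single_apply]
    · simp [Prod.snd_sum]
  rw [heightForm_apply]
  conv_lhs => rw [hv]
  rw [map_add, map_smul, map_sum, smul_eq_mul, mul_comm, sub_eq_add_neg, ← Finset.sum_neg_distrib]
  refine congrArg _ (Finset.sum_congr rfl fun i _ => ?_)
  rw [map_smul, smul_eq_mul]
  ring

/-- The form with coefficients `M₀ + 1` and `1` is perturbed to a generic one, by so little that the
bounds on `M` and `η` survive. -/
theorem exists_isGeneric_heightForm (V : Matrix (Fin d) (Fin n) ℝ)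
    (M₀ : ℝ) : ∃ (M : ℝ) (η : Fin d → ℝ), M₀ < M ∧ (∀ i, 0 < η i ∧ η i < 2) ∧
      (tropicalSystem V).IsGeneric (heightForm M η) := by
  obtain ⟨h', hh'⟩ := exists_eventually_isGeneric (tropicalSystem V)
    (heightForm (M₀ + 1) (1 : Fin d → ℝ))
  have h1 := eventually_add_mul_pos (h' (0, 1)) one_pos
  have h2 : ∀ᶠ ε in 𝓝[>] (0 : ℝ), ∀ i, 0 < 1 + ε * -h' (Pi.single i 1, 0) :=
    eventually_all.2 fun i => eventually_add_mul_pos _ one_pos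
  have h3 : ∀ᶠ ε in 𝓝[>] (0 : ℝ), ∀ i, -1 + ε * -h' (Pi.single i 1, 0) < 0 :=
    eventually_all.2 fun i => eventually_add_mul_neg _ (by norm_num)
  obtain ⟨ε, hgen, hM, hpos, hlt⟩ := (hh'.and (h1.and (h2.and h3))).exists
  refine ⟨M₀ + 1 + ε * h' (0, 1), fun i => 1 + ε * -h' (Pi.single i 1, 0), by linarith,
    fun i => ⟨hpos i, by linarith [hlt i]⟩, ?_⟩
  convert hgen using 1
  refine LinearMap.ext fun v => ?_
  rw [LinearMap.add_apply, LinearMap.smul_apply, smul_eq_mul]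
  conv_rhs => rw [eq_heightForm h']
  simp only [heightForm_apply, Pi.one_apply, add_mul, mul_sub, Finset.mul_sum,
    Finset.sum_add_distrib]
  have : ∑ i, ε * -h' (Pi.single i 1, 0) * v.1 i = ∑ i, ε * (-h' (Pi.single i 1, 0) * v.1 i) :=
    Finset.sum_congr rfl fun i _ => by ring
  rw [this]
  ring

theorem exists_bound (V : Matrix (Fin d) (Fin n) ℝ) : ∃ C : ℝ, 0 < C ∧ (∀ i j, |V i j| ≤ C) ∧
    ∀ κ : Fin n → Fin d, |∑ j, V (κ j) j| ≤ C := by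
  have hnn : 0 ≤ ∑ j, ∑ i, |V i j| := Finset.sum_nonneg fun j _ => Finset.sum_nonneg fun i _ =>
    abs_nonneg _
  have h1 : ∀ i j, |V i j| ≤ ∑ i, |V i j| := fun i j =>
    Finset.single_le_sum (f := fun i => |V i j|) (fun i _ => abs_nonneg _) (Finset.mem_univ i)
  refine ⟨∑ j, ∑ i, |V i j| + 1, by linarith, fun i j => ?_, fun κ => ?_⟩
  · have h2 := Finset.single_le_sum (f := fun j => ∑ i, |V i j|)
      (fun j _ => Finset.sum_nonneg fun i _ => abs_nonneg _) (Finset.mem_univ j)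
    linarith [h1 i j]
  · have h2 := Finset.abs_sum_le_sum_abs (fun j => V (κ j) j) Finset.univ
    have h3 := Finset.sum_le_sum fun j (_ : j ∈ Finset.univ) => h1 (κ j) j
    linarith

variable [Nonempty (Fin n)]

/-- The points with bounded cells are bounded. -/
theorem le_of_forall_covector_nonempty {C : ℝ} (hC : ∀ i j, |V i j| ≤ C)
    (hC' : ∀ κ : Fin n → Fin d, |∑ j, V (κ j) j| ≤ C) {v : (Fin d → ℝ) × ℝ}
    (hv : (tropicalSystem V).IsPt v) (ht : ((tropicalSystem V).tight v).Nonempty) {k : Fin d}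
    (hk : (covector V (point v) k).Nonempty) : v.1 k ≤ 3 * C * v.2 := by
  have hz : 0 < v.2 := hv.1
  have hn : (1 : ℝ) ≤ n := by
    exact_mod_cast Fin.pos_iff_nonempty.2 ‹Nonempty (Fin n)›
  obtain ⟨κ, hκ⟩ := ht
  obtain ⟨j, hj⟩ := hk
  rw [mem_covector_point hv] at hj
  have h1 : ∀ l, v.1 k ≤ v.1 l + 2 * C * v.2 := fun l => by
    have h2 := abs_le.1 (hC k j)
    have h3 := abs_le.1 (hC l j)
    nlinarith [hj l]
  have h2 := mem_tight.1 hκ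
  rw [a_apply, Finset.sum_sub_distrib, ← Finset.sum_mul, sub_eq_zero] at h2
  have h3 := Finset.sum_le_sum fun l (_ : l ∈ Finset.univ) => h1 (κ l)
  rw [Finset.sum_add_distrib, ← h2] at h3
  simp only [Finset.sum_const, Finset.card_univ, Fintype.card_fin, nsmul_eq_mul] at h3
  have h4 := mul_le_mul_of_nonneg_right (abs_le.1 (hC' κ)).2 hz.le
  have hC0 : 0 ≤ C := (abs_nonneg _).trans (hC' κ)
  have h5 : C * v.2 ≤ n * (C * v.2) := le_mul_of_one_le_left (mul_nonneg hC0 hz.le) hn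
  have h6 : (n : ℝ) * v.1 k ≤ n * (3 * C * v.2) := by linarith
  exact le_of_mul_le_mul_left h6 (by linarith)

/-- On recession directions only `-∑ η i * u i` is left, with `η` positive and `u` in the orthant.
On bounded faces every coordinate is at most `3 * C * z`, and `η i < 2`, so the sum is at most `6 *
d * C * z`, which `M * z` exceeds. -/
theorem separates_heightForm {C : ℝ} (hC0 : 0 < C) (hC : ∀ i j, |V i j| ≤ C)
    (hC' : ∀ κ : Fin n → Fin d, |∑ j, V (κ j) j| ≤ C) {M : ℝ} {η : Fin d → ℝ}
    (hη : ∀ i, 0 < η i ∧ η i < 2) (hM : 6 * d * C < M) :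
    (tropicalSystem V).Separates (heightForm M η) := by
  constructor
  · intro u hne hz hu
    rw [z_apply] at hz
    rw [heightForm_apply, hz, mul_zero, zero_sub, neg_lt_zero]
    have hnn := nonneg_of_recession hz hu
    refine Finset.sum_pos' (fun i _ => mul_nonneg (hη i).1.le (hnn i)) ?_
    by_contra! h
    refine hne (Prod.ext (funext fun i => le_antisymm ?_ (hnn i)) hz)
    exact nonpos_of_mul_nonpos_right (h i (Finset.mem_univ i)) (hη i).1
  · intro v hv hbdd
    have hz : 0 < v.2 := hv.1
    rcases Set.eq_empty_or_nonempty ((tropicalSystem V).tight v) with ht | ht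
    · rcases isEmpty_or_nonempty (Fin d) with hd | ⟨⟨k⟩⟩
      · rw [heightForm_apply, Finset.univ_eq_empty, Finset.sum_empty, sub_zero]
        have : (d : ℝ) = 0 := by
          by_contra h
          exact hd.elim ⟨0, Nat.pos_of_ne_zero fun h0 => h (by simp [h0])⟩
        rw [this] at hM
        exact mul_pos (by linarith) hz
      · exact absurd (unbdd_of_forall (k := k) fun κ hκ => by simp [ht] at hκ) hbdd
    · rw [unbdd_iff hv ht] at hbdd
      push Not at hbdd
      have h1 : ∑ i, η i * v.1 i ≤ ∑ _i : Fin d, 6 * C * v.2 := by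
        refine Finset.sum_le_sum fun i _ => ?_
        have h2 := le_of_forall_covector_nonempty hC hC' hv ht (hbdd i)
        have h3 : 0 < C * v.2 := mul_pos hC0 hz
        nlinarith [hη i]
      rw [Finset.sum_const, Finset.card_univ, Fintype.card_fin, nsmul_eq_mul] at h1
      rw [heightForm_apply]
      have h2 := mul_lt_mul_of_pos_right hM hz
      linarith

end tropicalSystem

/-! ### Facets, maximal cells and coarse types -/

namespace tropicalSystem

open HomogenizedSystem

variable {d n : ℕ} {V : Matrix (Fin d) (Fin n) ℝ}

/-- The weighted sum of the values of a map. -/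
def weight (κ : Fin n → Fin d) : ℕ := ∑ j, (n + 1) ^ (Fin.rev (κ j) : ℕ)

theorem weight_eq {κ : Fin n → Fin d} {H : Fin d → Set (Fin n)} (hH : ∀ i, H i = {j | κ j = i}) :
    weight κ = ∑ i, (H i).ncard * (n + 1) ^ (Fin.rev i : ℕ) := by
  classical
  rw [weight, ← Finset.sum_fiberwise Finset.univ κ]
  refine Finset.sum_congr rfl fun i _ => ?_
  have h : (H i).ncard = (Finset.univ.filter fun j => κ j = i).card := by
    rw [hH, Set.ncard_eq_toFinset_card']
    simp
  rw [h, ← smul_eq_mul, ← Finset.sum_const]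
  exact Finset.sum_congr rfl fun j hj => by rw [(Finset.mem_filter.1 hj).2]

theorem weight_lt {κ κ' : Fin n → Fin d} {H H' : Fin d → Set (Fin n)}
    (hH : ∀ i, H i = {j | κ j = i}) (hH' : ∀ i, H' i = {j | κ' j = i})
    (h : coarseType H < coarseType H') : weight κ < weight κ' := by
  rw [weight_eq hH, weight_eq hH']
  refine sum_mul_pow_rev_lt_of_lex (fun i => ?_) h
  simpa using Set.ncard_le_card (H i)

/-- A functional of the system is determined up to a multiple of the homogenizing coordinate by
the coarse type. -/
theorem a_sub_a_eq {κ κ' : Fin n → Fin d} {H H' : Fin d → Set (Fin n)}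
    (hH : ∀ i, H i = {j | κ j = i}) (hH' : ∀ i, H' i = {j | κ' j = i})
    (h : coarseType H = coarseType H') (v : (Fin d → ℝ) × ℝ) :
    (tropicalSystem V).a κ v - (tropicalSystem V).a κ' v =
      (∑ j, V (κ j) j - ∑ j, V (κ' j) j) * v.2 := by
  classical
  have key : ∀ (τ : Fin n → Fin d) (G : Fin d → Set (Fin n)), (∀ i, G i = {j | τ j = i}) →
      ∑ j, v.1 (τ j) = ∑ i, (G i).ncard * v.1 i := fun τ G hG => by
    rw [← Finset.sum_fiberwise Finset.univ τ]
    refine Finset.sum_congr rfl fun i _ => ?_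
    have h : (G i).ncard = (Finset.univ.filter fun j => τ j = i).card := by
      rw [hG, Set.ncard_eq_toFinset_card']
      simp
    rw [h, ← nsmul_eq_mul, ← Finset.sum_const]
    exact Finset.sum_congr rfl fun j hj => by rw [(Finset.mem_filter.1 hj).2]
  have hc : ∀ i, (H i).ncard = (H' i).ncard := fun i => congrFun (congrArg ofLex h) i
  simp only [a_apply, Finset.sum_sub_distrib, key κ H hH, key κ' H' hH', hc, sub_mul,
    Finset.sum_mul]
  ring

section Top

variable {x : (Fin d → ℝ) × ℝ} (hx : (tropicalSystem V).IsPt x)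
  (hx0 : (tropicalSystem V).tight x = ∅)

include hx0 in
theorem mem_faceSpan_of_tight_eq_empty (w : (Fin d → ℝ) × ℝ) :
    w ∈ (tropicalSystem V).faceSpan x := mem_faceSpan.2 fun κ hκ => by simp [hx0] at hκ

include hx0 in
theorem finrank_faceSpan_of_tight_eq_empty :
    Module.finrank ℝ ((tropicalSystem V).faceSpan x) = d + 1 := by
  have : (tropicalSystem V).faceSpan x = ⊤ :=
    eq_top_iff.2 fun w _ => mem_faceSpan_of_tight_eq_empty hx0 w
  rw [this, finrank_top, Module.finrank_prod, Module.finrank_fintype_fun_eq_card, Fintype.card_fin,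
    Module.finrank_self]

variable [Nonempty (Fin n)]

-- If `j` were also in `G_i` for some `i ≠ κ j`, changing `κ j` to `i` would give a second
-- functional of the same facet, hence a proportional one. The values on the diagonal agree, so the
-- factor is one, but the values on the `i`-th unit vector differ.
include hx hx0 in
theorem covector_eq_of_isFacet {y : (Fin d → ℝ) × ℝ} (hy : (tropicalSystem V).IsFacet y x)
    {κ : Fin n → Fin d} (hκ : κ ∈ (tropicalSystem V).tight y) (i : Fin d) :
    covector V (point y) i = {j | κ j = i} := by
  have hnx : ∀ τ, τ ∉ (tropicalSystem V).tight x := fun τ => by simp [hx0]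
  ext j
  refine ⟨fun hj => ?_, fun hj => (mem_covector_point_iff hy.1 ⟨κ, hκ⟩).2 ⟨κ, hκ, hj⟩⟩
  by_contra hne
  obtain ⟨γ, -, hγ⟩ := hy.exists_pos_mul hx hκ (hnx _) (update_mem_tight hy.1 hκ hj) (hnx _)
  have h1 := hγ (1, 0) (mem_faceSpan_of_tight_eq_empty hx0 _)
  have h2 := hγ (Pi.single i 1, 0) (mem_faceSpan_of_tight_eq_empty hx0 _)
  have h3 := a_update (V := V) κ j i (1, 0)
  have h4 := a_update (V := V) κ j i (Pi.single i 1, 0)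
  have hn : (n : ℝ) ≠ 0 := by
    exact_mod_cast (Fin.pos_iff_nonempty.2 ‹Nonempty (Fin n)›).ne'
  have h5 : (tropicalSystem V).a κ (1, 0) = -n := by simp [a_apply]
  have hγ1 : γ = 1 := by
    have h6 : (tropicalSystem V).a (Function.update κ j i) (1, 0) = -n := by simp [a_apply]
    rw [h5, h6] at h1
    have : n * (γ - 1) = 0 := by linarith
    linarith [(mul_eq_zero.1 this).resolve_left hn]
  rw [hγ1, one_mul] at h2
  rw [← h2] at h4
  have hne' : κ j ≠ i := hne
  simp [hne'] at h4

-- A point with no tight inequality represents the whole polyhedron, which is unbounded; so every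
-- cell, including `∞`, comes from a proper face.
include hx0 in
theorem properFaces_eq [Nonempty (Fin d)] :
    (tropicalSystem V).properFaces (cell V) {OnePoint.infty} x =
      (compactification V).cells := by
  ext τ
  refine Iff.trans (or_congr (exists_congr fun v => and_congr_right fun hv => ?_) ?_)
    (isRealizedBy.mem_cells τ).symm
  · rw [hx0, Set.empty_ssubset]
  · obtain ⟨k⟩ := ‹Nonempty (Fin d)›
    exact and_iff_left (unbdd_of_forall (k := k) fun κ hκ => by simp [hx0] at hκ)

-- Compactifying preserves and reflects inclusions of covector cells, and `{∞}` contains none of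
-- them. Maximality may thus be tested among the proper faces of the polyhedron.
include hx hx0 in
theorem isMaximalCovector_iff (hd : 2 ≤ d) {h : (Fin d → ℝ) × ℝ →ₗ[ℝ] ℝ}
    (hh : (tropicalSystem V).Separates h) {H : Fin d → Set (Fin n)} :
    IsMaximalCovector V H ↔ ∃ y, (tropicalSystem V).IsFacet y x ∧ covector V (point y) = H := by
  have : Nonempty (Fin d) := ⟨⟨0, by omega⟩⟩
  have hdim : 3 ≤ Module.finrank ℝ ((tropicalSystem V).faceSpan x) := by
    rw [finrank_faceSpan_of_tight_eq_empty hx0]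
    omega
  have hsub : ∀ v v', covectorCell V (covector V (point v)) ⊆ covectorCell V (covector V (point v'))
      ↔ cell V v ⊆ cell V v' := fun v v' => by
    rw [cell_subset_iff]
    exact ⟨fun h => h (mk_mem_covectorCell_self (x := point v)),
      fun h p hp i => (h i).trans (hp i)⟩
  have hmax : ∀ v, (tropicalSystem V).IsPt v → ((tropicalSystem V).tight v).Nonempty →
      (Maximal (fun σ => σ ∈ covectorDecomposition V) (covectorCell V (covector V (point v))) ↔
        ∃ y, (tropicalSystem V).IsFacet y x ∧ cell V y = cell V v) := by
    intro v hv ht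
    rw [← maximal_properFaces_iff pointed hh isRealizedBy hx hdim, properFaces_eq hx0]
    constructor
    · rintro ⟨-, h⟩
      refine ⟨mem_compactifiedDecomposition.2 (Or.inl ⟨v, hv, ht, rfl⟩), fun τ hτ hle => ?_⟩
      rcases mem_compactifiedDecomposition.1 hτ with ⟨v', -, -, rfl⟩ | rfl
      · exact (hsub _ _).1 (h ⟨_, ⟨Submodule.Quotient.mk (point v'), rfl⟩, rfl⟩ ((hsub _ _).2 hle))
      · exact absurd hle (not_cell_subset_infty v)
    · rintro ⟨-, h⟩
      refine ⟨⟨_, ⟨Submodule.Quotient.mk (point v), rfl⟩, rfl⟩, ?_⟩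
      rintro _ ⟨_, ⟨p, rfl⟩, rfl⟩ hle
      obtain ⟨z, rfl⟩ := Submodule.Quotient.mk_surjective _ p
      obtain ⟨v', hv', ht', hvz⟩ := exists_point_covector_eq (V := V) z
      rw [TropicalTorus.covector_mk, ← hvz] at hle ⊢
      exact (hsub _ _).2 (h (mem_compactifiedDecomposition.2 (Or.inl ⟨v', hv', ht', rfl⟩))
        ((hsub _ _).1 hle))
  constructor
  · rintro ⟨⟨p, rfl⟩, hp⟩
    obtain ⟨z, rfl⟩ := Submodule.Quotient.mk_surjective _ p
    obtain ⟨v, hv, ht, hvz⟩ := exists_point_covector_eq (V := V) z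
    rw [TropicalTorus.covector_mk, ← hvz] at hp ⊢
    obtain ⟨y, hy, heq⟩ := (hmax v hv ht).1 hp
    refine ⟨y, hy, ?_⟩
    rwa [isRealizedBy.eq_iff hy.1 hy.nonempty hv ht, tight_eq_iff hv ht hy.1 hy.nonempty] at heq
  · rintro ⟨y, hy, rfl⟩
    exact ⟨⟨Submodule.Quotient.mk (point y), rfl⟩, (hmax y hy.1 hy.nonempty).2 ⟨y, hy, rfl⟩⟩

-- The two functionals differ by a multiple of `z`, so the facets are parallel. Since `y` and `y'`
-- satisfy both inequalities, this multiple has both signs and is zero; hence `κ'` is tight at `y`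
-- too.
include hx hx0 in
theorem eq_of_coarseType_eq {y y' : (Fin d → ℝ) × ℝ} (hy : (tropicalSystem V).IsFacet y x)
    (hy' : (tropicalSystem V).IsFacet y' x)
    (h : coarseType (covector V (point y)) = coarseType (covector V (point y'))) :
    covector V (point y) = covector V (point y') := by
  obtain ⟨κ, hκ⟩ := hy.nonempty
  obtain ⟨κ', hκ'⟩ := hy'.nonempty
  have hH := covector_eq_of_isFacet hx hx0 hy hκ
  have hH' := covector_eq_of_isFacet hx hx0 hy' hκ'
  have h1 := a_sub_a_eq (V := V) hH hH' h
  have hz : 0 < y.2 := hy.1.1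
  have hz' : 0 < y'.2 := hy'.1.1
  have h2 := h1 y
  have h3 := h1 y'
  rw [mem_tight.1 hκ] at h2
  rw [mem_tight.1 hκ'] at h3
  have h4 : 0 ≤ ∑ j, V (κ j) j - ∑ j, V (κ' j) j := by
    refine nonneg_of_mul_nonneg_left ?_ hz
    linarith [hy.1.2 κ']
  have h5 : ∑ j, V (κ j) j - ∑ j, V (κ' j) j ≤ 0 := by
    refine nonpos_of_mul_nonpos_left ?_ hz'
    linarith [hy'.1.2 κ]
  rw [le_antisymm h5 h4, zero_mul, zero_sub, neg_eq_zero] at h2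
  exact funext fun i => (covector_eq_of_isFacet hx hx0 hy (κ := κ') h2 i).trans (hH' i).symm

end Top

/-- Lines close to the diagonal meet the facets in the order of their weights. -/
theorem sweepParam_lt_of_weight_lt [Nonempty (Fin n)] {C E α β : ℝ}
    (hC' : ∀ κ : Fin n → Fin d, |∑ j, V (κ j) j| ≤ C) (hα : 0 ≤ α) (hβ : 0 ≤ β)
    (hE : ∀ i : Fin d, ((n : ℝ) + 1) ^ (Fin.rev i : ℕ) ≤ E) (hαC : α * C < 1)
    (hsmall : 2 * β * C + 2 * α * E * C < 1) {κ κ' : Fin n → Fin d} (h : weight κ < weight κ') :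
    (tropicalSystem V).sweepParam (fun i => ((n : ℝ) + 1) ^ (Fin.rev i : ℕ), β) (1, α) κ' <
      (tropicalSystem V).sweepParam (fun i => ((n : ℝ) + 1) ^ (Fin.rev i : ℕ), β) (1, α) κ := by
  have hn : (1 : ℝ) ≤ n := by
    exact_mod_cast Fin.pos_iff_nonempty.2 ‹Nonempty (Fin n)›
  have hp : ∀ τ : Fin n → Fin d, (tropicalSystem V).a τ (1, α) = (∑ j, V (τ j) j) * α - n :=
    fun τ => by simp [a_apply, Finset.sum_mul]
  have hw : ∀ τ : Fin n → Fin d,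
      (tropicalSystem V).a τ (fun i => ((n : ℝ) + 1) ^ (Fin.rev i : ℕ), β) =
        (∑ j, V (τ j) j) * β - weight τ := fun τ => by
    simp [a_apply, Finset.sum_mul, weight]
  have hneg : ∀ τ : Fin n → Fin d, 0 < -((∑ j, V (τ j) j) * α - n) := fun τ => by
    have := mul_le_mul_of_nonneg_right (abs_le.1 (hC' τ)).2 hα
    linarith
  have hS : ∀ τ : Fin n → Fin d, (weight τ : ℝ) ≤ n * E := fun τ => by
    have := Finset.sum_le_sum fun j (_ : j ∈ Finset.univ) => hE (τ j)
    simpa [weight] using this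
  -- After clearing denominators the `α * β` terms cancel. The main term is `n` times the difference
  -- of the weights, so at least `n`, while `hsmall` keeps the terms in `α` and `β` below `n`.
  rw [sweepParam, sweepParam, hp, hp, hw, hw, div_lt_div_iff₀ (hneg _) (hneg _)]
  have h1 : (weight κ : ℝ) + 1 ≤ weight κ' := by exact_mod_cast h
  have hv := abs_le.1 (hC' κ)
  have hv' := abs_le.1 (hC' κ')
  set v := ∑ j, V (κ j) j
  set v' := ∑ j, V (κ' j) j
  have hC0 : 0 ≤ C := by linarith
  have h2 : β * n * (v' - v) ≤ β * n * (2 * C) :=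
    mul_le_mul_of_nonneg_left (by linarith) (by positivity)
  have h3 : (weight κ' : ℝ) * v ≤ n * E * C :=
    (mul_le_mul_of_nonneg_left hv.2 (Nat.cast_nonneg _)).trans
      (mul_le_mul_of_nonneg_right (hS κ') hC0)
  have h4 : -(weight κ * v' : ℝ) ≤ n * E * C := by
    rw [← mul_neg]
    exact (mul_le_mul_of_nonneg_left (by linarith) (Nat.cast_nonneg _)).trans
      (mul_le_mul_of_nonneg_right (hS κ) hC0)
  have h5 : α * (weight κ' * v - weight κ * v') ≤ α * (2 * (n * E * C)) :=
    mul_le_mul_of_nonneg_left (by linarith) hα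
  have h6 := mul_lt_mul_of_pos_left hsmall (by linarith : (0 : ℝ) < n)
  have h7 := mul_le_mul_of_nonneg_left h1 (by linarith : (0 : ℝ) ≤ n)
  linarith

theorem exists_isPt_tight_eq_empty [Nonempty (Fin n)] (V : Matrix (Fin d) (Fin n) ℝ) :
    ∃ x, (tropicalSystem V).IsPt x ∧ (tropicalSystem V).tight x = ∅ := by
  obtain ⟨C, hC0, -, hC⟩ := exists_bound V
  have hn : (1 : ℝ) ≤ n := by
    exact_mod_cast Fin.pos_iff_nonempty.2 ‹Nonempty (Fin n)›
  have ha : ∀ κ, (tropicalSystem V).a κ (fun _ => C + 1, 1) < 0 := fun κ => by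
    simp only [a_apply, mul_one, Finset.sum_sub_distrib, Finset.sum_const, Finset.card_univ,
      Fintype.card_fin, nsmul_eq_mul]
    nlinarith [abs_le.1 (hC κ)]
  refine ⟨(fun _ => C + 1, 1), ⟨one_pos, fun κ => (ha κ).le⟩, ?_⟩
  exact Set.eq_empty_of_forall_notMem fun κ hκ => (ha κ).ne hκ

end tropicalSystem

/-! ### The line that realizes the lexicographic order -/

open HomogenizedSystem tropicalSystem in
theorem mainTheorem4 (d n : ℕ) (hd : 2 ≤ d) (hn : 1 ≤ n) (V : Matrix (Fin d) (Fin n) ℝ) :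
    ∃ K : RegularCellComplex (OnePoint (TropicalTorus d)),
      K.cells = compactifiedDecomposition V ∧
      ∃ L : List (Fin d → Set (Fin n)),
        (∀ H, H ∈ L ↔ IsMaximalCovector V H) ∧
        L.Pairwise (fun H H' => coarseType H < coarseType H') ∧
        K.IsShelling K.cells (L.map (fun H => compactifiedCell (covectorCell V H))) := by
  have : Nonempty (Fin d) := ⟨⟨0, by omega⟩⟩
  have : Nonempty (Fin n) := ⟨⟨0, by omega⟩⟩
  refine ⟨compactification V, rfl, ?_⟩
  obtain ⟨C, hC0, hC, hC'⟩ := exists_bound V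
  obtain ⟨x, hx, hx0⟩ := exists_isPt_tight_eq_empty V
  set E : ℝ := ∑ i : Fin d, ((n : ℝ) + 1) ^ (Fin.rev i : ℕ) with hEdef
  have hE : ∀ i : Fin d, ((n : ℝ) + 1) ^ (Fin.rev i : ℕ) ≤ E := fun i =>
    Finset.single_le_sum (f := fun i : Fin d => ((n : ℝ) + 1) ^ (Fin.rev i : ℕ))
      (fun i _ => by positivity) (Finset.mem_univ i)
  have hE0 : 0 ≤ E := Finset.sum_nonneg fun i _ => by positivity
  -- The term `6 * d * C` gives separation and `α * C < 1`; the term `4 * E * C * (d + 1)` gives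
  -- `hsmall`, because `α * M ≤ 2 * d` and `β * M ≤ 2 * E`; the `1` makes `M` positive.
  obtain ⟨M, η, hM, hη, hgen⟩ := exists_isGeneric_heightForm V
    (6 * d * C + 4 * E * C * (d + 1) + 1)
  have hEC : 0 ≤ E * C := by positivity
  have hdC : 0 ≤ d * C := by positivity
  have hdEC : 0 ≤ E * C * d := by positivity
  have hM0 : 0 < M := by linarith
  have hh : (tropicalSystem V).Separates (heightForm M η) :=
    separates_heightForm hC0 hC hC' hη (by linarith)
  have hdim : 3 ≤ Module.finrank ℝ ((tropicalSystem V).faceSpan x) := by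
    rw [finrank_faceSpan_of_tight_eq_empty hx0]
    omega
  have hmax := fun H => isMaximalCovector_iff hx hx0 hd hh (H := H)
  -- The sorting lemma lists values in decreasing order, hence the dual order. It keeps one covector
  -- for each coarse type, and none is lost because maximal cells have distinct coarse types.
  obtain ⟨L, hL, hL', hsort⟩ := List.exists_pairwise_of_finite_image {H | IsMaximalCovector V H}
    (fun H => OrderDual.toDual (coarseType H)) (Set.toFinite _)
  have hLmem : ∀ H, H ∈ L ↔ IsMaximalCovector V H := fun H => by
    refine ⟨fun h => hL H h, fun h => ?_⟩
    obtain ⟨H', hH', heq⟩ := hL' H h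
    obtain ⟨y, hy, rfl⟩ := (hmax H).1 h
    obtain ⟨y', hy', rfl⟩ := (hmax H').1 (hL H' hH')
    rwa [← eq_of_coarseType_eq hx hx0 hy' hy heq]
  refine ⟨L, hLmem, hsort, ?_⟩
  choose! Y hY hYcov using fun H (hH : H ∈ L) => (hmax H).1 (hL H hH)
  have hcells : L.map (fun H => compactifiedCell (covectorCell V H)) = (L.map Y).map (cell V) := by
    rw [List.map_map]
    refine List.map_congr_left fun H hH => ?_
    rw [Function.comp_apply, cell, hYcov H hH]
  -- `α` and `β` are the homogenizing coordinates that place the diagonal vector and the vector of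
  -- powers in the kernel of `heightForm M η`, as a sweep of an unbounded face requires.
  set α : ℝ := (∑ i, η i) / M with hαdef
  set β : ℝ := (∑ i, η i * ((n : ℝ) + 1) ^ (Fin.rev i : ℕ)) / M with hβdef
  have hα : 0 ≤ α := div_nonneg (Finset.sum_nonneg fun i _ => (hη i).1.le) hM0.le
  have hβ : 0 ≤ β := div_nonneg (Finset.sum_nonneg fun i _ =>
    mul_nonneg (hη i).1.le (by positivity)) hM0.le
  have hαM : α * M ≤ 2 * d := by
    rw [hαdef, div_mul_cancel₀ _ hM0.ne']
    have := Finset.sum_le_sum fun i (_ : i ∈ Finset.univ) => (hη i).2.le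
    simpa [mul_comm] using this
  have hβM : β * M ≤ 2 * E := by
    rw [hβdef, div_mul_cancel₀ _ hM0.ne', hEdef, Finset.mul_sum]
    exact Finset.sum_le_sum fun i _ => mul_le_mul_of_nonneg_right (hη i).2.le (by positivity)
  have hαC : α * C < 1 := by
    refine lt_of_mul_lt_mul_right ?_ hM0.le
    have := mul_le_mul_of_nonneg_right hαM hC0.le
    linarith
  have hsmall : 2 * β * C + 2 * α * E * C < 1 := by
    refine lt_of_mul_lt_mul_right ?_ hM0.le
    have h1 := mul_le_mul_of_nonneg_right hαM hEC
    have h2 := mul_le_mul_of_nonneg_right hβM hC0.le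
    linarith
  have hlt := fun κ κ' : Fin n → Fin d =>
    sweepParam_lt_of_weight_lt (κ := κ) (κ' := κ') hC' hα hβ hE hαC hsmall
  rw [hcells, ← properFaces_eq hx0]
  refine isShelling_of_isSweepOrder pointed hh isRealizedBy hx hdim
    (w := (fun i => ((n : ℝ) + 1) ^ (Fin.rev i : ℕ), β)) (p := (1, α)) ⟨?_, ?_, ?_, ?_, ?_⟩
    ⟨?_, ?_, ?_⟩ fun y hy => hasVisibleShellings pointed hh hgen isRealizedBy hy.1
  · exact mem_faceSpan_of_tight_eq_empty hx0 _
  · exact mem_faceSpan_of_tight_eq_empty hx0 _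
  · intro κ _
    have h1 : (tropicalSystem V).a κ (1, α) = (∑ j, V (κ j) j) * α - n := by
      simp [a_apply, Finset.sum_mul]
    have h2 := mul_le_mul_of_nonneg_right (abs_le.1 (hC' κ)).2 hα
    have h3 : (1 : ℝ) ≤ n := by exact_mod_cast hn
    rw [h1]
    linarith
  · intro _
    rw [heightForm_apply, hβdef, mul_div_cancel₀ _ hM0.ne', sub_self]
  · intro _
    rw [heightForm_apply, hαdef, mul_div_cancel₀ _ hM0.ne']
    simp
  · intro y hy
    obtain ⟨H, hH, rfl⟩ := List.mem_map.1 hy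
    exact hY H hH
  · intro y hy
    have hH : covector V (point y) ∈ L := (hLmem _).2 ((hmax _).2 ⟨y, hy, rfl⟩)
    refine ⟨Y (covector V (point y)), List.mem_map_of_mem hH, ?_⟩
    rw [tight_eq_iff hy.1 hy.nonempty (hY _ hH).1 (hY _ hH).nonempty]
    exact hYcov _ hH
  · rw [List.pairwise_map]
    refine hsort.imp_of_mem fun {H H'} hH hH' hHH' s hs _ s' hs' _ => hlt _ _ ?_
    refine weight_lt (covector_eq_of_isFacet hx hx0 (hY H hH) hs)
      (covector_eq_of_isFacet hx hx0 (hY H' hH') hs') ?_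
    rw [hYcov H hH, hYcov H' hH']
    exact hHH'
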